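/- Undirected Geography is the impartial game played under normal play on a position $(G,s)$, where $G=(V,E)$ is a finite simple undirected graph and $s\in V$ is the vertex carrying the token: a move takes the token from its current vertex to an adjacent vertex and deletes the vertex it left, and a player who cannot move loses. The Grundy value of a position is the least non-negative integer that is not the Grundy value of a position reachable from it in one move (so it is $0$ if there is no move). Let $D\ge 0$ and $\Delta\ge 1$ be integers and let $c$ be a real number, all constant. There is an algorithm which, given a graph $G$ with $n\ge 1$ vertices (as an adjacency matrix) and a vertex $s$ of $G$ such that at most $c\log_2 n$ vertices of $G$ have degree in the range $[4,\Delta+1]$ and at most $D$ vertices of $G$ have degree more than $\Delta$, computes the Grundy value of the Undirected Geography position $(G,s)$ in time $O\!\left(n^{D+c\log_2\Delta+3}\right)$, where the implied constant depends only on $D$, $\Delta$ and $c$. Time is measured in steps of a unit-cost random access machine with words of $O(\log (n+1))$ bits. -/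

import Mathlib

/-! ### Undirected Geography and its Grundy values -/

/-- The minimum excluded value of a set of natural numbers (used only for finite sets). -/
noncomputable def mex (S : Set ℕ) : ℕ := sInf {k | k ∉ S}

namespace UndirectedGeography

/-- Grundy value of the position in which the token lies on `s` and `R` is the set of the
other vertices that have not been removed yet. A move takes the token from `s` to a
neighbour `v ∈ R` and removes `s`; the vertices left besides `v` are then `R.erase v`. -/
noncomputable def nimberAt {V : Type*} [DecidableEq V] (G : SimpleGraph V)
    (R : Finset V) (s : V) : ℕ :=
  mex {k | ∃ v, ∃ _ : v ∈ R, G.Adj s v ∧ nimberAt G (R.erase v) v = k}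
termination_by R.card
decreasing_by exact Finset.card_erase_lt_of_mem ‹_›

/-- Grundy value of the Undirected Geography position `(G, s)`. -/
noncomputable def nimber {V : Type*} [Fintype V] [DecidableEq V] (G : SimpleGraph V)
    (s : V) : ℕ :=
  nimberAt G (Finset.univ.erase s) s

end UndirectedGeography

/-! ### A unit-cost word RAM

Programs are structured (assignment, store, sequencing, branching, loops). Registers and
memory cells hold words of `w` bits; every operation, memory access, assignment and branch
costs one step. The word length `w` is a parameter of the semantics. -/

namespace WordRAM

/-- Binary operations on words. -/
inductive Op where
  | add | sub | mul | div | mod | lt | eq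

/-- The value of an operation before reduction to a word. Subtraction is cut off at `0`;
the comparisons return `1` for true and `0` for false. -/
def Op.apply : Op → ℕ → ℕ → ℕ
  | .add, a, b => a + b
  | .sub, a, b => a - b
  | .mul, a, b => a * b
  | .div, a, b => a / b
  | .mod, a, b => a % b
  | .lt, a, b => if a < b then 1 else 0
  | .eq, a, b => if a = b then 1 else 0

/-- Expressions: constants, registers, memory reads (indirect addressing), operations. -/
inductive Exp where
  | lit (a : ℕ)
  | reg (r : ℕ)
  | load (addr : Exp)
  | op (o : Op) (e₁ e₂ : Exp)

/-- Programs. -/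
inductive Prog where
  | skip
  | assign (r : ℕ) (e : Exp)
  | store (addr e : Exp)
  | seq (p q : Prog)
  | ite (b : Exp) (p q : Prog)
  | loop (b : Exp) (p : Prog)

/-- Contents of the registers and of the memory. -/
structure State where
  reg : ℕ → ℕ
  mem : ℕ → ℕ

/-- Value of an expression on a machine with `w`-bit words: constants and results of
operations are reduced modulo `2 ^ w`. -/
def Exp.val (w : ℕ) (σ : State) : Exp → ℕ
  | .lit a => a % 2 ^ w
  | .reg r => σ.reg r
  | .load a => σ.mem (a.val w σ)
  | .op o e₁ e₂ => o.apply (e₁.val w σ) (e₂.val w σ) % 2 ^ w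

/-- Number of steps needed to evaluate an expression. -/
def Exp.cost : Exp → ℕ
  | .lit _ => 1
  | .reg _ => 1
  | .load a => a.cost + 1
  | .op _ e₁ e₂ => e₁.cost + e₂.cost + 1

/-- `Exec w p σ t τ`: on a machine with `w`-bit words, program `p` started in state `σ`
halts after `t` steps in state `τ`. The test of a branch or of a loop succeeds when its
value is not `0`. -/
inductive Exec (w : ℕ) : Prog → State → ℕ → State → Prop where
  | skip (σ : State) : Exec w .skip σ 1 σ
  | assign (σ : State) (r : ℕ) (e : Exp) :
      Exec w (.assign r e) σ (e.cost + 1) ⟨Function.update σ.reg r (e.val w σ), σ.mem⟩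
  | store (σ : State) (a e : Exp) :
      Exec w (.store a e) σ (a.cost + e.cost + 1)
        ⟨σ.reg, Function.update σ.mem (a.val w σ) (e.val w σ)⟩
  | seq {p q : Prog} {σ τ υ : State} {t₁ t₂ : ℕ} :
      Exec w p σ t₁ τ → Exec w q τ t₂ υ → Exec w (.seq p q) σ (t₁ + t₂) υ
  | ite_true {b : Exp} {p q : Prog} {σ τ : State} {t : ℕ} :
      b.val w σ ≠ 0 → Exec w p σ t τ → Exec w (.ite b p q) σ (b.cost + 1 + t) τ
  | ite_false {b : Exp} {p q : Prog} {σ τ : State} {t : ℕ} :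
      b.val w σ = 0 → Exec w q σ t τ → Exec w (.ite b p q) σ (b.cost + 1 + t) τ
  | loop_true {b : Exp} {p : Prog} {σ τ υ : State} {t₁ t₂ : ℕ} :
      b.val w σ ≠ 0 → Exec w p σ t₁ τ → Exec w (.loop b p) τ t₂ υ →
      Exec w (.loop b p) σ (b.cost + 1 + t₁ + t₂) υ
  | loop_false {b : Exp} {p : Prog} {σ : State} :
      b.val w σ = 0 → Exec w (.loop b p) σ (b.cost + 1) σ

/-- Start state on input `(G, s)`, where `G` has the vertices `0, …, n - 1`: register `0`
holds `n`, register `1` holds `s`, memory cell `i * n + j` holds the entry `(i, j)` of the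
adjacency matrix for `i, j < n`, and everything else is `0`. -/
def graphInput {n : ℕ} (G : SimpleGraph (Fin n)) [DecidableRel G.Adj] (s : Fin n) :
    State where
  reg r := if r = 0 then n else if r = 1 then (s : ℕ) else 0
  mem a := if ∃ i j : Fin n, a = (i : ℕ) * n + j ∧ G.Adj i j then 1 else 0

end WordRAM

/-! ### Matchings as involutions -/

namespace Matching

open Finset

/-! Value zero is a matching condition. The player to move from `v` loses exactly when some maximum
matching of the remaining graph, `v` included, misses `v` (`nimberAt_eq_zero_iff_miss`). Both sides
obey the same recursion: `v` can be missed iff no neighbour `w` of `v` is missed by a maximum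
matching of the graph without `v` (`miss_insert_iff`). So one computation of the set of vertices
missed by maximum matchings, run on the graph without `v`, tells which options of the position at
`v` have value 0.

The algorithm is a depth first search that never enters an option of value 0. Every position it
enters below the root has nonzero value, so it has an option of value 0, which is skipped. The token
also arrived along an edge, so one more neighbour is gone. Hence at most `deg v - 2` options are
entered (`card_entered_le`): at most one for degree at most 3, fewer than `Δ` for degree in `[4, Δ +
1]`, and trivially at most `n` otherwise. Along a play each vertex carries the token at most once,
so the tree has at most a linear factor times the product of these bounds as nodes (`nodes_le`,
`nodes_root_le`). This is `O(n * Δ ^ q * n ^ D)` with `q ≤ c * log₂ n`, and `Δ ^ (c * log₂ n) = n ^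
(c * log₂ Δ)`.

It remains to spend only `O(n ^ 2)` steps per node. A maximum matching is carried along: entering
`w`, which no maximum matching misses, just deletes `w` and frees its partner (`opt_cut`), and this
is undone on return. From a maximum matching the missed vertices are found by one alternating search
with blossoms. Each outer vertex `x` owns an explicit matching, its row, that misses `x` and has the
same defect. A new row is glued from two old ones in linear time (`glue_isMat`, `fx_glue`), so no
alternating path is ever traced back. Blossoms closed by an edge are contracted one base at a time
(`LInv.lift`, `LInv.merge`), and each step makes one new vertex outer, which pays for its linear
cost. When all outer vertices have been scanned, a Tutte–Berge count (`certificate`) shows that no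
other vertex can be missed (`SInv.outer_iff_miss`). The first maximum matching is built by adding
the vertices one by one, in cubic time.

The program is written in a small language with named arrays over the word RAM; a clock in the
abstract state bounds the true running time, so correctness and cost are proved together. -/

/-- An involution with finitely many fixed points has as many of them as its domain, mod `2`. -/
theorem card_fixed_modEq (A : Finset ℕ) (N : ℕ → ℕ) (h : ∀ v ∈ A, N v ∈ A ∧ N (N v) = v) :
    (#{v ∈ A | N v = v} : ZMod 2) = (#A : ZMod 2) := by
  have h0 : ∑ _v ∈ A.filter (fun v => ¬ N v = v), (1 : ZMod 2) = 0 := by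
    refine Finset.sum_involution (fun v _ => N v) (fun _ _ => by decide) ?_ ?_ ?_
    · intro v hv _
      exact (mem_filter.1 hv).2
    · intro v hv
      obtain ⟨hv, hne⟩ := mem_filter.1 hv
      refine mem_filter.2 ⟨(h v hv).1, ?_⟩
      rw [(h v hv).2]
      exact fun h => hne h.symm
    · intro v hv
      exact (h v (mem_filter.1 hv).1).2
  have h1 := card_filter_add_card_filter_not (s := A) (fun v => N v = v)
  rw [← h1]
  push_cast
  simp only [sum_const, nsmul_eq_mul, mul_one] at h0
  rw [h0, add_zero]

variable (H : SimpleGraph ℕ)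

/-- A matching of the subgraph induced by `A`, as an involution whose fixed points are the
unmatched vertices. -/
def IsMat (A : Finset ℕ) (N : ℕ → ℕ) : Prop :=
  ∀ v ∈ A, N v ∈ A ∧ N (N v) = v ∧ (N v ≠ v → H.Adj v (N v))

/-- The vertices of `A` missed by `N`. -/
def fx (A : Finset ℕ) (N : ℕ → ℕ) : Finset ℕ := {v ∈ A | N v = v}

/-- Maximum matchings. -/
def Opt (A : Finset ℕ) (M : ℕ → ℕ) : Prop :=
  IsMat H A M ∧ ∀ N, IsMat H A N → #(fx A M) ≤ #(fx A N)

/-- `v` is missed by some maximum matching. -/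
def Miss (A : Finset ℕ) (v : ℕ) : Prop := ∃ N, Opt H A N ∧ N v = v

variable {H} {A R : Finset ℕ} {M N : ℕ → ℕ} {v w : ℕ}

theorem mem_fx : v ∈ fx A N ↔ v ∈ A ∧ N v = v := by simp [fx]

/-- Both defects have the parity of `#A`. Hence a matching that is not maximum has a defect larger
by at least two, which is the gap used in `Opt.add_two_le`. -/
theorem IsMat.parity (hM : IsMat H A M) (hN : IsMat H A N) :
    #(fx A M) % 2 = #(fx A N) % 2 := by
  have h1 := card_fixed_modEq A M fun v hv => ⟨(hM v hv).1, (hM v hv).2.1⟩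
  have h2 := card_fixed_modEq A N fun v hv => ⟨(hN v hv).1, (hN v hv).2.1⟩
  exact (ZMod.natCast_eq_natCast_iff' _ _ 2).1 (h1.trans h2.symm)

theorem IsMat.congr (hM : IsMat H A M) (h : ∀ v ∈ A, N v = M v) : IsMat H A N := by
  intro v hv
  have := hM v hv
  rw [h v hv, h _ this.1]
  exact this

theorem fx_congr (h : ∀ v ∈ A, N v = M v) : fx A N = fx A M := by
  ext v
  simp only [mem_fx]
  exact and_congr_right fun hv => by rw [h v hv]

theorem Opt.congr (hM : Opt H A M) (h : ∀ v ∈ A, N v = M v) : Opt H A N :=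
  ⟨hM.1.congr h, fun N' hN' => by rw [fx_congr h]; exact hM.2 N' hN'⟩

theorem isMat_id (H : SimpleGraph ℕ) (A : Finset ℕ) : IsMat H A id := fun v hv => by simp [hv]

theorem exists_opt (H : SimpleGraph ℕ) (A : Finset ℕ) : ∃ M, Opt H A M := by
  classical
  have hex : ∃ k, ∃ M, IsMat H A M ∧ #(fx A M) = k := ⟨_, id, isMat_id H A, rfl⟩
  obtain ⟨M, hM, hk⟩ := Nat.find_spec hex
  exact ⟨M, hM, fun N hN => hk ▸ Nat.find_min' hex ⟨N, hN, rfl⟩⟩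

theorem Opt.of_card_le (hM : Opt H A M) (hN : IsMat H A N) (h : #(fx A N) ≤ #(fx A M)) :
    Opt H A N := ⟨hN, fun N' hN' => h.trans (hM.2 N' hN')⟩

/-- A matching that misses a vertex missed by no maximum matching has defect two more. -/
theorem Opt.add_two_le (hM : Opt H A M) (hv : ¬ Miss H A v) (hN : IsMat H A N) (hNv : N v = v) :
    #(fx A M) + 2 ≤ #(fx A N) := by
  have h1 : ¬ #(fx A N) ≤ #(fx A M) := fun h => hv ⟨N, hM.of_card_le hN h, hNv⟩
  have h2 := hM.1.parity hN
  omega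

/-- Remove `v` and its partner from a matching. -/
def cut (N : ℕ → ℕ) (v : ℕ) : ℕ → ℕ := Function.update (Function.update N (N v) (N v)) v v

/-- Match `v` and `w` with each other. -/
def join (N : ℕ → ℕ) (v w : ℕ) : ℕ → ℕ := Function.update (Function.update N w v) v w

theorem cut_isMat (hN : IsMat H A N) (hv : v ∈ A) : IsMat H (A.erase v) (cut N v) := by
  intro u hu
  obtain ⟨huv, huA⟩ := mem_erase.1 hu
  simp only [cut, Function.update_apply]
  have h1 := hN u huA
  have h2 := hN v hv
  by_cases hc : u = N v
  · rw [hc] at huv ⊢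
    simp [huv, h2.1]
  · have h3 : N u ≠ v := fun h => hc (by rw [← h, h1.2.1])
    have h4 : N u ≠ N v := fun h => huv (by rw [← h1.2.1, h, h2.2.1])
    simp [huv, hc, h3, h4, h1.1, h1.2.1]
    exact h1.2.2

theorem fx_cut (hN : IsMat H A N) (hv : v ∈ A) (h : N v ≠ v) :
    #(fx (A.erase v) (cut N v)) = #(fx A N) + 1 := by
  have h2 := hN v hv
  have : fx (A.erase v) (cut N v) = insert (N v) (fx A N) := by
    ext u
    simp only [mem_fx, mem_insert, mem_erase, cut, Function.update_apply]
    by_cases huv : u = v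
    · subst huv
      simp [h, Ne.symm h]
    · by_cases hc : u = N v
      · simp [hc, h2.1, h]
      · simp [huv, hc]
  rw [this, card_insert_of_notMem]
  rw [mem_fx, h2.2.1]
  exact fun hh => h hh.2.symm

theorem fx_cut_fixed (h : N v = v) (hv : v ∈ A) :
    #(fx A N) = #(fx (A.erase v) (cut N v)) + 1 := by
  have : fx (A.erase v) (cut N v) = (fx A N).erase v := by
    ext u
    simp only [mem_fx, mem_erase, cut, Function.update_apply, h]
    by_cases huv : u = v <;> simp [huv]
  have hm : v ∈ fx A N := mem_fx.2 ⟨hv, h⟩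
  rw [this, card_erase_of_mem hm]
  have := card_pos.2 ⟨v, hm⟩
  omega

theorem free_isMat (hN : IsMat H A N) (hv : v ∉ A) :
    IsMat H (insert v A) (Function.update N v v) := by
  intro u hu
  simp only [Function.update_apply]
  by_cases huv : u = v
  · simp [huv]
  · have huA : u ∈ A := (mem_insert.1 hu).resolve_left huv
    have h1 := hN u huA
    have h3 : N u ≠ v := fun h => hv (h ▸ h1.1)
    simp [huv, h3, h1.1, h1.2.1]
    exact h1.2.2

theorem fx_free (hv : v ∉ A) :
    #(fx (insert v A) (Function.update N v v)) = #(fx A N) + 1 := by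
  have : fx (insert v A) (Function.update N v v) = insert v (fx A N) := by
    ext u
    simp only [mem_fx, mem_insert, Function.update_apply]
    by_cases huv : u = v <;> simp [huv]
  rw [this, card_insert_of_notMem]
  exact fun h => hv (mem_fx.1 h).1

theorem join_isMat (hN : IsMat H A N) (hv : v ∉ A) (hw : w ∈ A) (hNw : N w = w)
    (hvw : H.Adj v w) : IsMat H (insert v A) (join N v w) := by
  intro u hu
  have hwv : w ≠ v := fun h => hv (h ▸ hw)
  simp only [join, Function.update_apply]
  by_cases huv : u = v
  · simp [huv, hwv, hw, hvw]
  · have huA : u ∈ A := (mem_insert.1 hu).resolve_left huv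
    have h1 := hN u huA
    by_cases huw : u = w
    · simp [huw, hwv, hvw.symm]
    · have h3 : N u ≠ v := fun h => hv (h ▸ h1.1)
      have h4 : N u ≠ w := fun h => huw (by rw [← h1.2.1, h, hNw])
      simp [huv, huw, h3, h4, h1.1, h1.2.1]
      exact h1.2.2

theorem fx_join (hv : v ∉ A) (hw : w ∈ A) (hNw : N w = w) :
    #(fx (insert v A) (join N v w)) + 1 = #(fx A N) := by
  have hwv : w ≠ v := fun h => hv (h ▸ hw)
  have : fx (insert v A) (join N v w) = (fx A N).erase w := by
    ext u
    simp only [mem_fx, mem_insert, mem_erase, join, Function.update_apply]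
    by_cases huv : u = v
    · simp [huv, hwv, hv]
    · by_cases huw : u = w
      · simp [huw, hwv, hwv.symm]
      · simp [huv, huw]
  have hm : w ∈ fx A N := mem_fx.2 ⟨hw, hNw⟩
  rw [this, card_erase_of_mem hm]
  have := card_pos.2 ⟨w, hm⟩
  omega

/-- Deleting `v` from a matching of `insert v R` raises the defect by at most one, so adding a
vertex lowers the least defect by at most one; joining attains this. -/
theorem opt_join (hN : Opt H R N) (hv : v ∉ R) (hw : w ∈ R) (hNw : N w = w)
    (hvw : H.Adj v w) : Opt H (insert v R) (join N v w) := by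
  refine ⟨join_isMat hN.1 hv hw hNw hvw, fun N' hN' => ?_⟩
  have h1 := fx_join (N := N) hv hw hNw
  have hvi : v ∈ insert v R := mem_insert_self _ _
  have h2 := cut_isMat hN' hvi
  rw [erase_insert hv] at h2
  have h3 := hN.2 _ h2
  by_cases hc : N' v = v
  · have := fx_cut_fixed hc hvi
    rw [erase_insert hv] at this
    omega
  · have := fx_cut hN' hvi hc
    rw [erase_insert hv] at this
    omega

/-- A competitor that matches `v` to `w` leaves, after deletion of `v`, a matching that misses `w`.
As `w` is always covered by maximum matchings, this costs two, which outweighs the one gained by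
covering `v`. -/
theorem opt_free (hN : Opt H R N) (hv : v ∉ R) (hno : ∀ w ∈ R, H.Adj v w → ¬ Miss H R w) :
    Opt H (insert v R) (Function.update N v v) := by
  refine ⟨free_isMat hN.1 hv, fun N' hN' => ?_⟩
  rw [fx_free hv]
  have hvi : v ∈ insert v R := mem_insert_self _ _
  have h2 := cut_isMat hN' hvi
  rw [erase_insert hv] at h2
  by_cases hc : N' v = v
  · have := fx_cut_fixed hc hvi
    rw [erase_insert hv] at this
    have h3 := hN.2 _ h2
    omega
  · have := fx_cut hN' hvi hc
    rw [erase_insert hv] at this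
    have hh := hN' v hvi
    have h4 := hN.add_two_le (hno (N' v) ((mem_insert.1 hh.1).resolve_left hc) (hh.2.2 hc)) h2
      (by simp only [cut, Function.update_apply, if_true, ite_eq_right_iff]; exact Eq.symm)
    omega

/-- The recursion that makes missed vertices behave like lost positions: a neighbour that can be
missed could be joined to `v`, which would beat any matching that misses `v`. -/
theorem miss_insert_iff (hv : v ∉ R) :
    Miss H (insert v R) v ↔ ∀ w ∈ R, H.Adj v w → ¬ Miss H R w := by
  have hvi : v ∈ insert v R := mem_insert_self _ _
  constructor
  · rintro ⟨N0, hN0, hv0⟩ w hw hvw ⟨N, hN, hNw⟩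
    have h1 := fx_join (N := N) hv hw hNw
    have h2 := hN0.2 _ (join_isMat hN.1 hv hw hNw hvw)
    have h3 := fx_cut_fixed hv0 hvi
    have h4 := cut_isMat hN0.1 hvi
    rw [erase_insert hv] at h3 h4
    have h5 := hN.2 _ h4
    omega
  · intro h
    obtain ⟨N, hN⟩ := exists_opt H R
    exact ⟨_, opt_free hN hv h, by simp⟩

/-- A matching of the rest becomes, with `v` left free, a matching that misses `v`; by parity its
defect exceeds the optimum by two, so the rest has least defect one more than the whole, which `cut`
attains. -/
theorem opt_cut (hM : Opt H A M) (hv : v ∈ A) (hm : ¬ Miss H A v) :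
    Opt H (A.erase v) (cut M v) := by
  have hvM : M v ≠ v := fun h => hm ⟨M, hM, h⟩
  refine ⟨cut_isMat hM.1 hv, fun N hN => ?_⟩
  rw [fx_cut hM.1 hv hvM]
  have h1 := free_isMat hN (notMem_erase v A)
  have h2 := fx_free (N := N) (notMem_erase v A)
  rw [insert_erase hv] at h1 h2
  have := hM.add_two_le hm h1 (by simp)
  omega

/-- Counting certificate for maximum matchings: odd classes of `E`, separated by the partners
of their bases. -/
theorem certificate {E : Finset ℕ} {b : ℕ → ℕ} (hM : IsMat H A M) (hEA : E ⊆ A)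
    (hroot : ∀ v ∈ A, M v = v → v ∈ E)
    (hin : ∀ v ∈ E, b v ≠ v → M v ∈ E ∧ b (M v) = b v ∧ M v ≠ v)
    (hout : ∀ v ∈ E, b v = v → M v ≠ v → M v ∉ E)
    (hcl : ∀ x ∈ E, ∀ y ∈ A, H.Adj x y → (y ∈ E ∧ b y = b x) ∨ (y ∉ E ∧ M y ∈ E))
    (hN : IsMat H A N) :
    #(fx A M) ≤ #(fx A N) ∧ ∀ v ∈ A, v ∉ E → N v = v → #(fx A M) < #(fx A N) := by
  classical
  set O : Finset ℕ := {y ∈ A | y ∉ E ∧ M y ∈ E} with hO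
  set Bs : Finset ℕ := {v ∈ E | b v = v} with hBs
  set O' : Finset ℕ := {y ∈ O | N y ≠ y} with hO'
  have hdis : Disjoint (fx A M) O := by
    rw [disjoint_left]
    intro v hv hvO
    rw [mem_fx] at hv
    exact (mem_filter.1 hvO).2.1 (hroot v hv.1 hv.2)
  -- `M` injects the missed vertices and `O` into the bases: a vertex of `E` that is not a base has
  -- its partner in `E`, so it cannot be the partner of a vertex of `O`.
  have h1 : #(fx A M) + #O ≤ #Bs := by
    rw [← card_union_of_disjoint hdis]
    refine card_le_card_of_injOn M ?_ ?_
    · intro v hv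
      have hv' := mem_union.1 hv
      rcases hv' with hv' | hv'
      · obtain ⟨hvA, hvM⟩ := mem_fx.1 hv'
        simp only [hBs, coe_filter, Set.mem_ofPred_eq, hvM]
        refine ⟨hroot v hvA hvM, ?_⟩
        by_contra hc
        exact (hin v (hroot v hvA hvM) hc).2.2 hvM
      · obtain ⟨hvA, hvE, hMv⟩ := by simpa [hO] using hv'
        simp only [hBs, coe_filter, Set.mem_ofPred_eq]
        refine ⟨hMv, ?_⟩
        by_contra hc
        have := (hin _ hMv hc).1
        rw [(hM v hvA).2.1] at this
        exact hvE this
    · intro u hu v hv huv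
      have hu' : u ∈ A := by
        rcases mem_union.1 hu with h | h
        exacts [(mem_fx.1 h).1, (mem_filter.1 h).1]
      have hv' : v ∈ A := by
        rcases mem_union.1 hv with h | h
        exacts [(mem_fx.1 h).1, (mem_filter.1 h).1]
      rw [← (hM u hu').2.1, huv, (hM v hv').2.1]
  -- Otherwise `N` would map the class of `β` to itself without fixed points and the class would be
  -- even; but `M` pairs up all of it except `β`, so it is odd.
  have hex : ∀ β ∈ Bs, ∃ v ∈ E, b v = β ∧ (N v = v ∨ N v ∈ O') := by
    intro β hβ
    obtain ⟨hβE, hββ⟩ := mem_filter.1 hβ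
    by_contra! hc
    set C : Finset ℕ := {v ∈ E | b v = β} with hC
    have hNC : ∀ v ∈ C, N v ∈ C ∧ N (N v) = v := by
      intro v hv
      obtain ⟨hvE, hvb⟩ := mem_filter.1 hv
      have h2 := hN v (hEA hvE)
      obtain ⟨hne, hnO⟩ := hc v hvE hvb
      refine ⟨?_, h2.2.1⟩
      rcases hcl v hvE (N v) h2.1 (h2.2.2 hne) with h3 | h3
      · exact mem_filter.2 ⟨h3.1, h3.2.trans hvb⟩
      · refine absurd ?_ hnO
        refine mem_filter.2 ⟨mem_filter.2 ⟨h2.1, h3⟩, ?_⟩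
        rw [h2.2.1]
        exact fun h => hne h.symm
    have hfN : #{v ∈ C | N v = v} = 0 := by
      rw [card_eq_zero, filter_eq_empty_iff]
      intro v hv
      obtain ⟨hvE, hvb⟩ := mem_filter.1 hv
      exact (hc v hvE hvb).1
    have hβC : β ∈ C := mem_filter.2 ⟨hβE, hββ⟩
    have hMC : ∀ v ∈ C.erase β, M v ∈ C.erase β ∧ M (M v) = v := by
      intro v hv
      obtain ⟨hvβ, hv⟩ := mem_erase.1 hv
      obtain ⟨hvE, hvb⟩ := mem_filter.1 hv
      have h3 := hin v hvE (by rw [hvb]; exact hvβ.symm)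
      refine ⟨mem_erase.2 ⟨?_, mem_filter.2 ⟨h3.1, h3.2.1.trans hvb⟩⟩, (hM v (hEA hvE)).2.1⟩
      intro h4
      have := hout β hβE hββ
      rw [← h4, (hM v (hEA hvE)).2.1] at this
      exact this h3.2.2.symm hvE
    have hfM : #{v ∈ C.erase β | M v = v} = 0 := by
      rw [card_eq_zero, filter_eq_empty_iff]
      intro v hv
      obtain ⟨hvβ, hv⟩ := mem_erase.1 hv
      obtain ⟨hvE, hvb⟩ := mem_filter.1 hv
      exact (hin v hvE (by rw [hvb]; exact hvβ.symm)).2.2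
    have e1 := card_fixed_modEq C N hNC
    have e2 := card_fixed_modEq (C.erase β) M hMC
    rw [hfN] at e1
    rw [hfM] at e2
    have e3 := card_erase_add_one hβC
    rw [← e3] at e1
    push_cast at e1 e2
    rw [← e2] at e1
    exact absurd e1 (by decide)
  choose! g hgE hgb hg using hex
  set F : Finset ℕ := {v ∈ fx A N | v ∈ E} with hF
  -- The witnesses of different bases lie in different classes, so `N` sends them to distinct
  -- vertices of `F ∪ O'`. With `h1` this gives `#(fx A M) ≤ #F`, and `F` omits the vertices that
  -- `N` misses outside `E`.
  have h2 : #Bs ≤ #F + #O' := by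
    have hd : Disjoint F O' := by
      rw [disjoint_left]
      intro v hv hvO
      exact (mem_filter.1 (mem_filter.1 hvO).1).2.1 (mem_filter.1 hv).2
    rw [← card_union_of_disjoint hd]
    refine card_le_card_of_injOn (fun β => N (g β)) ?_ ?_
    · intro β hβ
      have hβ' : β ∈ Bs := hβ
      rcases hg β hβ' with h3 | h3
      · refine mem_union_left _ ?_
        simp only [h3]
        exact mem_filter.2 ⟨mem_fx.2 ⟨hEA (hgE β hβ'), h3⟩, hgE β hβ'⟩
      · exact mem_union_right _ h3
    · intro β hβ γ hγ h3
      have h4 : g β = g γ := by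
        rw [← (hN _ (hEA (hgE β hβ))).2.1, ← (hN _ (hEA (hgE γ hγ))).2.1]
        exact congrArg N h3
      rw [← hgb β hβ, h4, hgb γ hγ]
  have h3 : #O' ≤ #O := card_filter_le _ _
  have h4 : #F ≤ #(fx A N) := card_filter_le _ _
  refine ⟨by omega, fun v hvA hvE hvN => ?_⟩
  have h5 : #F < #(fx A N) := by
    refine card_lt_card ⟨filter_subset _ _, fun h => hvE ?_⟩
    exact (mem_filter.1 (h (mem_fx.2 ⟨hvA, hvN⟩))).2
  omega

end Matching

/-! ### Zero positions -/

namespace UndirectedGeography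

open Finset Matching

theorem mex_notMem {S : Set ℕ} (hS : S.Finite) : mex S ∉ S :=
  Nat.sInf_mem (s := {k | k ∉ S}) hS.infinite_compl.nonempty

theorem mem_of_lt_mex {S : Set ℕ} {k : ℕ} (h : k < mex S) : k ∈ S := by
  by_contra hk
  exact absurd (Nat.sInf_le (s := {k | k ∉ S}) hk) (not_le.2 h)

theorem mex_eq {S : Set ℕ} {k : ℕ} (h1 : k ∉ S) (h2 : ∀ j < k, j ∈ S) : mex S = k := by
  refine le_antisymm (Nat.sInf_le h1) ?_
  by_contra! h
  exact Nat.sInf_mem (s := {k | k ∉ S}) ⟨k, h1⟩ (h2 _ h)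

variable {V : Type*} [DecidableEq V] (G : SimpleGraph V)

theorem nimberAt_eq (R : Finset V) (s : V) :
    nimberAt G R s = mex {k | ∃ v ∈ R, G.Adj s v ∧ nimberAt G (R.erase v) v = k} := by
  rw [nimberAt]
  congr 1
  ext k
  simp [and_left_comm]

theorem options_finite (R : Finset V) (s : V) :
    {k | ∃ v ∈ R, G.Adj s v ∧ nimberAt G (R.erase v) v = k}.Finite := by
  refine (R.finite_toSet.image fun v => nimberAt G (R.erase v) v).subset ?_
  rintro k ⟨v, hv, -, rfl⟩
  exact ⟨v, hv, rfl⟩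

/-- All smaller values occur among the options. This keeps the values below `n`, so that the set of
values seen fits in one row of a matrix. -/
theorem nimberAt_le (R : Finset V) (s : V) : nimberAt G R s ≤ #R := by
  have hsub : range (nimberAt G R s) ⊆ R.image fun v => nimberAt G (R.erase v) v := by
    intro k hk
    rw [mem_range, nimberAt_eq] at hk
    obtain ⟨v, hv, -, h⟩ := mem_of_lt_mex hk
    exact mem_image.2 ⟨v, hv, h⟩
  simpa using (card_le_card hsub).trans card_image_le

theorem nimberAt_eq_zero (R : Finset V) (s : V) :
    nimberAt G R s = 0 ↔ ∀ v ∈ R, G.Adj s v → nimberAt G (R.erase v) v ≠ 0 := by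
  rw [nimberAt_eq]
  constructor
  · intro h v hv hsv h0
    have := mex_notMem (options_finite G R s)
    rw [h] at this
    exact this ⟨v, hv, hsv, h0⟩
  · intro h
    exact mex_eq (by rintro ⟨v, hv, hsv, h0⟩; exact h v hv hsv h0) (by simp)

/-- A position is a loss for the player to move iff a maximum matching misses the token. -/
theorem nimberAt_eq_zero_iff_miss (H : SimpleGraph ℕ) (R : Finset ℕ) (v : ℕ) (hv : v ∉ R) :
    nimberAt H R v = 0 ↔ Miss H (insert v R) v := by
  induction hk : #R generalizing R v with
  | zero =>
    obtain rfl := card_eq_zero.1 hk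
    rw [miss_insert_iff hv, nimberAt_eq_zero]
    simp
  | succ k ih =>
    rw [miss_insert_iff hv, nimberAt_eq_zero]
    refine forall₂_congr fun w hw => forall_congr' fun _ => not_congr ?_
    rw [ih (R.erase w) w (notMem_erase w R) (by rw [card_erase_of_mem hw, hk]; rfl),
      insert_erase hw]

/-- Moves the game from `Fin n` to `ℕ`, where matchings and arrays are plain functions `ℕ → ℕ`. -/
theorem nimberAt_map {W : Type*} [DecidableEq W] (f : V ↪ W) (R : Finset V) (s : V) :
    nimberAt (G.map f) (R.map f) (f s) = nimberAt G R s := by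
  induction hk : #R generalizing R s with
  | zero =>
    obtain rfl := card_eq_zero.1 hk
    rw [nimberAt_eq, nimberAt_eq]
    simp
  | succ k ih =>
    rw [nimberAt_eq, nimberAt_eq]
    congr 1
    ext j
    simp only [Set.mem_ofPred_eq, mem_map, exists_exists_and_eq_and, SimpleGraph.map_adj_apply]
    refine exists_congr fun v => and_congr_right fun hv => and_congr_right fun _ => ?_
    rw [← map_erase, ih _ _ (by rw [card_erase_of_mem hv, hk]; rfl)]

end UndirectedGeography

/-! ### Alternating search with blossoms -/

namespace Matching

open Finset

/-- State of the search for the vertices missed by maximum matchings: `E` is the set of outer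
vertices found so far, partitioned into blossoms with bases given by `b`; the partner of a
non-root base `β` hangs on the outer vertex `p β`; blossoms are ordered by `t`; the row `N x` is
a matching that misses `x`. -/
structure SInv (H : SimpleGraph ℕ) (A : Finset ℕ) (M : ℕ → ℕ) (E : Finset ℕ) (b p t : ℕ → ℕ)
    (N : ℕ → ℕ → ℕ) : Prop where
  isMat : IsMat H A M
  sub : E ⊆ A
  root : ∀ v ∈ A, M v = v → v ∈ E
  bE : ∀ v ∈ E, b v ∈ E
  bb : ∀ v ∈ E, b (b v) = b v
  inn : ∀ v ∈ E, b v ≠ v → M v ∈ E ∧ b (M v) = b v ∧ M v ≠ v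
  out : ∀ v ∈ E, b v = v → M v ≠ v → M v ∉ E
  pE : ∀ v ∈ E, b v = v → M v ≠ v → p v ∈ E ∧ H.Adj (p v) (M v) ∧ t (b (p v)) < t v
  tinj : ∀ u ∈ E, ∀ v ∈ E, b u = u → b v = v → t u = t v → u = v
  mat : ∀ x ∈ E, IsMat H A (N x) ∧ N x x = x ∧ #(fx A (N x)) = #(fx A M)
  same : ∀ x ∈ E, ∀ v ∈ A, ¬ (v ∈ E ∧ b v = b x) → N x v = N (b x) v
  brt : ∀ β ∈ E, b β = β → M β = β → ∀ v ∈ A, N β v = M v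
  bnr : ∀ β ∈ E, b β = β → M β ≠ β →
    N β (M β) = p β ∧ ∀ v ∈ A, v ≠ β → v ≠ M β → v ≠ p β → N β v = N (p β) v

/-- `γ` is an ancestor of the base `β` in the tree of blossoms. -/
inductive Anc (M b p : ℕ → ℕ) : ℕ → ℕ → Prop where
  | refl (β : ℕ) : Anc M b p β β
  | step {β γ : ℕ} : M β ≠ β → Anc M b p (b (p β)) γ → Anc M b p β γ

/-- `v` lies in a blossom above `x` in the tree of blossoms, or is the partner of its base. -/
def OnCh (M : ℕ → ℕ) (E : Finset ℕ) (b p : ℕ → ℕ) (x v : ℕ) : Prop :=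
  ∃ γ, Anc M b p (b x) γ ∧ ((v ∈ E ∧ b v = γ) ∨ (M γ ≠ γ ∧ v = M γ))

/-- Match `c` and `q`, miss `z`, follow `Nq` on `B` and `Nc` elsewhere. -/
def glue (B : ℕ → Prop) [DecidablePred B] (Nc Nq : ℕ → ℕ) (c q z : ℕ) (v : ℕ) : ℕ :=
  if v = c then q else if v = q then c else if v = z then z else if B v then Nq v else Nc v

section glue

variable {H : SimpleGraph ℕ} {A : Finset ℕ} {M Nc Nq : ℕ → ℕ} {B : ℕ → Prop} [DecidablePred B]
  {c q z β : ℕ}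

theorem glue_c : glue B Nc Nq c q z c = q := by simp [glue]

theorem glue_q (h : q ≠ c) : glue B Nc Nq c q z q = c := by simp [glue, h]

theorem glue_z (h : z ≠ c) (h' : z ≠ q) : glue B Nc Nq c q z z = z := by simp [glue, h, h']

theorem glue_B {v : ℕ} (hc : v ≠ c) (hq : v ≠ q) (hz : v ≠ z) (hB : B v) :
    glue B Nc Nq c q z v = Nq v := by simp [glue, hc, hq, hz, hB]

theorem glue_out {v : ℕ} (hc : v ≠ c) (hq : v ≠ q) (hz : v ≠ z) (hB : ¬ B v) :
    glue B Nc Nq c q z v = Nc v := by simp [glue, hc, hq, hz, hB]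

/-- Exchange along a blossom `B` with base `β`. If the base is matched to `z`, the result misses
`z`; if the base is a root, then `z = β` and the result is a matching of smaller defect. -/
theorem glue_isMat (hM : IsMat H A M) (hNc : IsMat H A Nc) (hNq : IsMat H A Nq)
    (hBA : ∀ v, B v → v ∈ A) (hβ : B β) (hq : B q) (hcA : c ∈ A) (hcB : ¬ B c)
    (hz : M β = z) (hzB : z ≠ β → ¬ B z) (hcz : c ≠ z) (hadj : H.Adj c q)
    (hcc : Nc c = c) (hqq : Nq q = q)
    (hNcM : ∀ v, B v ∨ v = z → Nc v = M v)
    (hBM : ∀ v, B v → v ≠ β → B (M v))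
    (hBq : ∀ v, B v → v ≠ q → B (Nq v) ∧ Nq v ≠ v) :
    IsMat H A (if z = β then glue B Nc Nq c q c else glue B Nc Nq c q z) := by
  have hzA : z ∈ A := hz ▸ (hM β (hBA β hβ)).1
  have hqc : q ≠ c := fun h => hcB (h ▸ hq)
  have hMz : M z = β := by rw [← hz, (hM β (hBA β hβ)).2.1]
  have hzc : z ≠ c := hcz.symm
  -- When the base is a root no vertex is to be freed. The slot for `z` is then filled with `c`, and
  -- its branch in `glue` is never reached.
  set z' := if z = β then c else z with hz'
  have heq : (if z = β then glue B Nc Nq c q c else glue B Nc Nq c q z) = glue B Nc Nq c q z' := by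
    rw [hz']; split_ifs <;> rfl
  rw [heq]
  have key : ∀ u ∈ A, u ≠ c → u ≠ z' → ¬ B u → Nc u ≠ c ∧ Nc u ≠ z' ∧ ¬ B (Nc u) := by
    intro u hu huc huz huB
    have h1 := hNc u hu
    have h2 : Nc u ≠ c := fun h => huc (by rw [← h1.2.1, h, hcc])
    have h3 : ¬ B (Nc u) := by
      intro h
      by_cases hb : Nc u = β
      · have : u = z := by rw [← h1.2.1, hNcM _ (Or.inl h), hb, hz]
        by_cases hzb : z = β
        · exact huB (this ▸ hzb ▸ hβ)
        · exact huz (by rw [hz', if_neg hzb, this])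
      · have := hBM _ h hb
        rw [← hNcM _ (Or.inl h), h1.2.1] at this
        exact huB this
    refine ⟨h2, ?_, h3⟩
    intro h
    by_cases hzb : z = β
    · rw [hz', if_pos hzb] at h
      exact h2 h
    · rw [hz', if_neg hzb] at h
      have : u = β := by rw [← h1.2.1, h, hNcM _ (Or.inr rfl), hMz]
      exact huB (this ▸ hβ)
  have hzB' : ¬ B z' := by
    rw [hz']
    split_ifs with h
    exacts [hcB, hzB h]
  intro u hu
  by_cases huc : u = c
  · subst huc
    rw [glue_c, glue_q hqc]
    exact ⟨hBA _ hq, rfl, fun _ => hadj⟩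
  by_cases huq : u = q
  · subst huq
    rw [glue_q hqc, glue_c]
    exact ⟨hcA, rfl, fun _ => hadj.symm⟩
  by_cases huz : u = z'
  · have h3 : glue B Nc Nq c q z' u = u := by
      have hzz : z' ≠ q := fun h => hzB' (h ▸ hq)
      rw [huz] at huc ⊢
      exact glue_z huc hzz
    rw [h3, h3]
    exact ⟨hu, rfl, fun h => absurd rfl h⟩
  by_cases huB : B u
  · rw [glue_B huc huq huz huB]
    have h1 := hNq u hu
    have h2 := hBq u huB huq
    rw [glue_B (fun h : Nq u = c => hcB (h ▸ h2.1))
      (fun h : Nq u = q => huq (by rw [← h1.2.1, h, hqq]))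
      (fun h : Nq u = z' => hzB' (h ▸ h2.1)) h2.1]
    exact h1
  · rw [glue_out huc huq huz huB]
    have h1 := hNc u hu
    obtain ⟨h2, h3, h4⟩ := key u hu huc huz huB
    rw [glue_out h2 (fun h => h4 (h ▸ hq)) h3 h4]
    exact h1

/-- Inside `B` the glued matching covers everything. If the base is matched, `c` is traded for `z`
among the missed vertices; if the base is a root, `c` is lost and nothing is gained, which is an
augmentation. -/
theorem fx_glue (hM : IsMat H A M)
    (hBA : ∀ v, B v → v ∈ A) (hβ : B β) (hq : B q) (hcA : c ∈ A) (hcB : ¬ B c)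
    (hz : M β = z) (hzB : z ≠ β → ¬ B z) (hcz : c ≠ z)
    (hcc : Nc c = c)
    (hNcM : ∀ v, B v ∨ v = z → Nc v = M v)
    (hBM : ∀ v, B v → v ≠ β → M v ≠ v)
    (hBq : ∀ v, B v → v ≠ q → Nq v ≠ v) :
    (z ≠ β → #(fx A (glue B Nc Nq c q z)) = #(fx A Nc)) ∧
    (z = β → #(fx A (glue B Nc Nq c q c)) < #(fx A Nc)) := by
  have hzA : z ∈ A := hz ▸ (hM β (hBA β hβ)).1
  have hqc : q ≠ c := fun h => hcB (h ▸ hq)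
  have hMz : M z = β := by rw [← hz, (hM β (hBA β hβ)).2.1]
  have hcf : c ∈ fx A Nc := mem_fx.2 ⟨hcA, hcc⟩
  constructor
  · intro hzb
    have hzf : z ∉ fx A Nc := by
      rw [mem_fx, hNcM z (Or.inr rfl), hMz]
      exact fun h => hzb h.2.symm
    have : fx A (glue B Nc Nq c q z) = insert z ((fx A Nc).erase c) := by
      ext u
      rw [mem_insert, mem_erase, mem_fx, mem_fx]
      by_cases huc : u = c
      · subst huc
        rw [glue_c]
        simp [hqc, hcz]
      by_cases huq : u = q
      · subst huq
        rw [glue_q hqc]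
        have h1 : u ≠ z := fun h => hzB hzb (h ▸ hq)
        have h2 : Nc u ≠ u := by
          rw [hNcM u (Or.inl hq)]
          by_cases hub : u = β
          · rw [hub, hz]; exact hzb
          · exact hBM u hq hub
        simp [h1, h2, hqc, hqc.symm]
      by_cases huz : u = z
      · subst huz
        rw [glue_z huc huq]
        simp [hzA]
      by_cases huB : B u
      · rw [glue_B huc huq huz huB]
        have h2 : Nc u ≠ u := by
          rw [hNcM u (Or.inl huB)]
          by_cases hub : u = β
          · rw [hub, hz]; exact hzb
          · exact hBM u huB hub
        simp [huz, hBq u huB huq, h2]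
      · rw [glue_out huc huq huz huB]
        simp [huc, huz]
    rw [this, card_insert_of_notMem (fun h => hzf (mem_of_mem_erase h)), card_erase_of_mem hcf]
    have := card_pos.2 ⟨c, hcf⟩
    omega
  · intro hzb
    refine card_lt_card ⟨?_, fun h => ?_⟩
    · intro u hu
      rw [mem_fx] at hu ⊢
      refine ⟨hu.1, ?_⟩
      have hu2 := hu.2
      by_cases huc : u = c
      · rw [huc, hcc]
      by_cases huq : u = q
      · subst huq
        rw [glue_q hqc] at hu2
        exact absurd hu2.symm huc
      by_cases huB : B u
      · rw [glue_B huc huq huc huB] at hu2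
        exact absurd hu2 (hBq u huB huq)
      · rwa [glue_out huc huq huc huB] at hu2
    · have := (mem_fx.1 (h hcf)).2
      rw [glue_c] at this
      exact hqc this

end glue

namespace SInv

variable {H : SimpleGraph ℕ} {A : Finset ℕ} {M : ℕ → ℕ} {E : Finset ℕ} {b p t : ℕ → ℕ}
    {N : ℕ → ℕ → ℕ}

/-- Times decrease strictly on the way up, because the partner of a base hangs on a blossom with an
earlier base. A base that is later than `β` is therefore not above `β`. -/
theorem anc_le (S : SInv H A M E b p t N) {β γ : ℕ} (h : Anc M b p β γ) (hβ : β ∈ E)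
    (hbβ : b β = β) : γ ∈ E ∧ b γ = γ ∧ t γ ≤ t β := by
  induction h with
  | refl β => exact ⟨hβ, hbβ, le_rfl⟩
  | step hne h ih =>
    obtain ⟨h1, h2, h3⟩ := S.pE _ hβ hbβ hne
    obtain ⟨h4, h5, h6⟩ := ih (S.bE _ h1) (S.bb _ h1)
    exact ⟨h4, h5, h6.trans h3.le⟩

/-- The row of `x` agrees with the given matching away from the blossoms above `x`. -/
theorem off_chain (S : SInv H A M E b p t N) {x v : ℕ} (hx : x ∈ E) (hv : v ∈ A)
    (h : ¬ OnCh M E b p x v) : N x v = M v := by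
  -- Off its own blossom the row of `x` is the row of the base, which away from the base, its
  -- partner and the vertex `p (b x)` is the row of `p (b x)`; the base of that vertex is earlier.
  induction hk : t (b x) using Nat.strong_induction_on generalizing x with
  | _ k ih =>
    have h1 : ¬ (v ∈ E ∧ b v = b x) := fun h2 => h ⟨_, Anc.refl _, Or.inl h2⟩
    rw [S.same x hx v hv h1]
    have hβ := S.bE x hx
    have hbb := S.bb x hx
    by_cases hr : M (b x) = b x
    · exact S.brt _ hβ hbb hr v hv
    · obtain ⟨h2, h3, h4⟩ := S.pE _ hβ hbb hr
      have h5 : ¬ OnCh M E b p (p (b x)) v := by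
        rintro ⟨γ, hγ, h5⟩
        exact h ⟨γ, Anc.step hr hγ, h5⟩
      rw [(S.bnr _ hβ hbb hr).2 v hv]
      · exact ih _ (by rw [← hk]; exact h4) h2 h5 rfl
      · rintro rfl
        exact h1 ⟨hβ, hbb⟩
      · intro h6
        exact h ⟨_, Anc.refl _, Or.inr ⟨hr, h6⟩⟩
      · rintro rfl
        exact h5 ⟨_, Anc.refl _, Or.inl ⟨h2, rfl⟩⟩

/-- The row of a base agrees with the given matching on the rest of the blossom. -/
theorem base_row (S : SInv H A M E b p t N) {β v : ℕ} (hβ : β ∈ E) (hb : b β = β) (hv : v ∈ E)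
    (hvb : b v = β) (hne : v ≠ β) : N β v = M v := by
  by_cases hr : M β = β
  · exact S.brt _ hβ hb hr v (S.sub hv)
  · obtain ⟨h2, h3, h4⟩ := S.pE _ hβ hb hr
    -- Every base above `p β` is earlier than `β`, so the blossom of `β` is not on that chain.
    have hoff : ¬ OnCh M E b p (p β) v := by
      rintro ⟨γ, hγ, h5⟩
      obtain ⟨h6, h7, h8⟩ := S.anc_le hγ (S.bE _ h2) (S.bb _ h2)
      rcases h5 with h5 | h5
      · rw [← h5.2, hvb] at h8
        omega
      · exact S.out _ h6 h7 h5.1 (h5.2 ▸ hv)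
    rw [(S.bnr _ hβ hb hr).2 v (S.sub hv) hne]
    · exact S.off_chain h2 (S.sub hv) hoff
    · rintro rfl
      exact S.out _ hβ hb hr hv
    · rintro rfl
      exact hoff ⟨_, Anc.refl _, Or.inl ⟨h2, rfl⟩⟩

/-- A matching that agrees with the row of `β` off a set `C` preserved by that row, in which the
row misses only `β`, also preserves `C`, and it misses at most one vertex there. -/
theorem row_class {C : ℕ → Prop} {β x : ℕ} {Nβ Nx : ℕ → ℕ} (hβ : IsMat H A Nβ)
    (hx : IsMat H A Nx) (hcard : #(fx A Nx) = #(fx A Nβ)) (hCA : ∀ v, C v → v ∈ A)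
    (hCβ : ∀ v, C v → v ≠ β → C (Nβ v) ∧ Nβ v ≠ v) (hββ : Nβ β = β)
    (hxC : C x) (hxx : Nx x = x) (hsame : ∀ v ∈ A, ¬ C v → Nx v = Nβ v) :
    ∀ v, C v → v ≠ x → C (Nx v) ∧ Nx v ≠ v := by
  classical
  intro v hv hvx
  constructor
  -- If `Nx v` were outside `C`, the two rows would agree there, so `Nβ` would also match `v` with
  -- `Nx v` and leave `C`.
  · by_contra hc
    have h1 := hx v (hCA v hv)
    have h2 := hsame _ h1.1 hc
    rw [h1.2.1] at h2
    have h3 : Nβ v = Nx v := (congrArg Nβ h2).trans (hβ _ h1.1).2.1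
    by_cases hvb : v = β
    · rw [hvb, hββ, ← hvb] at h3
      exact hc (h3 ▸ hv)
    · exact hc (h3 ▸ (hCβ v hv hvb).1)
  -- Off `C` the rows miss the same vertices, so by equal defects they miss equally many in `C`. The
  -- row of `β` misses at most one there, whereas `Nx` would miss both `x` and `v`.
  · intro hvv
    have e1 := card_filter_add_card_filter_not (s := fx A Nx) C
    have e2 := card_filter_add_card_filter_not (s := fx A Nβ) C
    have e3 : (fx A Nx).filter (fun v => ¬ C v) = (fx A Nβ).filter (fun v => ¬ C v) := by
      ext u
      simp only [mem_filter, mem_fx]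
      constructor
      · rintro ⟨⟨h1, h2⟩, h3⟩
        exact ⟨⟨h1, by rw [← hsame u h1 h3, h2]⟩, h3⟩
      · rintro ⟨⟨h1, h2⟩, h3⟩
        exact ⟨⟨h1, by rw [hsame u h1 h3, h2]⟩, h3⟩
    have e4 : #((fx A Nβ).filter C) ≤ 1 := by
      rw [card_le_one]
      have : ∀ u ∈ (fx A Nβ).filter C, u = β := by
        intro u hu
        obtain ⟨h1, h2⟩ := mem_filter.1 hu
        by_contra hne
        exact (hCβ u h2 hne).2 (mem_fx.1 h1).2
      intro u hu w hw
      rw [this u hu, this w hw]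
    have e5 : 1 < #((fx A Nx).filter C) := by
      rw [one_lt_card]
      exact ⟨v, mem_filter.2 ⟨mem_fx.2 ⟨hCA v hv, hvv⟩, hv⟩, x,
        mem_filter.2 ⟨mem_fx.2 ⟨hCA x hxC, hxx⟩, hxC⟩, hvx⟩
    rw [e3] at e1
    omega

/-- The base row follows `M` on the rest of the blossom and so preserves it; `row_class` carries
this over to `x`. This is what gluing through the blossom needs from the row of the entry vertex. -/
theorem cls (S : SInv H A M E b p t N) {x v : ℕ} (hx : x ∈ E) (hv : v ∈ E) (hvx : b v = b x)
    (hne : v ≠ x) : N x v ∈ E ∧ b (N x v) = b x ∧ N x v ≠ v := by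
  have hβ := S.bE x hx
  have hbb := S.bb x hx
  obtain ⟨m1, m2, m3⟩ := S.mat x hx
  obtain ⟨n1, n2, n3⟩ := S.mat _ hβ
  have := row_class (C := fun v => v ∈ E ∧ b v = b x) n1 m1 (m3.trans n3.symm)
    (fun v hv => S.sub hv.1) (fun v hv hne => ?_) n2 ⟨hx, rfl⟩ m2
    (fun v hv h => S.same x hx v hv h) v ⟨hv, hvx⟩ hne
  · exact ⟨this.1.1, this.1.2, this.2⟩
  · rw [S.base_row hβ hbb hv.1 hv.2 hne]
    obtain ⟨h1, h2, h3⟩ := S.inn v hv.1 (by rw [hv.2]; exact hne.symm)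
    exact ⟨⟨h1, h2.trans hv.2⟩, h3⟩

/-- The search starts from the unmatched vertices. -/
theorem init (hM : IsMat H A M) (p : ℕ → ℕ) (hN : ∀ x ∈ fx A M, ∀ v ∈ A, N x v = M v)
    (hb : ∀ x ∈ fx A M, b x = x) (ht : ∀ x ∈ fx A M, t x = x) :
    SInv H A M (fx A M) b p t N where
  isMat := hM
  sub := filter_subset _ _
  root v hv h := mem_fx.2 ⟨hv, h⟩
  bE v hv := by rwa [hb v hv]
  bb v hv := by rw [hb v hv, hb v hv]
  inn v hv h := absurd (hb v hv) h
  out v hv _ h := absurd (mem_fx.1 hv).2 h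
  pE v hv _ h := absurd (mem_fx.1 hv).2 h
  tinj u hu v hv _ _ h := by rwa [ht u hu, ht v hv] at h
  mat x hx := by
    refine ⟨hM.congr (hN x hx), ?_, congrArg card (fx_congr (hN x hx))⟩
    rw [hN x hx x (mem_fx.1 hx).1, (mem_fx.1 hx).2]
  same x hx v _ _ := by rw [hb x hx]
  brt β hβ _ _ v hv := hN β hβ v hv
  bnr v hv _ h := absurd (mem_fx.1 hv).2 h

end SInv

end Matching

/-! ### Contracting the blossom closed by an edge between outer vertices -/

namespace Matching

open Finset

/-- `v` lies in one of the blossoms with base in `L`, or is the partner of such a base. -/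
def Touched (M : ℕ → ℕ) (E : Finset ℕ) (b : ℕ → ℕ) (L : Finset ℕ) (v : ℕ) : Prop :=
  (v ∈ E ∧ b v ∈ L) ∨ ∃ β ∈ L, v = M β

/-- A row that misses `z` with as few missed vertices as `M`. -/
def Row (H : SimpleGraph ℕ) (A : Finset ℕ) (M N : ℕ → ℕ) (z : ℕ) : Prop :=
  IsMat H A N ∧ N z = z ∧ #(fx A N) = #(fx A M)

/-- The row `Nz` follows the row of one of the ends of the edge `x y` off the touched vertices and
the blossom of that end. -/
def Follows (A : Finset ℕ) (M : ℕ → ℕ) (E : Finset ℕ) (b : ℕ → ℕ) (N : ℕ → ℕ → ℕ) (L : Finset ℕ)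
    (x y : ℕ) (Nz : ℕ → ℕ) (z : ℕ) : Prop :=
  ∃ e, (e = x ∨ e = y) ∧ (Touched M E b L z ∨ z = e) ∧
    ∀ v ∈ A, ¬ Touched M E b L v → ¬ (v ∈ E ∧ b v = b e) → Nz v = N e v

/-- Progress of the contraction of the edge `x y` between outer vertices: `L` is the set of bases
passed so far on the two ways up, the walks stand at `q₁` and `q₂`, and they are about to
continue the rows of `c₁` and `c₂`. -/
structure LInv (H : SimpleGraph ℕ) (A : Finset ℕ) (M : ℕ → ℕ) (E : Finset ℕ) (b p t : ℕ → ℕ)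
    (N : ℕ → ℕ → ℕ) (x y : ℕ) (L : Finset ℕ) (N' : ℕ → ℕ → ℕ) (c₁ q₁ c₂ q₂ : ℕ) : Prop where
  row : ∀ u ∈ E, ∀ v ∈ A, N' u v = N u v
  low : ∀ β ∈ L, β ∈ E ∧ b β = β ∧ M β ≠ β ∧ t (b q₁) < t β ∧ t (b q₂) < t β ∧
    (b (p β) ∈ L ∨ b (p β) = b q₁ ∨ b (p β) = b q₂)
  q1 : q₁ ∈ E
  q2 : q₂ ∈ E
  adj1 : H.Adj c₁ q₁
  adj2 : H.Adj c₂ q₂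
  c1 : c₁ ∈ E ∨ ∃ β ∈ L, c₁ = M β
  c2 : c₂ ∈ E ∨ ∃ β ∈ L, c₂ = M β
  m1 : Row H A M (N' c₁) c₁
  m2 : Row H A M (N' c₂) c₂
  k1 : ∀ v ∈ A, ¬ Touched M E b L v → ¬ OnCh M E b p q₂ v → N' c₁ v = M v
  k2 : ∀ v ∈ A, ¬ Touched M E b L v → ¬ OnCh M E b p q₁ v → N' c₂ v = M v
  t1 : Touched M E b L c₁ ∨ OnCh M E b p q₂ c₁
  t2 : Touched M E b L c₂ ∨ OnCh M E b p q₁ c₂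
  x0 : x ∈ E
  y0 : y ∈ E
  bx : b x ∈ L ∨ b x = b q₁ ∨ b x = b q₂
  bY : b y ∈ L ∨ b y = b q₁ ∨ b y = b q₂
  new : ∀ β ∈ L, Row H A M (N' (M β)) (M β) ∧ Follows A M E b N L x y (N' (M β)) (M β)
  o1 : Follows A M E b N L x y (N' c₁) c₁
  o2 : Follows A M E b N L x y (N' c₂) c₂

variable {H : SimpleGraph ℕ} {A : Finset ℕ} {M : ℕ → ℕ} {E : Finset ℕ} {b p t : ℕ → ℕ}
    {N N' : ℕ → ℕ → ℕ} {x y : ℕ} {L : Finset ℕ} {c₁ q₁ c₂ q₂ : ℕ}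

theorem Touched.mono {L L' : Finset ℕ} (h : L ⊆ L') {v : ℕ} (hv : Touched M E b L v) :
    Touched M E b L' v := by
  rcases hv with hv | ⟨β, hβ, hv⟩
  exacts [Or.inl ⟨hv.1, h hv.2⟩, Or.inr ⟨β, h hβ, hv⟩]

theorem Follows.mono {L L' : Finset ℕ} (h : L ⊆ L') {Nz : ℕ → ℕ} {z : ℕ}
    (hF : Follows A M E b N L x y Nz z) : Follows A M E b N L' x y Nz z := by
  obtain ⟨e, he, hz, hF⟩ := hF
  exact ⟨e, he, hz.imp_left (Touched.mono h), fun v hv ht => hF v hv fun h' => ht (h'.mono h)⟩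

theorem Row.congr {Nz Nz' : ℕ → ℕ} {z : ℕ} (hz : z ∈ A) (h : Row H A M Nz z)
    (he : ∀ v ∈ A, Nz' v = Nz v) : Row H A M Nz' z :=
  ⟨h.1.congr he, by rw [he z hz, h.2.1], by rw [fx_congr he, h.2.2]⟩

theorem Follows.congr {Nz Nz' : ℕ → ℕ} {z : ℕ} (h : Follows A M E b N L x y Nz z)
    (he : ∀ v ∈ A, Nz' v = Nz v) : Follows A M E b N L x y Nz' z := by
  obtain ⟨e, h1, h3, h2⟩ := h
  exact ⟨e, h1, h3, fun v hv ht hc => by rw [he v hv, h2 v hv ht hc]⟩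

namespace LInv

theorem swap (I : LInv H A M E b p t N x y L N' c₁ q₁ c₂ q₂) :
    LInv H A M E b p t N x y L N' c₂ q₂ c₁ q₁ where
  row := I.row
  low β hβ := by
    obtain ⟨h1, h2, h3, h4, h5, h6⟩ := I.low β hβ
    exact ⟨h1, h2, h3, h5, h4, h6.imp_right Or.symm⟩
  q1 := I.q2
  q2 := I.q1
  adj1 := I.adj2
  adj2 := I.adj1
  c1 := I.c2
  c2 := I.c1
  m1 := I.m2
  m2 := I.m1
  k1 := I.k2
  k2 := I.k1
  t1 := I.t2
  t2 := I.t1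
  x0 := I.x0
  y0 := I.y0
  bx := I.bx.imp_right Or.symm
  bY := I.bY.imp_right Or.symm
  new := I.new
  o1 := I.o2
  o2 := I.o1

/-- The walk that stands at `x` extends the row of `y`, since it enters the blossom of `x` through
the edge `y x`; the other walk is symmetric. -/
theorem init (S : SInv H A M E b p t N) (hx : x ∈ E) (hy : y ∈ E) (hadj : H.Adj x y) :
    LInv H A M E b p t N x y ∅ N y x x y where
  row _ _ _ _ := rfl
  low β hβ := absurd hβ (notMem_empty β)
  q1 := hx
  q2 := hy
  adj1 := hadj.symm
  adj2 := hadj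
  c1 := Or.inl hy
  c2 := Or.inl hx
  m1 := S.mat y hy
  m2 := S.mat x hx
  k1 _ hv _ h := S.off_chain hy hv h
  k2 _ hv _ h := S.off_chain hx hv h
  t1 := Or.inr ⟨_, Anc.refl _, Or.inl ⟨hy, rfl⟩⟩
  t2 := Or.inr ⟨_, Anc.refl _, Or.inl ⟨hx, rfl⟩⟩
  x0 := hx
  y0 := hy
  bx := Or.inr (Or.inl rfl)
  bY := Or.inr (Or.inr rfl)
  new β hβ := absurd hβ (notMem_empty β)
  o1 := ⟨y, Or.inr rfl, Or.inr rfl, fun _ _ _ _ => rfl⟩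
  o2 := ⟨x, Or.inl rfl, Or.inr rfl, fun _ _ _ _ => rfl⟩

theorem c1A (S : SInv H A M E b p t N) (I : LInv H A M E b p t N x y L N' c₁ q₁ c₂ q₂) :
    c₁ ∈ A := by
  rcases I.c1 with h | ⟨β, hβ, rfl⟩
  · exact S.sub h
  · exact (S.isMat β (S.sub (I.low β hβ).1)).1

/-- The bases already passed are later than `b q₁`, and those above `q₂` are earlier, so `b q₁` is
among neither. Partners of distinct bases differ, and partners of matched bases are not outer, so no
overlap can arise through them either. Hence the row of `c₁` still equals `M` on this blossom and on
the partner of its base. -/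
theorem free (S : SInv H A M E b p t N) (I : LInv H A M E b p t N x y L N' c₁ q₁ c₂ q₂)
    (hne : b q₁ ≠ b q₂) (hle : t (b q₂) ≤ t (b q₁)) {v : ℕ}
    (hv : (v ∈ E ∧ b v = b q₁) ∨ v = M (b q₁)) :
    v ∈ A ∧ ¬ Touched M E b L v ∧ ¬ OnCh M E b p q₂ v := by
  have hβ := S.bE _ I.q1
  have hbb := S.bb _ I.q1
  have hlt : t (b q₂) < t (b q₁) := lt_of_le_of_ne hle fun h =>
    hne (S.tinj _ hβ _ (S.bE _ I.q2) hbb (S.bb _ I.q2) h.symm)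
  have hβL : b q₁ ∉ L := fun h => absurd (I.low _ h).2.2.2.1 (lt_irrefl _)
  have hinj : ∀ u ∈ E, b u = u → M (b q₁) = M u → u = b q₁ := by
    intro u hu _ h
    rw [← (S.isMat _ (S.sub hβ)).2.1, h, (S.isMat _ (S.sub hu)).2.1]
  have hnE : ∀ u ∈ E, b u = u → M u ≠ u → ∀ w ∈ E, w ≠ M u := by
    rintro u hu hbu hMu w hw rfl
    exact S.out u hu hbu hMu hw
  refine ⟨?_, ?_, ?_⟩
  · rcases hv with hv | rfl
    exacts [S.sub hv.1, (S.isMat _ (S.sub hβ)).1]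
  · rintro (⟨h1, h2⟩ | ⟨γ, hγ, h1⟩)
    · rcases hv with hv | rfl
      · exact hβL (hv.2 ▸ h2)
      · by_cases hr : M (b q₁) = b q₁
        · rw [hr, hbb] at h2; exact hβL h2
        · exact hnE _ hβ hbb hr _ h1 rfl
    · obtain ⟨g1, g2, g3, -⟩ := I.low γ hγ
      rcases hv with hv | hv
      · exact hnE γ g1 g2 g3 v hv.1 h1
      · exact hβL (hinj γ g1 g2 (hv.symm.trans h1) ▸ hγ)
  · rintro ⟨γ, hγ, h1⟩
    obtain ⟨g1, g2, g3⟩ := S.anc_le hγ (S.bE _ I.q2) (S.bb _ I.q2)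
    have hγβ : γ ≠ b q₁ := by rintro rfl; omega
    rcases h1 with ⟨h1, h2⟩ | ⟨h1, h2⟩
    · rcases hv with hv | rfl
      · exact hγβ (h2 ▸ hv.2)
      · by_cases hr : M (b q₁) = b q₁
        · rw [hr, hbb] at h2; exact hγβ h2.symm
        · exact hnE _ hβ hbb hr _ h1 rfl
    · rcases hv with hv | hv
      · exact hnE γ g1 g2 h1 v hv.1 h2
      · exact hγβ (hinj γ g1 g2 (hv.symm.trans h2))

/-- One step up on the later side. -/
theorem lift (S : SInv H A M E b p t N) (hopt : Opt H A M)
    (I : LInv H A M E b p t N x y L N' c₁ q₁ c₂ q₂)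
    (hne : b q₁ ≠ b q₂) (hle : t (b q₂) ≤ t (b q₁)) :
    M (b q₁) ≠ b q₁ ∧ M (b q₁) ∉ E ∧ b q₁ ∉ L ∧ c₁ ≠ M (b q₁) ∧ c₂ ≠ M (b q₁) ∧
    ∀ N'' : ℕ → ℕ → ℕ,
      (∀ u ∈ A, u ≠ M (b q₁) → ∀ v ∈ A, N'' u v = N' u v) →
      (∀ v ∈ A, N'' (M (b q₁)) v =
        glue (fun v => v ∈ E ∧ b v = b q₁) (N' c₁) (N' q₁) c₁ q₁ (M (b q₁)) v) →
      LInv H A M E b p t N x y (insert (b q₁) L) N'' (M (b q₁)) (p (b q₁)) c₂ q₂ := by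
  have hβ := S.bE _ I.q1
  have hbb := S.bb _ I.q1
  set β := b q₁ with hβdef
  have hlt : t (b q₂) < t β := lt_of_le_of_ne hle fun h =>
    hne (S.tinj _ hβ _ (S.bE _ I.q2) hbb (S.bb _ I.q2) h.symm)
  have hβL : β ∉ L := fun h => absurd (I.low _ h).2.2.2.1 (lt_irrefl _)
  have hfree : ∀ v, (v ∈ E ∧ b v = β) ∨ v = M β →
    v ∈ A ∧ ¬ Touched M E b L v ∧ ¬ OnCh M E b p q₂ v := fun v hv => I.free S hne hle hv
  have hcf : ∀ v, (v ∈ E ∧ b v = β) ∨ v = M β → c₁ ≠ v := by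
    rintro v hv rfl
    obtain ⟨-, h1, h2⟩ := hfree _ hv
    exact I.t1.elim h1 h2
  have hNcM : ∀ v, (v ∈ E ∧ b v = β) ∨ v = M β → N' c₁ v = M v := by
    intro v hv
    obtain ⟨h0, h1, h2⟩ := hfree _ hv
    exact I.k1 v h0 h1 h2
  have hcA := I.c1A S
  have hq1A := S.sub I.q1
  have hNq : IsMat H A (N' q₁) := (S.mat _ I.q1).1.congr (I.row _ I.q1)
  have hqq : N' q₁ q₁ = q₁ := by rw [I.row _ I.q1 _ hq1A]; exact (S.mat _ I.q1).2.1
  have hBM : ∀ v, (v ∈ E ∧ b v = β) → v ≠ β → (M v ∈ E ∧ b (M v) = β) ∧ M v ≠ v := by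
    rintro v ⟨h1, h2⟩ h3
    obtain ⟨h4, h5, h6⟩ := S.inn v h1 (by rw [h2]; exact h3.symm)
    exact ⟨⟨h4, h5.trans h2⟩, h6⟩
  have hBq : ∀ v, (v ∈ E ∧ b v = β) → v ≠ q₁ →
      (N' q₁ v ∈ E ∧ b (N' q₁ v) = β) ∧ N' q₁ v ≠ v := by
    rintro v ⟨h1, h2⟩ h3
    rw [I.row _ I.q1 v (S.sub h1)]
    obtain ⟨h4, h5, h6⟩ := S.cls I.q1 h1 h2 h3
    exact ⟨⟨h4, h5⟩, h6⟩
  have hzB : M β ≠ β → ¬ (M β ∈ E ∧ b (M β) = β) := fun h h' => S.out β hβ hbb h h'.1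
  have G1 := glue_isMat (B := fun v => v ∈ E ∧ b v = β) S.isMat I.m1.1 hNq
    (fun v hv => S.sub hv.1) ⟨hβ, hbb⟩ ⟨I.q1, rfl⟩ hcA
    (fun h => hcf c₁ (Or.inl h) rfl) rfl hzB (hcf _ (Or.inr rfl)) I.adj1 I.m1.2.1 hqq hNcM
    (fun v hv h => (hBM v hv h).1) hBq
  have G2 := fx_glue (B := fun v => v ∈ E ∧ b v = β) (Nc := N' c₁) (Nq := N' q₁) S.isMat
    (fun v hv => S.sub hv.1) ⟨hβ, hbb⟩ ⟨I.q1, rfl⟩ hcA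
    (fun h => hcf c₁ (Or.inl h) rfl) rfl hzB (hcf _ (Or.inr rfl)) I.m1.2.1 hNcM
    (fun v hv h => (hBM v hv h).2) (fun v hv h => (hBq v hv h).2)
  -- If the later base were a root, the glued matching would have smaller defect than the maximum
  -- matching `M`.
  have hr : M β ≠ β := by
    intro h
    rw [if_pos h] at G1
    have h1 := hopt.2 _ G1
    have h2 := G2.2 h
    rw [I.m1.2.2] at h2
    omega
  rw [if_neg hr] at G1
  have hzE : M β ∉ E := S.out β hβ hbb hr
  have hc2z : c₂ ≠ M β := by
    rcases I.c2 with h | ⟨γ, hγ, h⟩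
    · exact fun h' => hzE (h' ▸ h)
    · intro h'
      have : γ = β := by
        rw [← (S.isMat _ (S.sub hβ)).2.1, ← h', h, (S.isMat _ (S.sub (I.low γ hγ).1)).2.1]
      exact hβL (this ▸ hγ)
  refine ⟨hr, hzE, hβL, hcf _ (Or.inr rfl), hc2z, fun N'' hN1 hN2 => ?_⟩
  obtain ⟨p1, p2, p3⟩ := S.pE β hβ hbb hr
  have hzA : M β ∈ A := (S.isMat β (S.sub hβ)).1
  have hsub : L ⊆ insert β L := subset_insert _ _
  have hzq : M β ≠ q₁ := fun h => hzE (h ▸ I.q1)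
  have hrow : Row H A M (N'' (M β)) (M β) := by
    refine Row.congr hzA ⟨G1, ?_, ?_⟩ hN2
    · exact glue_z (hcf _ (Or.inr rfl)).symm hzq
    · rw [G2.1 hr, I.m1.2.2]
  have hTβ : ∀ v, (v ∈ E ∧ b v = β) ∨ v = M β → Touched M E b (insert β L) v := by
    rintro v (h | h)
    · exact Or.inl ⟨h.1, by rw [h.2]; exact mem_insert_self _ _⟩
    · exact Or.inr ⟨β, mem_insert_self _ _, h⟩
  have hout : ∀ v ∈ A, ¬ Touched M E b (insert β L) v → v ≠ c₁ → N'' (M β) v = N' c₁ v := by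
    intro v hv hT hvc
    rw [hN2 v hv, glue_out hvc]
    · rintro rfl
      exact hT (hTβ _ (Or.inl ⟨I.q1, rfl⟩))
    · rintro rfl
      exact hT (hTβ _ (Or.inr rfl))
    · exact fun h => hT (hTβ _ (Or.inl h))
  have hch : ∀ v, OnCh M E b p q₁ v → Touched M E b (insert β L) v ∨ OnCh M E b p (p β) v := by
    rintro v ⟨γ, hγ, h⟩
    cases hγ with
    | refl => exact Or.inl (hTβ v (h.imp id And.right))
    | step _ hγ => exact Or.inr ⟨γ, hγ, h⟩
  have hc2A : c₂ ∈ A := I.swap.c1A S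
  have hfol : Follows A M E b N (insert β L) x y (N'' (M β)) (M β) := by
    obtain ⟨e, he, h1, h2⟩ := I.o1
    refine ⟨e, he, Or.inl (hTβ _ (Or.inr rfl)), fun v hv hT hc => ?_⟩
    have hvc : v ≠ c₁ := by
      rintro rfl
      rcases h1 with h1 | rfl
      · exact hT (h1.mono hsub)
      · exact hc ⟨by rcases he with rfl | rfl; exacts [I.x0, I.y0], rfl⟩
    rw [hout v hv hT hvc]
    exact h2 v hv (fun h => hT (h.mono hsub)) hc
  have hzne : ∀ u ∈ E, u ≠ M β := fun u hu h => hzE (h ▸ hu)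
  exact
  { row := fun u hu v hv => by rw [hN1 u (S.sub hu) (hzne u hu) v hv, I.row u hu v hv]
    low := by
      intro γ hγ
      rcases mem_insert.1 hγ with rfl | hγ
      · exact ⟨hβ, hbb, hr, p3, hlt, Or.inr (Or.inl rfl)⟩
      · obtain ⟨h1, h2, h3, h4, h5, h6⟩ := I.low γ hγ
        refine ⟨h1, h2, h3, p3.trans h4, h5, ?_⟩
        rcases h6 with h6 | h6 | h6
        · exact Or.inl (mem_insert_of_mem h6)
        · exact Or.inl (h6 ▸ mem_insert_self _ _)
        · exact Or.inr (Or.inr h6)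
    q1 := p1
    q2 := I.q2
    adj1 := p2.symm
    adj2 := I.adj2
    c1 := Or.inr ⟨β, mem_insert_self _ _, rfl⟩
    c2 := I.c2.imp id fun ⟨γ, hγ, h⟩ => ⟨γ, mem_insert_of_mem hγ, h⟩
    m1 := hrow
    m2 := I.m2.congr hc2A (hN1 _ hc2A hc2z)
    k1 := by
      intro v hv hT hO
      have hvc : v ≠ c₁ := by
        rintro rfl
        exact I.t1.elim (fun h => hT (h.mono hsub)) hO
      rw [hout v hv hT hvc]
      exact I.k1 v hv (fun h => hT (h.mono hsub)) hO
    k2 := by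
      intro v hv hT hO
      rw [hN1 _ hc2A hc2z v hv]
      exact I.k2 v hv (fun h => hT (h.mono hsub)) fun h => (hch v h).elim hT hO
    t1 := Or.inl (hTβ _ (Or.inr rfl))
    t2 := I.t2.elim (fun h => Or.inl (h.mono hsub)) (hch _)
    x0 := I.x0
    y0 := I.y0
    bx := by
      rcases I.bx with h | h | h
      exacts [Or.inl (mem_insert_of_mem h), Or.inl (h ▸ mem_insert_self _ _), Or.inr (Or.inr h)]
    bY := by
      rcases I.bY with h | h | h
      exacts [Or.inl (mem_insert_of_mem h), Or.inl (h ▸ mem_insert_self _ _), Or.inr (Or.inr h)]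
    new := by
      intro γ hγ
      rcases mem_insert.1 hγ with rfl | hγ
      · exact ⟨hrow, hfol⟩
      · have hγA := S.sub (I.low γ hγ).1
        have hne' : M γ ≠ M β := by
          intro h
          have : γ = β := by
            rw [← (S.isMat _ (S.sub hβ)).2.1, ← h, (S.isMat _ hγA).2.1]
          exact hβL (this ▸ hγ)
        have hMA := (S.isMat γ hγA).1
        exact ⟨(I.new γ hγ).1.congr hMA (hN1 _ hMA hne'),
          ((I.new γ hγ).2.mono hsub).congr (hN1 _ hMA hne')⟩
    o1 := hfol
    o2 := (I.o2.mono hsub).congr (hN1 _ hc2A hc2z) }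

/-- Contraction: all blossoms passed and the partners of their bases become one blossom. -/
theorem merge (S : SInv H A M E b p t N) (I : LInv H A M E b p t N x y L N' c₁ q₁ c₂ q₂)
    (heq : b q₁ = b q₂) {b' : ℕ → ℕ}
    (hb1 : ∀ v, Touched M E b L v → b' v = b q₁)
    (hb2 : ∀ v ∈ E, b v ∉ L → b' v = b v) :
    SInv H A M (E ∪ L.image M) b' p t N' := by
  set lam := b q₁ with hlam
  have hlE : lam ∈ E := S.bE _ I.q1
  have hbl : b lam = lam := S.bb _ I.q1
  have hlL : lam ∉ L := fun h => absurd (I.low _ h).2.2.2.1 (lt_irrefl _)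
  have hb'l : b' lam = lam := by rw [hb2 lam hlE (by rw [hbl]; exact hlL), hbl]
  have hMM : ∀ v ∈ A, M (M v) = v := fun v hv => (S.isMat v hv).2.1
  have hmemE : ∀ {v}, v ∈ E ∪ L.image M ↔ v ∈ E ∨ ∃ β ∈ L, v = M β := by
    intro v
    simp only [mem_union, mem_image, eq_comm]
  have hzE : ∀ β ∈ L, M β ∉ E := by
    intro β hβ
    obtain ⟨h1, h2, h3, -⟩ := I.low β hβ
    exact S.out β h1 h2 h3
  have hcases : ∀ v ∈ E ∪ L.image M,
      (v ∈ E ∧ b v ∉ L ∧ b' v = b v) ∨ (v ∈ E ∧ b v ∈ L ∧ b' v = lam) ∨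
      (∃ β ∈ L, v = M β ∧ b' v = lam) := by
    intro v hv
    rcases hmemE.1 hv with h | ⟨β, hβ, h⟩
    · by_cases hc : b v ∈ L
      · exact Or.inr (Or.inl ⟨h, hc, hb1 v (Or.inl ⟨h, hc⟩)⟩)
      · exact Or.inl ⟨h, hc, hb2 v h hc⟩
    · exact Or.inr (Or.inr ⟨β, hβ, h, hb1 v (Or.inr ⟨β, hβ, h⟩)⟩)
  have hsubE : ∀ {v}, v ∈ E → v ∈ E ∪ L.image M := fun h => mem_union_left _ h
  have hbase : ∀ v ∈ E ∪ L.image M, b' v = v → v ∈ E ∧ b v = v ∧ v ∉ L := by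
    intro v hv hbv
    rcases hcases v hv with ⟨h1, h2, h3⟩ | ⟨h1, h2, h3⟩ | ⟨β, hβ, h2, h3⟩
    · have : b v = v := h3.symm.trans hbv
      exact ⟨h1, this, by rwa [this] at h2⟩
    · have : v = lam := hbv.symm.trans h3
      rw [this, hbl] at h2
      exact absurd h2 hlL
    · have : v = lam := hbv.symm.trans h3
      rw [this] at h2
      exact absurd (h2 ▸ hlE) (hzE β hβ)
  have hbb' : ∀ v ∈ E, b v = v → v ∉ L → b' v = v := by
    intro v hv hb hL
    rw [hb2 v hv (by rwa [hb]), hb]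
  -- rows of outer vertices in the merged blossom
  have hsameE : ∀ u ∈ E, b' u = lam → ∀ v ∈ A, ¬ (v ∈ E ∪ L.image M ∧ b' v = lam) →
      N u v = N lam v := by
    intro u hu hbu v hv hc
    have hcl : ∀ w, Touched M E b L w ∨ (w ∈ E ∧ b w = lam) → v ≠ w := by
      rintro w hw rfl
      rcases hw with hw | hw
      · refine hc ⟨?_, hb1 _ hw⟩
        rcases hw with hw | hw
        exacts [hmemE.2 (Or.inl hw.1), hmemE.2 (Or.inr hw)]
      · exact hc ⟨hsubE hw.1, by rw [hb2 _ hw.1 (by rw [hw.2]; exact hlL), hw.2]⟩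
    -- Go up the tree: away from the merged class the row of `u` is the row of `p (b u)`, whose base
    -- is earlier and is again a passed base or `lam`. The climb ends in the blossom of `lam`.
    induction hk : t (b u) using Nat.strong_induction_on generalizing u with
    | _ k ih =>
      by_cases hul : b u = lam
      · rw [S.same u hu v hv, hul]
        rintro ⟨h1, h2⟩
        exact hcl v (Or.inr ⟨h1, h2.trans hul⟩) rfl
      · have huL : b u ∈ L := by
          by_contra h
          exact hul ((hb2 u hu h).symm.trans hbu)
        obtain ⟨l1, l2, l3, -, -, l6⟩ := I.low _ huL
        obtain ⟨p1, p2, p3⟩ := S.pE _ l1 l2 l3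
        have hpc : b (p (b u)) ∈ L ∨ b (p (b u)) = lam := by
          rcases l6 with h | h | h
          exacts [Or.inl h, Or.inr h, Or.inr (h.trans heq.symm)]
        have hpt : Touched M E b L (p (b u)) ∨ (p (b u) ∈ E ∧ b (p (b u)) = lam) :=
          hpc.imp (fun h => Or.inl ⟨p1, h⟩) fun h => ⟨p1, h⟩
        have hbp : b' (p (b u)) = lam := by
          rcases hpc with h | h
          · exact hb1 _ (Or.inl ⟨p1, h⟩)
          · rw [hb2 _ p1 (by rw [h]; exact hlL), h]
        rw [S.same u hu v hv (fun h => hcl v (Or.inl (Or.inl ⟨h.1, h.2 ▸ huL⟩)) rfl),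
          (S.bnr _ l1 l2 l3).2 v hv (hcl _ (Or.inl (Or.inl ⟨l1, by rwa [l2]⟩)))
            (hcl _ (Or.inl (Or.inr ⟨_, huL, rfl⟩))) (hcl _ hpt)]
        exact ih _ (hk ▸ p3) _ p1 hbp rfl
  have hend : ∀ e, e = x ∨ e = y → e ∈ E ∧ b' e = lam ∧ (b e ∈ L ∨ b e = lam) := by
    have aux : ∀ e ∈ E, (b e ∈ L ∨ b e = b q₁ ∨ b e = b q₂) →
        e ∈ E ∧ b' e = lam ∧ (b e ∈ L ∨ b e = lam) := by
      intro e he h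
      have h' : b e ∈ L ∨ b e = lam := by
        rcases h with h | h | h
        exacts [Or.inl h, Or.inr h, Or.inr (h.trans heq.symm)]
      refine ⟨he, ?_, h'⟩
      rcases h' with h | h
      · exact hb1 e (Or.inl ⟨he, h⟩)
      · rw [hb2 e he (by rw [h]; exact hlL), h]
    rintro e (rfl | rfl)
    exacts [aux _ I.x0 I.bx, aux _ I.y0 I.bY]
  refine
  { isMat := S.isMat
    sub := ?_
    root := fun v hv h => hsubE (S.root v hv h)
    bE := ?_
    bb := ?_
    inn := ?_
    out := ?_
    pE := ?_
    tinj := ?_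
    mat := ?_
    same := ?_
    brt := ?_
    bnr := ?_ }
  · intro v hv
    rcases hmemE.1 hv with h | ⟨β, hβ, rfl⟩
    exacts [S.sub h, (S.isMat β (S.sub (I.low β hβ).1)).1]
  · intro v hv
    rcases hcases v hv with ⟨h1, h2, h3⟩ | ⟨h1, h2, h3⟩ | ⟨β, hβ, h2, h3⟩
    · rw [h3]; exact hsubE (S.bE v h1)
    · rw [h3]; exact hsubE hlE
    · rw [h3]; exact hsubE hlE
  · intro v hv
    rcases hcases v hv with ⟨h1, h2, h3⟩ | ⟨h1, h2, h3⟩ | ⟨β, hβ, h2, h3⟩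
    · rw [h3, hb2 _ (S.bE v h1) (by rwa [S.bb v h1]), S.bb v h1]
    · rw [h3, hb'l]
    · rw [h3, hb'l]
  · intro v hv hne
    rcases hcases v hv with ⟨h1, h2, h3⟩ | ⟨h1, h2, h3⟩ | ⟨β, hβ, h2, h3⟩
    · rw [h3] at hne
      obtain ⟨i1, i2, i3⟩ := S.inn v h1 hne
      exact ⟨hsubE i1, by rw [h3, hb2 _ i1 (by rwa [i2]), i2], i3⟩
    · by_cases hbv : b v = v
      · have hvL : v ∈ L := hbv ▸ h2
        exact ⟨hmemE.2 (Or.inr ⟨v, hvL, rfl⟩), by rw [h3]; exact hb1 _ (Or.inr ⟨v, hvL, rfl⟩),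
          (I.low v hvL).2.2.1⟩
      · obtain ⟨i1, i2, i3⟩ := S.inn v h1 hbv
        exact ⟨hsubE i1, by rw [h3]; exact hb1 _ (Or.inl ⟨i1, by rwa [i2]⟩), i3⟩
    · obtain ⟨l1, l2, l3, -⟩ := I.low β hβ
      rw [h3, h2, hMM β (S.sub l1)]
      exact ⟨hsubE l1, hb1 _ (Or.inl ⟨l1, by rwa [l2]⟩), l3.symm⟩
  · intro v hv hbv hMv hMvE
    obtain ⟨h1, h2, h3⟩ := hbase v hv hbv
    rcases hmemE.1 hMvE with h | ⟨β, hβ, h⟩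
    · exact S.out v h1 h2 hMv h
    · have : v = β := by rw [← hMM v (S.sub h1), h, hMM β (S.sub (I.low β hβ).1)]
      exact h3 (this ▸ hβ)
  · intro v hv hbv hMv
    obtain ⟨h1, h2, h3⟩ := hbase v hv hbv
    obtain ⟨p1, p2, p3⟩ := S.pE v h1 h2 hMv
    refine ⟨hsubE p1, p2, ?_⟩
    -- A passed base is replaced by `lam`, which is earlier than all of them, so the order of times
    -- survives.
    by_cases hc : b (p v) ∈ L
    · rw [hb1 _ (Or.inl ⟨p1, hc⟩)]
      exact (I.low _ hc).2.2.2.1.trans p3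
    · rwa [hb2 _ p1 hc]
  · intro u hu v hv hbu hbv h
    obtain ⟨u1, u2, -⟩ := hbase u hu hbu
    obtain ⟨v1, v2, -⟩ := hbase v hv hbv
    exact S.tinj u u1 v v1 u2 v2 h
  · intro u hu
    rcases hmemE.1 hu with h | ⟨β, hβ, rfl⟩
    · exact Row.congr (S.sub h) (S.mat u h) (I.row u h)
    · exact (I.new β hβ).1
  · intro u hu v hv hc
    rcases hcases u hu with ⟨h1, h2, h3⟩ | ⟨h1, h2, h3⟩ | ⟨β, hβ, h2, h3⟩
    · rw [h3] at hc ⊢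
      rw [I.row u h1 v hv, I.row _ (S.bE u h1) v hv]
      refine S.same u h1 v hv fun h => hc ⟨hsubE h.1, ?_⟩
      rw [hb2 v h.1 (by rwa [h.2]), h.2]
    · rw [h3] at hc ⊢
      rw [I.row u h1 v hv, I.row _ hlE v hv]
      exact hsameE u h1 h3 v hv hc
    · rw [h3] at hc ⊢
      obtain ⟨e, he, -, hF⟩ := (I.new β hβ).2
      obtain ⟨e1, e2, e3⟩ := hend e he
      rw [h2, hF v hv, I.row _ hlE v hv]
      · exact hsameE e e1 e2 v hv hc
      · intro hT
        refine hc ⟨?_, hb1 v hT⟩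
        rcases hT with hT | hT
        exacts [hsubE hT.1, hmemE.2 (Or.inr hT)]
      · rintro ⟨h4, h5⟩
        refine hc ⟨hsubE h4, ?_⟩
        rcases e3 with e3 | e3
        · exact hb1 v (Or.inl ⟨h4, by rwa [h5]⟩)
        · rw [hb2 v h4 (by rw [h5, e3]; exact hlL), h5, e3]
  · intro β hβ hb hM v hv
    obtain ⟨h1, h2, -⟩ := hbase β hβ hb
    rw [I.row β h1 v hv]
    exact S.brt β h1 h2 hM v hv
  · intro β hβ hb hM
    obtain ⟨h1, h2, -⟩ := hbase β hβ hb
    obtain ⟨r1, r2⟩ := S.bnr β h1 h2 hM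
    have hp := (S.pE β h1 h2 hM).1
    refine ⟨by rw [I.row β h1 _ (S.isMat β (S.sub h1)).1, r1], fun v hv a1 a2 a3 => ?_⟩
    rw [I.row β h1 v hv, I.row _ hp v hv]
    exact r2 v hv a1 a2 a3

/-- The partners of the passed bases are distinct and were not outer. The number of steps up thus
equals the number of vertices that become outer, to which the running time is charged. -/
theorem card_union (S : SInv H A M E b p t N)
    (I : LInv H A M E b p t N x y L N' c₁ q₁ c₂ q₂) : #(E ∪ L.image M) = #E + #L := by
  rw [card_union_of_disjoint, card_image_of_injOn]
  · intro u hu v hv h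
    rw [← (S.isMat u (S.sub (I.low u hu).1)).2.1, h, (S.isMat v (S.sub (I.low v hv).1)).2.1]
  · rw [disjoint_right]
    intro v hv
    obtain ⟨β, hβ, rfl⟩ := mem_image.1 hv
    obtain ⟨h1, h2, h3, -⟩ := I.low β hβ
    exact S.out β h1 h2 h3

end LInv

/-! ### Growing the tree, and completeness of the search -/

namespace SInv

/-- Growing the tree by an unlabelled vertex `y` and its partner. -/
theorem grow (S : SInv H A M E b p t N) (hx : x ∈ E) (hy : y ∈ A) (hyE : y ∉ E)
    (hMy : M y ∉ E) (hadj : H.Adj x y) {tm : ℕ}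
    (htm : ∀ v ∈ E, b v = v → t v < tm)
    (hrow : ∀ u ∈ E, ∀ v ∈ A, N' u v = N u v)
    (hnew : ∀ v ∈ A, N' (M y) v =
      glue (fun v => v ∈ E ∧ b v = y) (N x) (N y) x y (M y) v) :
    SInv H A M (insert (M y) E) (Function.update b (M y) (M y)) (Function.update p (M y) x)
      (Function.update t (M y) tm) N' := by
  have hM := S.isMat
  set z := M y with hz
  have hzA : z ∈ A := (hM y hy).1
  have hMz : M z = y := (hM y hy).2.1
  have hzy : z ≠ y := fun h => hyE (S.root y hy h)
  have hne : ∀ u ∈ E, u ≠ z := fun u hu h => hMy (h ▸ hu)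
  have hMne : ∀ u ∈ E, M u ≠ z := fun u hu h => by
    have : u = y := by rw [← (hM u (S.sub hu)).2.1, h, hMz]
    exact hyE (this ▸ hu)
  have hoff : ∀ v, v = y ∨ v = z → ¬ OnCh M E b p x v := by
    rintro v hv ⟨γ, hγ, h⟩
    obtain ⟨h1, -, -⟩ := S.anc_le hγ (S.bE x hx) (S.bb x hx)
    rcases h with h | h
    · rcases hv with rfl | rfl
      exacts [hyE h.1, hMy h.1]
    · have h2 : M v = γ := by rw [h.2, (hM γ (S.sub h1)).2.1]
      rcases hv with rfl | rfl
      · exact hMy (by rw [hz, h2]; exact h1)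
      · exact hyE (by rw [← hMz, h2]; exact h1)
  have hNM : ∀ v, v = y ∨ v = z → N x v = M v := by
    intro v hv
    refine S.off_chain hx ?_ (hoff v hv)
    rcases hv with rfl | rfl
    exacts [hy, hzA]
  have hxA := S.sub hx
  obtain ⟨r1, r2, r3⟩ := S.mat x hx
  -- `y` is not outer, so no outer vertex has base `y` and the stored row of `y`, which is
  -- meaningless, is never read. The result is the exchange along the one-vertex blossom `{y}`.
  have hgl : ∀ v ∈ A, N' z v = glue (fun v => v = y) (N x) id x y z v := by
    intro v hv
    rw [hnew v hv]
    by_cases h1 : v = y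
    · subst h1
      have h2 : v ≠ x := fun h => hyE (h ▸ hx)
      rw [glue_q h2, glue_q h2]
    · have : ¬ (v ∈ E ∧ b v = y) := fun h => hyE (h.2 ▸ S.bE v h.1)
      simp only [glue, h1, this, if_false]
  have hxy : x ≠ y := fun h => hyE (h ▸ hx)
  have G1 := glue_isMat (B := fun v => v = y) (Nq := id) hM r1 (isMat_id H A)
    (fun v hv => hv ▸ hy) rfl rfl hxA hxy hz.symm (fun h h' => h h') (hne x hx) hadj r2 rfl hNM
    (fun v hv h => absurd hv h) (fun v hv h => absurd hv h)
  rw [if_neg hzy] at G1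
  have G2 := (fx_glue (B := fun v => v = y) (Nc := N x) (Nq := id) hM
    (fun v hv => hv ▸ hy) rfl rfl hxA hxy hz.symm (fun h h' => h h') (hne x hx) r2 hNM
    (fun v hv h => absurd hv h) (fun v hv h => absurd hv h)).1 hzy
  have hbo : ∀ u ∈ E, Function.update b z z u = b u := fun u hu => by simp [hne u hu]
  have hbn : Function.update b z z z = z := by simp
  have hpo : ∀ u ∈ E, Function.update p z x u = p u := fun u hu => by simp [hne u hu]
  have hpn : Function.update p z x z = x := by simp
  have hto : ∀ u ∈ E, Function.update t z tm u = t u := fun u hu => by simp [hne u hu]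
  have htn : Function.update t z tm z = tm := by simp
  generalize Function.update b z z = b' at *
  generalize Function.update p z x = p' at *
  generalize Function.update t z tm = t' at *
  refine
  { isMat := hM
    sub := insert_subset hzA S.sub
    root := fun v hv h => mem_insert_of_mem (S.root v hv h)
    bE := ?_
    bb := ?_
    inn := ?_
    out := ?_
    pE := ?_
    tinj := ?_
    mat := ?_
    same := ?_
    brt := ?_
    bnr := ?_ }
  · intro v hv
    rcases mem_insert.1 hv with rfl | h
    · rw [hbn]; exact mem_insert_self _ _
    · rw [hbo v h]; exact mem_insert_of_mem (S.bE v h)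
  · intro v hv
    rcases mem_insert.1 hv with rfl | h
    · rw [hbn, hbn]
    · rw [hbo v h, hbo _ (S.bE v h), S.bb v h]
  · intro v hv hv'
    rcases mem_insert.1 hv with rfl | h
    · exact absurd hbn hv'
    · rw [hbo v h] at hv' ⊢
      obtain ⟨i1, i2, i3⟩ := S.inn v h hv'
      exact ⟨mem_insert_of_mem i1, by rw [hbo _ i1, i2], i3⟩
  · intro v hv hbv hMv h'
    rcases mem_insert.1 hv with rfl | h
    · rw [hMz] at h'
      rcases mem_insert.1 h' with h' | h'
      exacts [hzy h'.symm, hyE h']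
    · rw [hbo v h] at hbv
      rcases mem_insert.1 h' with h' | h'
      exacts [hMne v h h', S.out v h hbv hMv h']
  · intro v hv hbv hMv
    rcases mem_insert.1 hv with rfl | h
    · rw [hpn, hMz, hbo x hx, hto _ (S.bE x hx), htn]
      exact ⟨mem_insert_of_mem hx, hadj, htm _ (S.bE x hx) (S.bb x hx)⟩
    · rw [hbo v h] at hbv
      obtain ⟨p1, p2, p3⟩ := S.pE v h hbv hMv
      rw [hpo v h, hbo _ p1, hto _ (S.bE _ p1), hto v h]
      exact ⟨mem_insert_of_mem p1, p2, p3⟩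
  · intro u hu v hv hbu hbv h
    rcases mem_insert.1 hu with rfl | hu
    · rcases mem_insert.1 hv with rfl | hv
      · rfl
      · rw [htn, hto v hv] at h
        rw [hbo v hv] at hbv
        exact absurd h (htm v hv hbv).ne'
    · rcases mem_insert.1 hv with rfl | hv
      · rw [htn, hto u hu] at h
        rw [hbo u hu] at hbu
        exact absurd h (htm u hu hbu).ne
      · rw [hto u hu, hto v hv] at h
        rw [hbo u hu] at hbu
        rw [hbo v hv] at hbv
        exact S.tinj u hu v hv hbu hbv h
  · intro u hu
    rcases mem_insert.1 hu with rfl | hu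
    · exact Row.congr hzA ⟨G1, glue_z (hne x hx).symm hzy, G2.trans r3⟩ hgl
    · exact Row.congr (S.sub hu) (S.mat u hu) (hrow u hu)
  · intro u hu v hv hc
    rcases mem_insert.1 hu with rfl | hu
    · rw [hbn]
    · rw [hbo u hu] at hc ⊢
      rw [hrow u hu v hv, hrow _ (S.bE u hu) v hv]
      exact S.same u hu v hv fun h => hc ⟨mem_insert_of_mem h.1, by rw [hbo v h.1, h.2]⟩
  · intro β hβ hb hMb v hv
    rcases mem_insert.1 hβ with rfl | hβ
    · rw [hMz] at hMb
      exact absurd hMb.symm hzy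
    · rw [hbo β hβ] at hb
      rw [hrow β hβ v hv, S.brt β hβ hb hMb v hv]
  · intro β hβ hb hMb
    rcases mem_insert.1 hβ with rfl | hβ
    · rw [hMz, hpn]
      refine ⟨by rw [hgl y hy, glue_q hxy.symm], fun v hv h1 h2 h3 => ?_⟩
      rw [hgl v hv, glue_out h3 h2 h1 h2, hrow x hx v hv]
    · rw [hbo β hβ] at hb
      obtain ⟨r1, r2⟩ := S.bnr β hβ hb hMb
      have hp := (S.pE β hβ hb hMb).1
      rw [hpo β hβ]
      refine ⟨by rw [hrow β hβ _ (hM β (S.sub hβ)).1, r1], fun v hv h1 h2 h3 => ?_⟩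
      rw [hrow β hβ v hv, hrow _ hp v hv, r2 v hv h1 h2 h3]

/-- The edges from the outer vertices in `P` have been dealt with. -/
def Scanned (H : SimpleGraph ℕ) (A : Finset ℕ) (M : ℕ → ℕ) (E : Finset ℕ) (b : ℕ → ℕ)
    (P : Finset ℕ) (x y : ℕ) : Prop :=
  y ∈ A → H.Adj x y → (y ∈ E ∧ (b y = b x ∨ y ∉ P)) ∨ (y ∉ E ∧ M y ∈ E)

/-- When all outer vertices have been scanned, they are the vertices that some maximum matching
misses. -/
theorem outer_iff_miss (S : SInv H A M E b p t N) (hopt : Opt H A M)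
    (hP : ∀ x ∈ E, ∀ y, Scanned H A M E b E x y) {v : ℕ} (hv : v ∈ A) : v ∈ E ↔ Miss H A v := by
  constructor
  · intro h
    obtain ⟨h1, h2, h3⟩ := S.mat v h
    exact ⟨N v, hopt.of_card_le h1 h3.le, h2⟩
  · rintro ⟨N0, hN0, h0⟩
    by_contra hE
    have := (certificate S.isMat S.sub S.root S.inn S.out (fun x hx y hy hadj => by
      rcases hP x hx y hy hadj with ⟨h1, h2⟩ | h
      · exact Or.inl ⟨h1, h2.resolve_right fun h => h h1⟩
      · exact Or.inr h) hN0.1).2 v hv hE h0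
    have h2 := hN0.2 M hopt.1
    omega

end SInv

end Matching

/-! ### A small language with named variables and arrays on top of the word RAM -/

namespace GeoRAM

open WordRAM

/-- Named variables. -/
inductive Vr where
  | src | v | y | u | x | c | q | z | be | g | c1 | q1 | c2 | q2 | tm | h | w | d | k

/-- Named arrays. -/
inductive Ar where
  | A | M | E | dn | b | p | t | mr | V | pt | U | NM | Z | SN

/-- Values of the variables and arrays, and the time spent so far. -/
structure St where
  T : ℕ
  src : ℕ
  v : ℕ
  y : ℕ
  u : ℕ
  x : ℕ
  c : ℕ
  q : ℕ
  z : ℕ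
  be : ℕ
  g : ℕ
  c1 : ℕ
  q1 : ℕ
  c2 : ℕ
  q2 : ℕ
  tm : ℕ
  h : ℕ
  w : ℕ
  d : ℕ
  k : ℕ
  A : ℕ → ℕ
  M : ℕ → ℕ
  E : ℕ → ℕ
  dn : ℕ → ℕ
  b : ℕ → ℕ
  p : ℕ → ℕ
  t : ℕ → ℕ
  mr : ℕ → ℕ
  V : ℕ → ℕ
  pt : ℕ → ℕ
  U : ℕ → ℕ
  NM : ℕ → ℕ
  Z : ℕ → ℕ
  SN : ℕ → ℕ

/-- The register of a variable is one more than its index. -/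
def Vr.idx : Vr → ℕ
  | .src => 0 | .v => 1 | .y => 2 | .u => 3 | .x => 4 | .c => 5 | .q => 6 | .z => 7 | .be => 8
  | .g => 9 | .c1 => 10 | .q1 => 11 | .c2 => 12 | .q2 => 13 | .tm => 14 | .h => 15 | .w => 16
  | .d => 17 | .k => 18

/-- The residue mod `16` of the cells of an array. -/
def Ar.idx : Ar → ℕ
  | .A => 0 | .M => 1 | .E => 2 | .dn => 3 | .b => 4 | .p => 5 | .t => 6 | .mr => 7 | .V => 8
  | .pt => 9 | .U => 10 | .NM => 11 | .Z => 12 | .SN => 13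

namespace St

/-- Read a variable. -/
def get : Vr → St → ℕ
  | .src, s => s.src | .v, s => s.v | .y, s => s.y | .u, s => s.u | .x, s => s.x
  | .c, s => s.c | .q, s => s.q | .z, s => s.z | .be, s => s.be | .g, s => s.g
  | .c1, s => s.c1 | .q1, s => s.q1 | .c2, s => s.c2 | .q2, s => s.q2 | .tm, s => s.tm
  | .h, s => s.h | .w, s => s.w | .d, s => s.d | .k, s => s.k

/-- Write a variable. -/
def set : Vr → ℕ → St → St
  | .src, a, s => { s with src := a } | .v, a, s => { s with v := a }
  | .y, a, s => { s with y := a } | .u, a, s => { s with u := a }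
  | .x, a, s => { s with x := a } | .c, a, s => { s with c := a }
  | .q, a, s => { s with q := a } | .z, a, s => { s with z := a }
  | .be, a, s => { s with be := a } | .g, a, s => { s with g := a }
  | .c1, a, s => { s with c1 := a } | .q1, a, s => { s with q1 := a }
  | .c2, a, s => { s with c2 := a } | .q2, a, s => { s with q2 := a }
  | .tm, a, s => { s with tm := a } | .h, a, s => { s with h := a }
  | .w, a, s => { s with w := a } | .d, a, s => { s with d := a }
  | .k, a, s => { s with k := a }

/-- Read an array. -/
def getA : Ar → St → ℕ → ℕ
  | .A, s => s.A | .M, s => s.M | .E, s => s.E | .dn, s => s.dn | .b, s => s.b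
  | .p, s => s.p | .t, s => s.t | .mr, s => s.mr | .V, s => s.V | .pt, s => s.pt
  | .U, s => s.U | .NM, s => s.NM | .Z, s => s.Z | .SN, s => s.SN

/-- Write an array. -/
def setA : Ar → (ℕ → ℕ) → St → St
  | .A, f, s => { s with A := f } | .M, f, s => { s with M := f }
  | .E, f, s => { s with E := f } | .dn, f, s => { s with dn := f }
  | .b, f, s => { s with b := f } | .p, f, s => { s with p := f }
  | .t, f, s => { s with t := f } | .mr, f, s => { s with mr := f }
  | .V, f, s => { s with V := f } | .pt, f, s => { s with pt := f }
  | .U, f, s => { s with U := f } | .NM, f, s => { s with NM := f }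
  | .Z, f, s => { s with Z := f } | .SN, f, s => { s with SN := f }

/-- Advance the clock. -/
def tick (c : ℕ) (s : St) : St := { s with T := s.T + c }

theorem get_set_self (r : Vr) (a : ℕ) (s : St) : (s.set r a).get r = a := by
  cases r <;> rfl

theorem get_set_ne {r l : Vr} (h : r ≠ l) (a : ℕ) (s : St) : (s.set r a).get l = s.get l := by
  cases r <;> cases l <;> first | rfl | exact absurd rfl h

theorem getA_set (r : Vr) (a : ℕ) (s : St) (f : Ar) : (s.set r a).getA f = s.getA f := by
  cases r <;> cases f <;> rfl

theorem getA_setA_self (r : Ar) (a : ℕ → ℕ) (s : St) : (s.setA r a).getA r = a := by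
  cases r <;> rfl

theorem getA_setA_ne {r l : Ar} (h : r ≠ l) (a : ℕ → ℕ) (s : St) :
    (s.setA r a).getA l = s.getA l := by
  cases r <;> cases l <;> first | rfl | exact absurd rfl h

theorem get_setA (r : Ar) (a : ℕ → ℕ) (s : St) (f : Vr) : (s.setA r a).get f = s.get f := by
  cases r <;> cases f <;> rfl

theorem get_tick (c : ℕ) (s : St) (r : Vr) : (s.tick c).get r = s.get r := by cases r <;> rfl

theorem getA_tick (c : ℕ) (s : St) (r : Ar) : (s.tick c).getA r = s.getA r := by
  cases r <;> rfl

theorem T_set (r : Vr) (a : ℕ) (s : St) : (s.set r a).T = s.T := by cases r <;> rfl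

theorem T_setA (r : Ar) (a : ℕ → ℕ) (s : St) : (s.setA r a).T = s.T := by cases r <;> rfl

end St

theorem Vr.idx_injective {r l : Vr} (h : r.idx = l.idx) : r = l := by
  cases r <;> cases l <;> first | rfl | exact absurd h (by decide)

theorem Ar.idx_injective {r l : Ar} (h : r.idx = l.idx) : r = l := by
  cases r <;> cases l <;> first | rfl | exact absurd h (by decide)

theorem Ar.idx_lt (r : Ar) : r.idx < 16 := by cases r <;> decide

/-- Expressions; `ix` computes the position of an entry of a matrix with `n` columns. -/
inductive X where
  | lit (a : ℕ)
  | n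
  | v (r : Vr)
  | get (a : Ar) (i : X)
  | ix (i j : X)
  | adj (i j : X)
  | lt (e f : X)
  | eq (e f : X)
  | inc (e : X)
  | dec (e : X)

namespace X

/-- Translation to the word RAM. -/
def comp : X → Exp
  | lit a => .lit a
  | n => .reg 0
  | v r => .reg (r.idx + 1)
  | get a i => .load (.op .add (.op .add (.op .mul (.reg 0) (.reg 0)) (.lit a.idx))
      (.op .mul (.lit 16) i.comp))
  | ix i j => .op .add (.op .mul i.comp (.reg 0)) j.comp
  | adj i j => .load (.op .add (.op .mul i.comp (.reg 0)) j.comp)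
  | lt e f => .op .lt e.comp f.comp
  | eq e f => .op .eq e.comp f.comp
  | inc e => .op .add e.comp (.lit 1)
  | dec e => .op .sub e.comp (.lit 1)

/-- Number of steps. -/
def cost : X → ℕ
  | lit _ => 1
  | n => 1
  | v _ => 1
  | get _ i => i.cost + 9
  | ix i j => i.cost + j.cost + 3
  | adj i j => i.cost + j.cost + 4
  | lt e f => e.cost + f.cost + 1
  | eq e f => e.cost + f.cost + 1
  | inc e => e.cost + 2
  | dec e => e.cost + 2

end X

/-- All values stay below this bound. -/
def bnd (n : ℕ) : ℕ := 4 * (n + 1) ^ 2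

/-- Parameters of a run: number of vertices, word length, graph. -/
structure Mach where
  n : ℕ
  w : ℕ
  H : SimpleGraph ℕ
  hw : n * n + 16 * bnd n + 16 ≤ 2 ^ w

open Classical in
/-- Truth value as a number. -/
noncomputable def flag (p : Prop) : ℕ := if p then 1 else 0

theorem flag_ne_zero {p : Prop} : flag p ≠ 0 ↔ p := by simp [flag]

theorem flag_eq_zero {p : Prop} : flag p = 0 ↔ ¬ p := by simp [flag]

theorem flag_le (p : Prop) : flag p ≤ 1 := by unfold flag; split_ifs <;> simp

theorem ite_flag {p : Prop} [Decidable p] : (if p then 1 else 0) = flag p := by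
  unfold flag; split_ifs <;> rfl

namespace X

variable (m : Mach) (s : St)

/-- Value. -/
noncomputable def eval : X → ℕ
  | lit a => a
  | n => m.n
  | v r => s.get r
  | get a i => s.getA a (i.eval)
  | ix i j => i.eval * m.n + j.eval
  | adj i j => flag (m.H.Adj i.eval j.eval)
  | lt e f => flag (e.eval < f.eval)
  | eq e f => flag (e.eval = f.eval)
  | inc e => e.eval + 1
  | dec e => e.eval - 1

/-- No overflow occurs during the evaluation. -/
def ok : X → Prop
  | lit a => a ≤ 3
  | n => True
  | v _ => True
  | get _ i => i.ok
  | ix i j => i.ok ∧ j.ok ∧ i.eval m s ≤ m.n ∧ j.eval m s ≤ m.n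
  | adj i j => i.ok ∧ j.ok ∧ i.eval m s < m.n ∧ j.eval m s < m.n
  | lt e f => e.ok ∧ f.ok
  | eq e f => e.ok ∧ f.ok
  | inc e => e.ok ∧ e.eval m s ≤ 2 * m.n
  | dec e => e.ok

end X

/-- The machine state `σ` represents `s`. -/
structure Rep (m : Mach) (σ : State) (s : St) : Prop where
  n : σ.reg 0 = m.n
  reg : ∀ r : Vr, σ.reg (r.idx + 1) = s.get r
  lt : ∀ r, s.get r < bnd m.n
  arr : ∀ (a : Ar) (i : ℕ), i < bnd m.n → σ.mem (m.n * m.n + a.idx + 16 * i) = s.getA a i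
  alt : ∀ (a : Ar) (i : ℕ), i < bnd m.n → s.getA a i < bnd m.n
  adj : ∀ i j, i < m.n → j < m.n → σ.mem (i * m.n + j) = flag (m.H.Adj i j)

variable {m : Mach}

theorem le_bnd (N : ℕ) : N * N + N + 3 * N + 4 ≤ bnd N := by
  unfold bnd; nlinarith

theorem X.comp_cost (e : X) : e.comp.cost = e.cost := by
  induction e <;> simp_all only [X.comp, Exp.cost, X.cost] <;> omega

/-- The largest address is below `n * n + 16 * bnd n + 16 ≤ 2 ^ w`, so under `ok` none of the
reductions modulo `2 ^ w` changes anything. -/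
theorem X.comp_val {σ : State} {s : St} (hr : Rep m σ s) (e : X) (he : e.ok m s) :
    e.comp.val m.w σ = e.eval m s ∧ e.eval m s < bnd m.n := by
  have hw := m.hw
  have hb := le_bnd m.n
  have hb2 : bnd m.n < 2 ^ m.w := by omega
  induction e with
  | lit a =>
    simp only [X.ok] at he
    simp only [X.comp, Exp.val, X.eval]
    exact ⟨Nat.mod_eq_of_lt (by omega), by omega⟩
  | n => exact ⟨hr.n, by simp only [X.eval]; omega⟩
  | v r => exact ⟨hr.reg r, hr.lt r⟩
  | get a i ih =>
    obtain ⟨h1, h2⟩ := ih he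
    simp only [X.comp, Exp.val, Op.apply, X.eval, h1, hr.n]
    have ha := a.idx_lt
    refine ⟨?_, hr.alt a _ h2⟩
    rw [Nat.mod_eq_of_lt (a := m.n * m.n) (by omega), Nat.mod_eq_of_lt (a := a.idx) (by omega),
      Nat.mod_eq_of_lt (a := m.n * m.n + a.idx) (by omega), Nat.mod_eq_of_lt (a := 16) (by omega),
      Nat.mod_eq_of_lt (a := 16 * X.eval m s i) (by omega), Nat.mod_eq_of_lt (by omega)]
    exact hr.arr a _ h2
  | ix i j ih1 ih2 =>
    obtain ⟨o1, o2, o3, o4⟩ := he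
    obtain ⟨h1, h2⟩ := ih1 o1
    obtain ⟨h3, h4⟩ := ih2 o2
    simp only [X.comp, Exp.val, Op.apply, X.eval, h1, h3, hr.n]
    have := Nat.mul_le_mul_right m.n o3
    rw [Nat.mod_eq_of_lt (a := X.eval m s i * m.n) (by omega), Nat.mod_eq_of_lt (by omega)]
    exact ⟨rfl, by omega⟩
  | adj i j ih1 ih2 =>
    obtain ⟨o1, o2, o3, o4⟩ := he
    obtain ⟨h1, h2⟩ := ih1 o1
    obtain ⟨h3, h4⟩ := ih2 o2
    simp only [X.comp, Exp.val, Op.apply, h1, h3, hr.n]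
    have := Nat.mul_le_mul_right m.n o3.le
    rw [Nat.mod_eq_of_lt (a := X.eval m s i * m.n) (by omega), Nat.mod_eq_of_lt (by omega),
      hr.adj _ _ o3 o4]
    refine ⟨rfl, ?_⟩
    simp only [X.eval]
    have := flag_le (m.H.Adj (eval m s i) (eval m s j))
    omega
  | lt e f ih1 ih2 =>
    obtain ⟨h1, h2⟩ := ih1 he.1
    obtain ⟨h3, h4⟩ := ih2 he.2
    simp only [X.comp, Exp.val, Op.apply, X.eval, h1, h3, ite_flag]
    have := flag_le (eval m s e < eval m s f)
    exact ⟨Nat.mod_eq_of_lt (by omega), by omega⟩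
  | eq e f ih1 ih2 =>
    obtain ⟨h1, h2⟩ := ih1 he.1
    obtain ⟨h3, h4⟩ := ih2 he.2
    simp only [X.comp, Exp.val, Op.apply, X.eval, h1, h3, ite_flag]
    have := flag_le (eval m s e = eval m s f)
    exact ⟨Nat.mod_eq_of_lt (by omega), by omega⟩
  | inc e ih =>
    obtain ⟨h1, h2⟩ := ih he.1
    have := he.2
    simp only [X.comp, Exp.val, Op.apply, X.eval, h1]
    rw [Nat.mod_eq_of_lt (a := 1) (by omega), Nat.mod_eq_of_lt (by omega)]
    exact ⟨rfl, by omega⟩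
  | dec e ih =>
    obtain ⟨h1, h2⟩ := ih he
    simp only [X.comp, Exp.val, Op.apply, X.eval, h1]
    rw [Nat.mod_eq_of_lt (a := 1) (by omega), Nat.mod_eq_of_lt (by omega)]
    exact ⟨rfl, by omega⟩

/-! ### A calculus of preconditions that also counts time -/

/-- From any machine state that represents `s`, the program halts in a state that represents
`s'`, within the time recorded by the clock. -/
def Runs (m : Mach) (P : Prog) (s s' : St) : Prop :=
  ∀ σ, Rep m σ s → ∃ τ t, Exec m.w P σ t τ ∧ Rep m τ s' ∧ s.T + t ≤ s'.T

/-- The program halts in a state that satisfies `Q`. -/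
def wp (m : Mach) (P : Prog) (s : St) (Q : St → Prop) : Prop := ∃ s', Runs m P s s' ∧ Q s'

/-- Assignment. -/
def asg (r : Vr) (e : X) : Prog := .assign (r.idx + 1) e.comp

/-- Store into an array. -/
def sto (a : Ar) (i e : X) : Prog :=
  .store (.op .add (.op .add (.op .mul (.reg 0) (.reg 0)) (.lit a.idx))
      (.op .mul (.lit 16) i.comp)) e.comp

/-- Branch. -/
def cond (e : X) (p q : Prog) : Prog := .ite e.comp p q

/-- Branch without alternative. -/
def when (e : X) (p : Prog) : Prog := .ite e.comp p .skip

/-- Loop. -/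
def while_ (e : X) (p : Prog) : Prog := .loop e.comp p

/-- Loop over all vertices. -/
def forUp (r : Vr) (p : Prog) : Prog :=
  .seq (asg r (.lit 0)) (while_ (.lt (.v r) .n) (.seq p (asg r (.inc (.v r)))))

/-- Sequential composition. -/
infixr:60 " ;; " => Prog.seq

variable {s s' s'' : St} {P P' : Prog} {Q Q' : St → Prop} {e i : X} {r : Vr} {a : Ar}

theorem Rep.tick {σ : State} {c : ℕ} (h : Rep m σ s) : Rep m σ (s.tick c) where
  n := h.n
  reg r := by rw [St.get_tick]; exact h.reg r
  lt r := by rw [St.get_tick]; exact h.lt r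
  arr a i hi := by rw [St.getA_tick]; exact h.arr a i hi
  alt a i hi := by rw [St.getA_tick]; exact h.alt a i hi
  adj := h.adj

theorem Rep.set {σ : State} {x : ℕ} (h : Rep m σ s) (hx : x < bnd m.n) :
    Rep m ⟨Function.update σ.reg (r.idx + 1) x, σ.mem⟩ (s.set r x) where
  n := by simpa using h.n
  reg l := by
    by_cases hl : r = l
    · subst hl
      simp [St.get_set_self]
    · have : l.idx ≠ r.idx := fun h => hl (Vr.idx_injective h.symm)
      rw [St.get_set_ne hl, ← h.reg l]
      simp [this]
  lt l := by
    by_cases hl : r = l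
    · subst hl
      rwa [St.get_set_self]
    · rw [St.get_set_ne hl]
      exact h.lt l
  arr a i hi := by rw [St.getA_set]; exact h.arr a i hi
  alt a i hi := by rw [St.getA_set]; exact h.alt a i hi
  adj := h.adj

/-- Arrays are interleaved modulo 16 above address `n * n`: different arrays use different residues,
and the adjacency matrix lies below all of them. -/
theorem Rep.setA {σ : State} {x j : ℕ} (h : Rep m σ s) (hx : x < bnd m.n) :
    Rep m ⟨σ.reg, Function.update σ.mem (m.n * m.n + a.idx + 16 * j) x⟩
      (s.setA a (Function.update (s.getA a) j x)) where
  n := h.n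
  reg l := by rw [St.get_setA]; exact h.reg l
  lt l := by rw [St.get_setA]; exact h.lt l
  arr l i hi := by
    by_cases hl : a = l
    · subst hl
      rw [St.getA_setA_self]
      by_cases hij : i = j
      · simp [hij]
      · simp only [Function.update_apply, hij, if_false]
        rw [if_neg (by omega)]
        exact h.arr a i hi
    · have : a.idx ≠ l.idx := fun h => hl (Ar.idx_injective h)
      have h1 := a.idx_lt
      have h2 := l.idx_lt
      rw [St.getA_setA_ne hl]
      simp only [Function.update_apply]
      rw [if_neg (by omega)]
      exact h.arr l i hi
  alt l i hi := by
    by_cases hl : a = l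
    · subst hl
      rw [St.getA_setA_self, Function.update_apply]
      split_ifs
      exacts [hx, h.alt a i hi]
    · rw [St.getA_setA_ne hl]
      exact h.alt l i hi
  adj i j hi hj := by
    simp only [Function.update_apply]
    rw [if_neg, h.adj i j hi hj]
    have : i * m.n + m.n ≤ m.n * m.n := by
      have := Nat.mul_le_mul_right m.n (Nat.succ_le_of_lt hi)
      rwa [Nat.succ_mul] at this
    omega

theorem wp_mono (h : wp m P s Q) (hQ : ∀ s', Q s' → Q' s') : wp m P s Q' := by
  obtain ⟨s', h1, h2⟩ := h
  exact ⟨s', h1, hQ s' h2⟩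

theorem wp_seq (h : wp m P s fun s' => wp m P' s' Q) : wp m (P ;; P') s Q := by
  obtain ⟨s1, h1, s2, h2, hQ⟩ := h
  refine ⟨s2, fun σ hσ => ?_, hQ⟩
  obtain ⟨τ, t, e1, r1, t1⟩ := h1 σ hσ
  obtain ⟨υ, t', e2, r2, t2⟩ := h2 τ r1
  exact ⟨υ, t + t', .seq e1 e2, r2, by omega⟩

theorem wp_skip (h : Q (s.tick 1)) : wp m .skip s Q :=
  ⟨_, fun σ hσ => ⟨σ, 1, .skip σ, hσ.tick, le_rfl⟩, h⟩

theorem wp_asg (he : e.ok m s) (h : Q ((s.set r (e.eval m s)).tick (e.cost + 1))) :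
    wp m (asg r e) s Q := by
  refine ⟨_, fun σ hσ => ?_, h⟩
  obtain ⟨h1, h2⟩ := X.comp_val hσ e he
  refine ⟨_, _, .assign σ _ _, ?_, ?_⟩
  · rw [h1]
    exact (hσ.set h2).tick
  · simp only [St.tick, St.T_set, X.comp_cost, le_refl]

theorem wp_sto (hi : i.ok m s) (he : e.ok m s)
    (h : Q ((s.setA a (Function.update (s.getA a) (i.eval m s) (e.eval m s))).tick
      (i.cost + e.cost + 9))) :
    wp m (sto a i e) s Q := by
  refine ⟨_, fun σ hσ => ?_, h⟩
  obtain ⟨h1, h2⟩ := X.comp_val hσ e he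
  obtain ⟨h3, h4⟩ := X.comp_val hσ (.get a i) hi
  obtain ⟨h5, h6⟩ := X.comp_val hσ i hi
  have hb := le_bnd m.n
  have hw := m.hw
  have ha := a.idx_lt
  refine ⟨_, _, .store σ _ _, ?_, ?_⟩
  · simp only [Exp.val, Op.apply, h5, hσ.n, h1]
    rw [Nat.mod_eq_of_lt (a := m.n * m.n) (by omega), Nat.mod_eq_of_lt (a := a.idx) (by omega),
      Nat.mod_eq_of_lt (a := m.n * m.n + a.idx) (by omega), Nat.mod_eq_of_lt (a := 16) (by omega),
      Nat.mod_eq_of_lt (a := 16 * X.eval m s i) (by omega), Nat.mod_eq_of_lt (by omega)]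
    exact (hσ.setA h2).tick
  · simp only [St.tick, St.T_setA, X.comp_cost, Exp.cost]
    omega

theorem wp_cond (he : e.ok m s) (h1 : e.eval m s ≠ 0 → wp m P (s.tick (e.cost + 1)) Q)
    (h0 : e.eval m s = 0 → wp m P' (s.tick (e.cost + 1)) Q) : wp m (cond e P P') s Q := by
  by_cases h : e.eval m s = 0
  · obtain ⟨s', hr, hQ⟩ := h0 h
    refine ⟨s', fun σ hσ => ?_, hQ⟩
    obtain ⟨τ, t, h2, h3, h4⟩ := hr σ hσ.tick
    refine ⟨τ, _, .ite_false ?_ h2, h3, ?_⟩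
    · rw [(X.comp_val hσ e he).1, h]
    · rw [X.comp_cost]; simp only [St.tick] at h4; omega
  · obtain ⟨s', hr, hQ⟩ := h1 h
    refine ⟨s', fun σ hσ => ?_, hQ⟩
    obtain ⟨τ, t, h2, h3, h4⟩ := hr σ hσ.tick
    refine ⟨τ, _, .ite_true ?_ h2, h3, ?_⟩
    · rwa [(X.comp_val hσ e he).1]
    · rw [X.comp_cost]; simp only [St.tick] at h4; omega

theorem wp_when (he : e.ok m s) (h1 : e.eval m s ≠ 0 → wp m P (s.tick (e.cost + 1)) Q)
    (h0 : e.eval m s = 0 → Q ((s.tick (e.cost + 1)).tick 1)) : wp m (when e P) s Q :=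
  wp_cond he h1 fun h => wp_skip (h0 h)

theorem wp_loop_false (he : e.ok m s) (h : e.eval m s = 0) (hQ : Q (s.tick (e.cost + 1))) :
    wp m (while_ e P) s Q := by
  refine ⟨_, fun σ hσ => ⟨σ, _, .loop_false ?_, hσ.tick, ?_⟩, hQ⟩
  · rw [(X.comp_val hσ e he).1, h]
  · rw [X.comp_cost]; simp only [St.tick]; omega

theorem wp_loop_true (he : e.ok m s) (h : e.eval m s ≠ 0)
    (hQ : wp m P (s.tick (e.cost + 1)) fun s' => wp m (while_ e P) s' Q) :
    wp m (while_ e P) s Q := by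
  obtain ⟨s1, h1, s2, h2, hQ⟩ := hQ
  refine ⟨s2, fun σ hσ => ?_, hQ⟩
  obtain ⟨τ, t, e1, r1, t1⟩ := h1 σ hσ.tick
  obtain ⟨υ, t', e2, r2, t2⟩ := h2 τ r1
  refine ⟨υ, _, .loop_true ?_ e1 e2, r2, ?_⟩
  · rwa [(X.comp_val hσ e he).1]
  · rw [X.comp_cost]; simp only [St.tick] at t1; omega

theorem wp_while (I : St → Prop) (μ : St → ℕ) (hI : I s) (hok : ∀ s, I s → e.ok m s)
    (hstep : ∀ s, I s → e.eval m s ≠ 0 →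
      wp m P (s.tick (e.cost + 1)) fun s' => I s' ∧ μ s' < μ s)
    (hend : ∀ s, I s → e.eval m s = 0 → Q (s.tick (e.cost + 1))) :
    wp m (while_ e P) s Q := by
  induction hk : μ s using Nat.strong_induction_on generalizing s with
  | _ k ih =>
    by_cases h : e.eval m s = 0
    · exact wp_loop_false (hok s hI) h (hend s hI h)
    · exact wp_loop_true (hok s hI) h
        (wp_mono (hstep s hI h) fun s' h' => ih _ (hk ▸ h'.2) h'.1 rfl)

/-- The ticks are the costs of setting the counter (2), of testing it (4) and of increasing it (4).
-/
theorem wp_for (I : ℕ → St → Prop) (h0 : I 0 ((s.set r 0).tick 2))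
    (hstep : ∀ i < m.n, ∀ s, s.get r = i → I i s →
      wp m P (s.tick 4) fun s' => s'.get r = i ∧ I (i + 1) ((s'.set r (i + 1)).tick 4))
    (hend : ∀ s, s.get r = m.n → I m.n s → Q (s.tick 4)) : wp m (forUp r P) s Q := by
  refine wp_seq (wp_asg (by simp [X.ok]) ?_)
  refine wp_while (fun s => s.get r ≤ m.n ∧ I (s.get r) s) (fun s => m.n - s.get r) ?_
    (fun s _ => ⟨trivial, trivial⟩) ?_ ?_
  · have : ((s.set r 0).tick 2).get r = 0 := by rw [St.get_tick, St.get_set_self]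
    simp only [X.eval, X.cost]
    rw [this]
    exact ⟨Nat.zero_le _, h0⟩
  · intro s hs h
    simp only [X.eval, flag_ne_zero] at h
    refine wp_seq (wp_mono (hstep _ h s rfl hs.2) fun s' hs' => wp_asg ?_ ?_)
    · simp only [X.ok, X.eval, hs'.1]
      exact ⟨trivial, by omega⟩
    · simp only [X.eval, hs'.1, X.cost]
      rw [St.get_tick, St.get_set_self]
      exact ⟨⟨h, hs'.2⟩, by omega⟩
  · intro s hs h
    simp only [X.eval, flag_eq_zero, not_lt] at h
    have : s.get r = m.n := le_antisymm hs.1 h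
    exact hend s this (this ▸ hs.2)

attribute [simp] X.eval X.ok X.cost St.get St.set St.getA St.setA St.tick flag_ne_zero flag_eq_zero

end GeoRAM

/-! ### Gluing two rows in linear time -/

namespace GeoRAM

open WordRAM Matching

/-- Compute the row of the partner `z` of the base `be` from the rows of `c` and `q`. -/
def glueP : Prog :=
  asg .z (.get .M (.v .be)) ;;
  forUp .u (
    asg .g (.get .NM (.ix (.v .c) (.v .u))) ;;
    when (.get .E (.v .u)) (when (.eq (.get .b (.v .u)) (.v .be))
      (asg .g (.get .NM (.ix (.v .q) (.v .u))))) ;;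
    sto .NM (.ix (.v .z) (.v .u)) (.v .g)) ;;
  sto .NM (.ix (.v .z) (.v .z)) (.v .z) ;;
  sto .NM (.ix (.v .z) (.v .q)) (.v .c) ;;
  sto .NM (.ix (.v .z) (.v .c)) (.v .q)

theorem ix_inj {n a a' v v' : ℕ} (hv : v < n) (hv' : v' < n) (h : a * n + v = a' * n + v') :
    a = a' ∧ v = v' := by
  have h1 : (a * n + v) / n = a := by
    rw [Nat.mul_comm, Nat.mul_add_div (by omega), Nat.div_eq_of_lt hv, add_zero]
  have h2 : (a' * n + v') / n = a' := by
    rw [Nat.mul_comm, Nat.mul_add_div (by omega), Nat.div_eq_of_lt hv', add_zero]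
  have : a = a' := by rw [← h1, h, h2]
  subst this
  exact ⟨rfl, by omega⟩

/-- As `z` differs from `c` and `q`, writing row `z` does not disturb the two rows being read. -/
theorem glueP_spec {m : Mach} {s : St} (hc : s.c < m.n) (hq : s.q < m.n)
    (hz : s.M s.be < m.n) (hzc : s.M s.be ≠ s.c) (hzq : s.M s.be ≠ s.q) :
    wp m glueP s fun s' => ∃ T' u' g' NM',
      s' = { s with T := T', z := s.M s.be, u := u', g := g', NM := NM' } ∧
      T' ≤ s.T + 100 * m.n + 100 ∧
      (∀ a, a ≠ s.M s.be → ∀ v < m.n, NM' (a * m.n + v) = s.NM (a * m.n + v)) ∧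
      (∀ v < m.n, NM' (s.M s.be * m.n + v) =
        glue (fun v => s.E v ≠ 0 ∧ s.b v = s.be) (fun v => s.NM (s.c * m.n + v))
          (fun v => s.NM (s.q * m.n + v)) s.c s.q (s.M s.be) v) := by
  set zz := s.M s.be with hzz
  refine wp_seq (wp_asg trivial ?_)
  simp only [X.eval, St.get, St.set, St.tick, St.getA, X.cost]
  refine wp_seq (wp_for (fun i s' => ∃ T' g' NM',
      s' = { s with T := T', z := zz, u := i, g := g', NM := NM' } ∧
      T' ≤ s.T + 100 * i + 20 ∧
      (∀ a, a ≠ zz → ∀ v < m.n, NM' (a * m.n + v) = s.NM (a * m.n + v)) ∧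
      (∀ v < i, NM' (zz * m.n + v) = if s.E v ≠ 0 ∧ s.b v = s.be then s.NM (s.q * m.n + v)
          else s.NM (s.c * m.n + v))) ?_ ?_ ?_)
  · refine ⟨_, _, _, rfl, by dsimp; omega, ?_, ?_⟩
    · intros; rfl
    · intros; omega
  · rintro i hi _ - ⟨T1, g1, NM1, rfl, hT, h1, h2⟩
    refine wp_seq (wp_asg (by simp; omega) ?_)
    dsimp
    refine wp_seq (wp_mono (Q := fun s' => ∃ T',
      s' = { s with T := T', z := zz, u := i, NM := NM1, g := if s.E i ≠ 0 ∧ s.b i = s.be then NM1 (s.q * m.n + i) else NM1 (s.c * m.n + i) } ∧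
      T' ≤ T1 + 60) ?_ ?_)
    · refine wp_when (by simp) (fun hE => wp_when (by simp) (fun hb => wp_asg (by simp; omega) ?_)
        fun hb => ?_) fun hE => ?_
      all_goals dsimp at *
      · simp only [flag_ne_zero] at hb
        exact ⟨_, by rw [if_pos ⟨hE, hb⟩], by omega⟩
      · simp only [flag_eq_zero] at hb
        exact ⟨_, by rw [if_neg (fun h => hb h.2)], by omega⟩
      · exact ⟨_, by rw [if_neg (fun h => h.1 hE)], by omega⟩
    · rintro _ ⟨T2, rfl, hT2⟩
      refine wp_sto (by simp; omega) (by simp) ?_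
      dsimp
      refine ⟨rfl, _, _, _, rfl, by omega, fun a ha v hv => ?_, fun v hv => ?_⟩
      · rw [Function.update_of_ne, h1 a ha v hv]
        exact fun h => ha (ix_inj hv hi h).1
      · by_cases hvi : v = i
        · subst hvi
          rw [Function.update_self, h1 _ hzq.symm v hi, h1 _ hzc.symm v hi]
        · rw [Function.update_of_ne, h2 v (by omega)]
          exact fun h => hvi (ix_inj (by omega) hi h).2
  · rintro _ - ⟨T1, g1, NM1, rfl, hT, h1, h2⟩
    -- The last store wins, so writing at `z`, then `q`, then `c` gives the order of precedence in
    -- `glue`.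
    refine wp_seq (wp_sto (by simp; omega) (by simp) ?_)
    refine wp_seq (wp_sto (by simp; omega) (by simp) ?_)
    refine wp_sto (by simp; omega) (by simp) ?_
    dsimp
    refine ⟨_, _, _, _, rfl, by omega, fun a ha v hv => ?_, fun v hv => ?_⟩
    · rw [Function.update_of_ne, Function.update_of_ne, Function.update_of_ne, h1 a ha v hv]
      all_goals exact fun h => ha (ix_inj hv ‹_› h).1
    · simp only [Function.update_apply]
      have key : ∀ a < m.n, zz * m.n + v = zz * m.n + a ↔ v = a := fun a ha =>
        ⟨fun h => (ix_inj hv ha h).2, fun h => by rw [h]⟩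
      rw [h2 v hv]
      simp only [key _ hc, key _ hq, key _ hz]
      unfold glue
      split_ifs <;> simp_all

end GeoRAM

/-! ### The contraction as a program -/

namespace GeoRAM

open WordRAM Matching Finset

/-- The cells `v < n` of `f` are non-zero exactly at the elements of `S`. -/
def Flags (n : ℕ) (f : ℕ → ℕ) (S : Finset ℕ) : Prop := ∀ v < n, f v ≠ 0 ↔ v ∈ S

/-- The matrix stored in an array. -/
def rows (n : ℕ) (f : ℕ → ℕ) (x v : ℕ) : ℕ := f (x * n + v)

/-- The state of the search stored in the arrays. -/
structure SI (m : Mach) (A E P : Finset ℕ) (s : St) : Prop where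
  fA : Flags m.n s.A A
  fE : Flags m.n s.E E
  dn : Flags m.n s.dn P
  lt : ∀ v ∈ A, v < m.n
  inv : SInv m.H A s.M E s.b s.p s.t (rows m.n s.NM)
  PE : P ⊆ E
  tm : ∀ v ∈ E, s.b v = v → s.t v < s.tm
  tm_le : s.tm ≤ m.n + #E

/-- Step up on the side of `q1`, or on the other one if that stands higher in time. -/
def liftP : Prog :=
  when (.lt (.get .t (.get .b (.v .q1))) (.get .t (.get .b (.v .q2)))) (
    asg .g (.v .c1) ;; asg .c1 (.v .c2) ;; asg .c2 (.v .g) ;;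
    asg .g (.v .q1) ;; asg .q1 (.v .q2) ;; asg .q2 (.v .g)) ;;
  asg .be (.get .b (.v .q1)) ;; asg .c (.v .c1) ;; asg .q (.v .q1) ;;
  glueP ;;
  sto .mr (.v .be) (.lit 1) ;; sto .mr (.v .z) (.lit 1) ;;
  asg .c1 (.v .z) ;; asg .q1 (.get .p (.v .be))

/-- Contract the blossom closed by the edge `x y`. -/
def contractP : Prog :=
  forUp .v (sto .mr (.v .v) (.lit 0)) ;;
  asg .c1 (.v .y) ;; asg .q1 (.v .x) ;; asg .c2 (.v .x) ;; asg .q2 (.v .y) ;;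
  while_ (.eq (.eq (.get .b (.v .q1)) (.get .b (.v .q2))) (.lit 0)) liftP ;;
  asg .be (.get .b (.v .q1)) ;;
  forUp .v (
    cond (.get .E (.v .v)) (asg .h (.get .mr (.get .b (.v .v)))) (asg .h (.get .mr (.v .v))) ;;
    when (.v .h) (sto .E (.v .v) (.lit 1) ;; sto .b (.v .v) (.v .be)))

/-- Progress of the contraction stored in the arrays. -/
structure CI (m : Mach) (A E L : Finset ℕ) (s : St) : Prop where
  inv : LInv m.H A s.M E s.b s.p s.t (rows m.n s.NM) s.x s.y L (rows m.n s.NM) s.c1 s.q1 s.c2 s.q2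
  sinv : SInv m.H A s.M E s.b s.p s.t (rows m.n s.NM)
  E : Flags m.n s.E E
  mr : Flags m.n s.mr (L ∪ L.image s.M)

theorem CI.swap {m : Mach} {A E L : Finset ℕ} {s : St} (h : CI m A E L s) (T' g' : ℕ) :
    CI m A E L { s with T := T', g := g', c1 := s.c2, q1 := s.q2, c2 := s.c1, q2 := s.q1 } where
  inv := h.inv.swap
  sinv := h.sinv
  E := h.E
  mr := h.mr

/-- The search invariant does not depend on rows other than those of outer vertices. -/
theorem SInv_congr_rows {H : SimpleGraph ℕ} {A E : Finset ℕ} {M b p t : ℕ → ℕ} {N N' : ℕ → ℕ → ℕ}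
    (S : SInv H A M E b p t N) (h : ∀ u ∈ E, ∀ v ∈ A, N' u v = N u v) :
    SInv H A M E b p t N' :=
  { S with
    mat := fun x hx => Row.congr (S.sub hx) (S.mat x hx) (h x hx)
    same := fun x hx v hv hc => by
      rw [h x hx v hv, h _ (S.bE x hx) v hv]; exact S.same x hx v hv hc
    brt := fun β hβ hb hM v hv => by rw [h β hβ v hv]; exact S.brt β hβ hb hM v hv
    bnr := fun β hβ hb hM => by
      obtain ⟨r1, r2⟩ := S.bnr β hβ hb hM
      refine ⟨by rw [h β hβ _ (S.isMat β (S.sub hβ)).1, r1], fun v hv a b c => ?_⟩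
      rw [h β hβ v hv, h _ (S.pE β hβ hb hM).1 v hv]
      exact r2 v hv a b c }

/-- The program overwrites rows in place, so one matrix plays the part of the old rows and of the
new ones; rows of vertices that are not outer are irrelevant for the old ones. -/
theorem LInv_congr_rows {H : SimpleGraph ℕ} {A E L : Finset ℕ} {M b p t : ℕ → ℕ}
    {N N' N'' : ℕ → ℕ → ℕ} {x y c₁ q₁ c₂ q₂ : ℕ}
    (I : LInv H A M E b p t N x y L N'' c₁ q₁ c₂ q₂) (h : ∀ u ∈ E, ∀ v ∈ A, N' u v = N u v) :
    LInv H A M E b p t N' x y L N'' c₁ q₁ c₂ q₂ :=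
  have key : ∀ {Nz z}, Follows A M E b N L x y Nz z → Follows A M E b N' L x y Nz z := by
    rintro Nz z ⟨e, he, h1, h2⟩
    refine ⟨e, he, h1, fun v hv hT hc => ?_⟩
    rw [h2 v hv hT hc, h e _ v hv]
    rcases he with rfl | rfl
    exacts [I.x0, I.y0]
  { I with
    row := fun u hu v hv => by rw [I.row u hu v hv, h u hu v hv]
    new := fun β hβ => ⟨(I.new β hβ).1, key (I.new β hβ).2⟩
    o1 := key I.o1
    o2 := key I.o2 }

theorem liftP_spec {m : Mach} {A E L : Finset ℕ} {s : St} (hlt : ∀ v ∈ A, v < m.n)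
    (hopt : Opt m.H A s.M) (h : CI m A E L s) (hne : s.b s.q1 ≠ s.b s.q2) :
    wp m liftP s fun s' => ∃ T' u' g' NM' c' q' z' be' mr' c1' q1' c2' q2',
      s' = { s with T := T', u := u', g := g', NM := NM', c := c', q := q', z := z', be := be', mr := mr', c1 := c1', q1 := q1', c2 := c2', q2 := q2' } ∧
      T' ≤ s.T + 100 * m.n + 300 ∧
      (∃ L', #L' = #L + 1 ∧ CI m A E L' s') ∧
      s.t (s.b q1') + s.t (s.b q2') < s.t (s.b s.q1) + s.t (s.b s.q2) := by
  refine wp_seq (wp_mono (Q := fun s' => ∃ T' g' c1' q1' c2' q2',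
      s' = { s with T := T', g := g', c1 := c1', q1 := q1', c2 := c2', q2 := q2' } ∧
      T' ≤ s.T + 60 ∧ CI m A E L s' ∧ s.b q1' ≠ s.b q2' ∧
      s.t (s.b q2') ≤ s.t (s.b q1') ∧
      s.t (s.b q1') + s.t (s.b q2') = s.t (s.b s.q1) + s.t (s.b s.q2)) ?_ ?_)
  · refine wp_when (by simp) (fun hl => ?_) (fun hl => ?_)
    · refine wp_seq (wp_asg (by simp) ?_)
      refine wp_seq (wp_asg (by simp) ?_)
      refine wp_seq (wp_asg (by simp) ?_)
      refine wp_seq (wp_asg (by simp) ?_)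
      refine wp_seq (wp_asg (by simp) ?_)
      refine wp_asg (by simp) ?_
      simp at hl
      dsimp
      exact ⟨_, _, _, _, _, _, rfl, by omega, h.swap _ _, hne.symm, hl.le, by omega⟩
    · simp at hl
      dsimp
      exact ⟨_, _, _, _, _, _, rfl, by omega, ⟨h.inv, h.sinv, h.E, h.mr⟩, hne, hl, rfl⟩
  · rintro _ ⟨T1, g1, c1, q1, c2, q2, rfl, hT, h, hne, hle, hsum⟩
    have hI := h.inv
    have hS := h.sinv
    dsimp at hI hS
    obtain ⟨l1, l2, l3, l4, l5, l6⟩ := hI.lift hS hopt hne hle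
    have hq := hS.sub hI.q1
    have hβE := hS.bE _ hI.q1
    have hβ := hS.sub hβE
    have hzA := (hS.isMat _ hβ).1
    have hc := hI.c1A hS
    have hp := hS.pE _ hβE (hS.bb _ hI.q1) l1
    refine wp_seq (wp_asg (by simp) ?_)
    refine wp_seq (wp_asg (by simp) ?_)
    refine wp_seq (wp_asg (by simp) ?_)
    dsimp
    refine wp_seq (wp_mono (glueP_spec (hlt _ hc) (hlt _ hq) (hlt _ hzA) l4.symm
      (fun h => l2 (h ▸ hI.q1))) ?_)
    rintro _ ⟨T2, u2, g2, NM2, rfl, hT2, r1, r2⟩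
    refine wp_seq (wp_sto (by simp) (by simp) ?_)
    refine wp_seq (wp_sto (by simp) (by simp) ?_)
    refine wp_seq (wp_asg (by simp) ?_)
    refine wp_asg (by simp) ?_
    dsimp at *
    have hrow : ∀ u ∈ E, ∀ v ∈ A, rows m.n NM2 u v = rows m.n s.NM u v :=
      fun u hu v hv => r1 u (fun h => l2 (h ▸ hu)) v (hlt v hv)
    refine ⟨_, _, _, _, _, _, _, _, _, _, _, _, _, rfl, by omega,
      ⟨insert (s.b q1) L, card_insert_of_notMem l3, ?_⟩, ?_⟩
    · refine ⟨?_, SInv_congr_rows hS hrow, h.E, ?_⟩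
      · refine LInv_congr_rows (l6 (rows m.n NM2)
          (fun u hu hne v hv => r1 u hne v (hlt v hv)) fun v hv => ?_) hrow
        refine (r2 v (hlt v hv)).trans ?_
        have hE : (s.E v ≠ 0 ∧ s.b v = s.b q1) ↔ (v ∈ E ∧ s.b v = s.b q1) :=
          and_congr_left fun _ => h.E v (hlt v hv)
        simp only [glue, hE]
        rfl
      · intro v hv
        have := h.mr v hv
        dsimp at this ⊢
        simp only [Function.update_apply, image_insert]
        simp only [mem_union, mem_insert] at this ⊢
        split_ifs with h1 h2
        · simp [h1]
        · simp [h2]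
        · rw [this]
          tauto
    · omega

/-- Shows that the marks on passed bases and their partners decide membership in the new blossom: an
outer vertex looks up the mark of its base, any other vertex its own mark. -/
theorem Touched_iff {H : SimpleGraph ℕ} {A E L : Finset ℕ} {M b p t : ℕ → ℕ}
    {N N' : ℕ → ℕ → ℕ} {x y c₁ q₁ c₂ q₂ : ℕ} (S : SInv H A M E b p t N)
    (I : LInv H A M E b p t N x y L N' c₁ q₁ c₂ q₂) (v : ℕ) :
    (v ∈ E → (Touched M E b L v ↔ b v ∈ L ∪ L.image M)) ∧
    (v ∉ E → (Touched M E b L v ↔ v ∈ L ∪ L.image M)) := by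
  have h1 : ∀ β ∈ L, M β ∉ E := fun β hβ =>
    S.out β (I.low β hβ).1 (I.low β hβ).2.1 (I.low β hβ).2.2.1
  simp only [Touched, mem_union, mem_image]
  constructor
  · intro hv
    constructor
    · rintro (h | ⟨β, hβ, rfl⟩)
      exacts [Or.inl h.2, absurd hv (h1 β hβ)]
    · rintro (h | ⟨β, hβ, h⟩)
      · exact Or.inl ⟨hv, h⟩
      · exact absurd (S.bE v hv) (h ▸ h1 β hβ)
  · intro hv
    constructor
    · rintro (h | ⟨β, hβ, h⟩)
      exacts [absurd h.1 hv, Or.inr ⟨β, hβ, h.symm⟩]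
    · rintro (h | ⟨β, hβ, h⟩)
      exacts [absurd (I.low v h).1 hv, Or.inr ⟨β, hβ, h.symm⟩]

open Classical in
/-- The relabelling after a contraction. -/
theorem relabel_spec {m : Mach} {A E L : Finset ℕ} {s : St} (hlt : ∀ v ∈ A, v < m.n)
    (h : CI m A E L s) :
    wp m (forUp .v (
    cond (.get .E (.v .v)) (asg .h (.get .mr (.get .b (.v .v)))) (asg .h (.get .mr (.v .v))) ;;
    when (.v .h) (sto .E (.v .v) (.lit 1) ;; sto .b (.v .v) (.v .be)))) s fun s' =>
      ∃ T' v' h' E' b', s' = { s with T := T', v := v', h := h', E := E', b := b' } ∧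
      T' ≤ s.T + 100 * m.n + 100 ∧
      ∀ v < m.n, (E' v ≠ 0 ↔ v ∈ E ∨ Touched s.M E s.b L v) ∧
        b' v = if Touched s.M E s.b L v then s.be else s.b v := by
  refine wp_for (fun i s' => ∃ T' h' E' b',
      s' = { s with T := T', v := i, h := h', E := E', b := b' } ∧ T' ≤ s.T + 100 * i + 50 ∧
      (∀ v < i, (E' v ≠ 0 ↔ v ∈ E ∨ Touched s.M E s.b L v) ∧
        b' v = if Touched s.M E s.b L v then s.be else s.b v) ∧
      ∀ v, i ≤ v → E' v = s.E v ∧ b' v = s.b v) ?_ ?_ ?_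
  · exact ⟨_, _, _, _, rfl, by dsimp; omega, by intros; omega, fun v _ => ⟨rfl, rfl⟩⟩
  · rintro i hi _ - ⟨T1, h1, E1, b1, rfl, hT, k1, k2⟩
    obtain ⟨e1, e2⟩ := k2 i le_rfl
    have hEi := h.E i hi
    obtain ⟨t1, t2⟩ := Touched_iff h.sinv h.inv i
    refine wp_seq (wp_mono (Q := fun s' => ∃ T' h',
      s' = { s with T := T', v := i, h := h', E := E1, b := b1 } ∧ T' ≤ T1 + 45 ∧
      (h' ≠ 0 ↔ Touched s.M E s.b L i)) ?_ ?_)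
    · refine wp_cond (by simp) (fun hc => wp_asg (by simp) ?_) (fun hc => wp_asg (by simp) ?_)
      all_goals dsimp at *
      · rw [e1, hEi] at hc
        refine ⟨_, _, rfl, by omega, ?_⟩
        rw [e2, t1 hc]
        exact h.mr _ (hlt _ (h.sinv.sub (h.sinv.bE i hc)))
      · rw [e1] at hc
        have hc' : i ∉ E := fun h' => (hEi.2 h') hc
        refine ⟨_, _, rfl, by omega, ?_⟩
        rw [t2 hc']
        exact h.mr _ hi
    · rintro _ ⟨T2, h2, rfl, hT2, hh⟩
      refine wp_when (by simp) (fun hc => ?_) (fun hc => ?_)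
      · dsimp at hc
        refine wp_seq (wp_sto (by simp) (by simp) ?_)
        refine wp_sto (by simp) (by simp) ?_
        dsimp
        have hT := hh.1 hc
        refine ⟨rfl, _, _, _, _, rfl, by omega, fun v hv => ?_, fun v hv => ?_⟩
        · by_cases hvi : v = i
          · subst hvi
            simp [hT]
          · simp only [Function.update_of_ne hvi]
            exact k1 v (by omega)
        · have hvi : v ≠ i := by omega
          simp only [Function.update_of_ne hvi]
          exact k2 v (by omega)
      · dsimp at hc ⊢
        have hT : ¬ Touched s.M E s.b L i := fun h' => (hh.2 h') hc
        refine ⟨rfl, _, _, _, _, rfl, by omega, fun v hv => ?_, fun v hv => k2 v (by omega)⟩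
        by_cases hvi : v = i
        · subst hvi
          simp only [hT, e1, e2, or_false, if_false, and_true]
          exact hEi
        · exact k1 v (by omega)
  · rintro _ - ⟨T1, h1, E1, b1, rfl, hT, k1, k2⟩
    exact ⟨_, _, _, _, _, rfl, by dsimp; omega, k1⟩

theorem clear_spec {m : Mach} {s : St} (a : Ar) :
    wp m (forUp .v (sto a (.v .v) (.lit 0))) s fun s' =>
      ∃ T' v' f, s' = ({ s with T := T', v := v' } : St).setA a f ∧ T' ≤ s.T + 20 * m.n + 10 ∧
      ∀ v < m.n, f v = 0 := by
  refine wp_for (fun i s' => ∃ T' f, s' = ({ s with T := T', v := i } : St).setA a f ∧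
      T' ≤ s.T + 20 * i + 5 ∧ ∀ v < i, f v = 0) ?_ ?_ ?_
  · exact ⟨_, s.getA a, by cases a <;> rfl, by dsimp; omega, by intros; omega⟩
  · rintro i hi _ - ⟨T1, f, rfl, hT, hf⟩
    refine wp_sto (by simp) (by simp) ?_
    refine ⟨by cases a <;> rfl, T1 + 19, Function.update f i 0, ?_, by omega, fun v hv => ?_⟩
    · cases a <;> rfl
    · by_cases hvi : v = i
      · simp [hvi]
      · rw [Function.update_of_ne hvi]
        exact hf v (by omega)
  · rintro _ - ⟨T1, f, rfl, hT, hf⟩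
    exact ⟨T1 + 4, m.n, f, by cases a <;> rfl, by omega, hf⟩

/-- The sum of the times of the two current bases decreases with each step up, and each step adds
one element to `L`, by which the running time is measured. -/
theorem liftLoop_spec {m : Mach} {A E : Finset ℕ} {s : St} (hlt : ∀ v ∈ A, v < m.n)
    (hopt : Opt m.H A s.M) (h : CI m A E ∅ s) :
    wp m (while_ (.eq (.eq (.get .b (.v .q1)) (.get .b (.v .q2))) (.lit 0)) liftP) s fun s' =>
      ∃ T' u' g' NM' c' q' z' be' mr' c1' q1' c2' q2',
      s' = { s with T := T', u := u', g := g', NM := NM', c := c', q := q', z := z', be := be', mr := mr', c1 := c1', q1 := q1', c2 := c2', q2 := q2' } ∧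
      (∃ L, CI m A E L s' ∧ T' ≤ s.T + 50 + (100 * m.n + 400) * #L) ∧ s.b q1' = s.b q2' := by
  refine wp_while (fun s' => ∃ T' u' g' NM' c' q' z' be' mr' c1' q1' c2' q2',
      s' = { s with T := T', u := u', g := g', NM := NM', c := c', q := q', z := z', be := be', mr := mr', c1 := c1', q1 := q1', c2 := c2', q2 := q2' } ∧
      ∃ L, CI m A E L s' ∧ T' ≤ s.T + (100 * m.n + 400) * #L)
    (fun s => s.t (s.b s.q1) + s.t (s.b s.q2)) ?_ ?_ ?_ ?_
  · exact ⟨_, _, _, _, _, _, _, _, _, _, _, _, _, rfl, ∅, h, by omega⟩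
  · intro s _
    simp
  · rintro _ ⟨T2, u2, g2, NM2, c2, q2, z2, be2, mr2, c12, q12, c22, q22, rfl, L, hC, hT2⟩ hb
    simp at hb
    dsimp
    refine wp_mono (liftP_spec (L := L) hlt hopt ⟨hC.inv, hC.sinv, hC.E, hC.mr⟩ hb) ?_
    rintro _ ⟨T3, u3, g3, NM3, c3, q3, z3, be3, mr3, c13, q13, c23, q23, rfl, hT3, ⟨L', hL', hC'⟩,
      ht⟩
    dsimp at hT2 hT3 ht
    refine ⟨⟨T3, u3, g3, NM3, c3, q3, z3, be3, mr3, c13, q13, c23, q23, rfl, L', hC', ?_⟩, ht⟩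
    rw [hL', Nat.mul_succ]
    linarith
  · rintro _ ⟨T2, u2, g2, NM2, c2, q2, z2, be2, mr2, c12, q12, c22, q22, rfl, L, hC, hT2⟩ hb
    simp at hb
    exact ⟨_, _, _, _, _, _, _, _, _, _, _, _, _, rfl,
      ⟨L, ⟨hC.inv, hC.sinv, hC.E, hC.mr⟩, by dsimp; omega⟩, hb⟩

-- Since the ends of the edge lie in different blossoms, at least one step up was made. Thus `0 <
-- #L`, and the fixed linear cost of a contraction can also be charged to a new outer vertex.
open Classical in
theorem contract_post {m : Mach} {A E L P : Finset ℕ} {s s' : St} (h : SI m A E P s)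
    (hS : SInv m.H A s.M E s.b s.p s.t (rows m.n s'.NM))
    (hI : LInv m.H A s.M E s.b s.p s.t (rows m.n s'.NM) s.x s.y L (rows m.n s'.NM)
      s'.c1 s'.q1 s'.c2 s'.q2) (hb : s.b s'.q1 = s.b s'.q2) (hne : s.b s.x ≠ s.b s.y)
    (hEb : ∀ v < m.n, (s'.E v ≠ 0 ↔ v ∈ E ∨ Touched s.M E s.b L v) ∧
      s'.b v = if Touched s.M E s.b L v then s.b s'.q1 else s.b v)
    (eA : s'.A = s.A) (eM : s'.M = s.M) (ed : s'.dn = s.dn) (ep : s'.p = s.p) (et : s'.t = s.t)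
    (etm : s'.tm = s.tm) :
    SI m A (E ∪ L.image s.M) P s' ∧ 0 < #L ∧ #(E ∪ L.image s.M) = #E + #L ∧
      (∀ u ∈ E, ∀ v ∈ E, s.b u = s.b v → s'.b u = s'.b v) ∧ s'.b s.y = s'.b s.x := by
  have hTA : ∀ v, Touched s.M E s.b L v → v ∈ A := by
    rintro v (hv | ⟨β, hβ, rfl⟩)
    exacts [hS.sub hv.1, (hS.isMat β (hS.sub (hI.low β hβ).1)).1]
  have hb1 : ∀ v, Touched s.M E s.b L v → s'.b v = s.b s'.q1 := fun v hv => by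
    rw [(hEb v (h.lt v (hTA v hv))).2, if_pos hv]
  have hzE : ∀ β ∈ L, s.M β ∉ E := fun β hβ =>
    hS.out β (hI.low β hβ).1 (hI.low β hβ).2.1 (hI.low β hβ).2.2.1
  have hb2 : ∀ v ∈ E, s.b v ∉ L → s'.b v = s.b v := fun v hv hvL => by
    rw [(hEb v (h.lt v (hS.sub hv))).2, if_neg]
    rintro (h' | ⟨β, hβ, rfl⟩)
    exacts [hvL h'.2, hzE β hβ hv]
  have hmerge := hI.merge hS hb hb1 hb2
  have hcard := hI.card_union hS
  have hbE : ∀ u ∈ E, (s.b u ∈ L ∧ s'.b u = s.b s'.q1) ∨ (s.b u ∉ L ∧ s'.b u = s.b u) := by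
    intro u hu
    by_cases hc : s.b u ∈ L
    exacts [Or.inl ⟨hc, hb1 u (Or.inl ⟨hu, hc⟩)⟩, Or.inr ⟨hc, hb2 u hu hc⟩]
  have hends : ∀ u ∈ E, (s.b u ∈ L ∨ s.b u = s.b s'.q1 ∨ s.b u = s.b s'.q2) →
      s'.b u = s.b s'.q1 := by
    intro u hu hc
    rcases hbE u hu with ⟨h1, h2⟩ | ⟨h1, h2⟩
    · exact h2
    · rcases hc with hc | hc | hc
      exacts [absurd hc h1, h2.trans hc, h2.trans (hc.trans hb.symm)]
  have hL : 0 < #L := by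
    rw [card_pos, nonempty_iff_ne_empty]
    rintro rfl
    have h1 := hI.bx
    have h2 := hI.bY
    simp only [notMem_empty, false_or] at h1 h2
    rw [hb, or_self] at h1 h2
    exact hne (h1.trans h2.symm)
  refine ⟨⟨by rw [eA]; exact h.fA, fun v hv => ?_, by rw [ed]; exact h.dn, h.lt,
    by rw [eM, ep, et]; exact hmerge, h.PE.trans subset_union_left, fun v hv hbv => ?_, ?_⟩, hL,
    hcard, fun u hu v hv huv => ?_, ?_⟩
  · rw [(hEb v hv).1, mem_union, mem_image]
    simp only [Touched, eq_comm (a := v)]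
    tauto
  · rw [et, etm]
    have h0 : v ∈ E ∧ s.b v = v := by
      rcases mem_union.1 hv with hv | hv
      · refine ⟨hv, ?_⟩
        rcases hbE v hv with ⟨h1, h2⟩ | ⟨h1, h2⟩
        · have : v = s.b s'.q1 := hbv.symm.trans h2
          rw [this]
          exact hS.bb _ hI.q1
        · exact h2.symm.trans hbv
      · obtain ⟨β, hβ, rfl⟩ := mem_image.1 hv
        have := hb1 _ (Or.inr ⟨β, hβ, rfl⟩)
        rw [hbv] at this
        exact absurd (hS.bE _ hI.q1) (this ▸ hzE β hβ)
    exact h.tm v h0.1 h0.2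
  · have := h.tm_le
    omega
  · rcases hbE u hu with ⟨h1, h2⟩ | ⟨h1, h2⟩ <;> rcases hbE v hv with ⟨h3, h4⟩ | ⟨h3, h4⟩
    · rw [h2, h4]
    · exact absurd (huv ▸ h1) h3
    · exact absurd (huv ▸ h3) h1
    · rw [h2, h4, huv]
  · rw [hends _ hI.x0 hI.bx, hends _ hI.y0 hI.bY]

theorem contractP_spec {m : Mach} {A E P : Finset ℕ} {s : St} (hopt : Opt m.H A s.M)
    (h : SI m A E P s) (hx : s.x ∈ E) (hy : s.y ∈ E) (hadj : m.H.Adj s.x s.y)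
    (hne : s.b s.x ≠ s.b s.y) :
    wp m contractP s fun s' => ∃ T' v' u' g' NM' c' q' z' be' mr' c1' q1' c2' q2' h' E' b',
      s' = { s with T := T', v := v', u := u', g := g', NM := NM', c := c', q := q', z := z', be := be', mr := mr', c1 := c1', q1 := q1', c2 := c2', q2 := q2', h := h', E := E', b := b' } ∧
      ∃ F : Finset ℕ, SI m A F P s' ∧ E ⊆ F ∧ #E < #F ∧ T' ≤ s.T + 1000 * (m.n + 1) * (#F - #E) ∧
      (∀ u ∈ E, ∀ v ∈ E, s.b u = s.b v → b' u = b' v) ∧ b' s.y = b' s.x := by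
  refine wp_seq (wp_mono (clear_spec .mr) ?_)
  rintro _ ⟨T1, v1, mr1, rfl, hT1, hmr⟩
  dsimp
  refine wp_seq (wp_asg (by simp) ?_)
  refine wp_seq (wp_asg (by simp) ?_)
  refine wp_seq (wp_asg (by simp) ?_)
  refine wp_seq (wp_asg (by simp) ?_)
  dsimp
  refine wp_seq (wp_mono (liftLoop_spec (A := A) (E := E) h.lt hopt
    ⟨LInv.init h.inv hx hy hadj, h.inv, h.fE, fun v hv => ?_⟩) ?_)
  · simp [hmr v hv]
  · rintro _ ⟨T2, u2, g2, NM2, c2, q2, z2, be2, mr2, c12, q12, c22, q22, rfl, ⟨L, hC, hT2⟩, hb⟩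
    refine wp_seq (wp_asg (by simp) ?_)
    dsimp at hb hT2 ⊢
    refine wp_mono (relabel_spec (L := L) h.lt ⟨hC.inv, hC.sinv, hC.E, hC.mr⟩) ?_
    rintro _ ⟨T3, v3, h3, E3, b3, rfl, hT3, hEb⟩
    dsimp at hT3
    refine ⟨_, _, _, _, _, _, _, _, _, _, _, _, _, _, _, _, _, rfl, E ∪ L.image s.M, ?_⟩
    obtain ⟨r1, r2, r3, r4, r5⟩ := contract_post (s' := { s with T := T3, v := v3, u := u2, g := g2, NM := NM2, c := c2, q := q2, z := z2, be := s.b q12, mr := mr2, c1 := c12, q1 := q12, c2 := c22, q2 := q22, h := h3, E := E3, b := b3 }) h hC.sinv hC.inv hb hne hEb rfl rfl rfl rfl rfl rfl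
    refine ⟨r1, subset_union_left, by omega, ?_, r4, r5⟩
    rw [r3, Nat.add_sub_cancel_left]
    nlinarith

end GeoRAM

/-! ### Dealing with a single pair of vertices in the search -/

namespace GeoRAM

open WordRAM Matching Finset

/-- Grow the tree from `x` through `y`. -/
def growP : Prog :=
  asg .c (.v .x) ;; asg .q (.v .y) ;; asg .be (.v .y) ;; glueP ;;
  sto .E (.v .z) (.lit 1) ;; sto .b (.v .z) (.v .z) ;; sto .p (.v .z) (.v .x) ;;
  sto .t (.v .z) (.v .tm) ;; asg .tm (.inc (.v .tm))

/-- Deal with the pair `x`, `y` where `x` is outer. -/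
def visitP : Prog :=
  when (.adj (.v .x) (.v .y)) (when (.get .A (.v .y)) (
    cond (.get .E (.v .y))
      (cond (.eq (.get .b (.v .x)) (.get .b (.v .y))) .skip contractP)
      (cond (.get .E (.get .M (.v .y))) .skip growP)))

/-- Let `x` be an outer vertex that has not been scanned, or `n`. -/
def findP : Prog :=
  asg .x .n ;;
  forUp .v (when (.get .E (.v .v)) (cond (.get .dn (.v .v)) .skip (asg .x (.v .v))))

/-- Begin the search from the unmatched vertices. -/
def startP : Prog :=
  forUp .v (sto .E (.v .v) (.lit 0)) ;; forUp .v (sto .dn (.v .v) (.lit 0)) ;; asg .tm .n ;;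
  forUp .v (when (.get .A (.v .v)) (when (.eq (.get .M (.v .v)) (.v .v)) (
    sto .E (.v .v) (.lit 1) ;; sto .b (.v .v) (.v .v) ;; sto .t (.v .v) (.v .v) ;;
    forUp .u (sto .NM (.ix (.v .v) (.v .u)) (.get .M (.v .u))))))

/-- Find the vertices missed by maximum matchings. -/
def searchP : Prog :=
  startP ;; findP ;;
  while_ (.lt (.v .x) .n) (sto .dn (.v .x) (.lit 1) ;; forUp .y visitP ;; findP)

/-- `s'` differs from `s` only in what a visit changes. -/
def VFr (s s' : St) : Prop :=
  ∃ T' v' u' g' NM' c' q' z' be' mr' c1' q1' c2' q2' h' E' b' p' t' tm',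
    s' = { s with T := T', v := v', u := u', g := g', NM := NM', c := c', q := q', z := z', be := be', mr := mr', c1 := c1', q1 := q1', c2 := c2', q2 := q2', h := h', E := E', b := b', p := p', t := t', tm := tm' }

/-- `s'` differs from `s` only in what a search changes. -/
def SFr (s s' : St) : Prop :=
  ∃ T' v' u' g' NM' c' q' z' be' mr' c1' q1' c2' q2' h' E' b' p' t' tm' x' y' dn',
    s' = { s with T := T', v := v', u := u', g := g', NM := NM', c := c', q := q', z := z', be := be', mr := mr', c1 := c1', q1 := q1', c2 := c2', q2 := q2', h := h', E := E', b := b', p := p', t := t', tm := tm', x := x', y := y', dn := dn' }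

theorem SFr.trans {s s' s'' : St} (h : SFr s s') (h' : SFr s' s'') : SFr s s'' := by
  obtain ⟨_, _, _, _, _, _, _, _, _, _, _, _, _, _, _, _, _, _, _, _, _, _, _, rfl⟩ := h
  obtain ⟨_, _, _, _, _, _, _, _, _, _, _, _, _, _, _, _, _, _, _, _, _, _, _, rfl⟩ := h'
  exact ⟨_, _, _, _, _, _, _, _, _, _, _, _, _, _, _, _, _, _, _, _, _, _, _, rfl⟩

theorem growP_spec {m : Mach} {A E P : Finset ℕ} {s : St}
    (h : SI m A E P s) (hx : s.x ∈ E) (hy : s.y ∈ A) (hyE : s.y ∉ E) (hMy : s.M s.y ∉ E)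
    (hadj : m.H.Adj s.x s.y) :
    wp m growP s fun s' => VFr s s' ∧ SI m A (insert (s.M s.y) E) P s' ∧
      s'.T ≤ s.T + 100 * m.n + 300 ∧ ∀ u ∈ E, s'.b u = s.b u := by
  have hS := h.inv
  have hzA := (hS.isMat _ hy).1
  refine wp_seq (wp_asg (by simp) ?_)
  refine wp_seq (wp_asg (by simp) ?_)
  refine wp_seq (wp_asg (by simp) ?_)
  dsimp
  have hzn := h.lt _ hzA
  refine wp_seq (wp_mono (glueP_spec (h.lt _ (hS.sub hx)) (h.lt _ hy) hzn
    (fun h' => hMy (h' ▸ hx)) (fun h' => hyE (hS.root _ hy h'))) ?_)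
  rintro _ ⟨T2, u2, g2, NM2, rfl, hT2, r1, r2⟩
  dsimp at hT2 r1 r2
  have htm := h.tm_le
  -- At most `n` vertices are outer, so the counter `tm` is at most `2 * n`, the bound that `X.inc`
  -- asks for.
  have hEA := card_le_card (hS.sub.trans (fun v hv => mem_range.2 (h.lt v hv)))
  rw [card_range] at hEA
  refine wp_seq (wp_sto (by simp) (by simp) ?_)
  refine wp_seq (wp_sto (by simp) (by simp) ?_)
  refine wp_seq (wp_sto (by simp) (by simp) ?_)
  refine wp_seq (wp_sto (by simp) (by simp) ?_)
  refine wp_asg (by simp; omega) ?_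
  dsimp
  refine ⟨⟨_, _, _, _, _, _, _, _, _, _, _, _, _, _, _, _, _, _, _, _, rfl⟩, ?_, by omega, ?_⟩
  · refine ⟨h.fA, fun v hv => ?_, h.dn, h.lt, ?_, h.PE.trans (subset_insert _ _),
      fun v hv hb => ?_, ?_⟩
    · dsimp
      rw [Function.update_apply, mem_insert]
      split_ifs with hc
      · simp [hc]
      · simp only [hc, false_or]; exact h.fE v hv
    · refine hS.grow hx hy hyE hMy hadj h.tm
        (fun u hu v hv => r1 u (fun h' => hMy (h' ▸ hu)) v (h.lt v hv)) fun v hv => ?_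
      refine (r2 v (h.lt v hv)).trans ?_
      have hE : (s.E v ≠ 0 ∧ s.b v = s.y) ↔ (v ∈ E ∧ s.b v = s.y) :=
        and_congr_left fun _ => h.fE v (h.lt v hv)
      simp only [glue, hE]
      rfl
    · dsimp at hb ⊢
      rcases mem_insert.1 hv with rfl | hv
      · simp
      · have hne : v ≠ s.M s.y := fun h' => hMy (h' ▸ hv)
        rw [Function.update_of_ne hne] at hb ⊢
        have := h.tm v hv hb
        omega
    · dsimp
      rw [card_insert_of_notMem hMy]
      omega
  · intro u hu
    have hne : u ≠ s.M s.y := fun h' => hMy (h' ▸ hu)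
    rw [Function.update_of_ne hne]

/-- Blossoms only get coarser. A vertex `y` that was inner and becomes outer was not in `E ⊇ P`, so
the edge to it falls under `y ∉ P` and is left for the scan of `y`. -/
theorem Scanned_mono {H : SimpleGraph ℕ} {A E F P : Finset ℕ} {M b b' : ℕ → ℕ} {x y : ℕ}
    (h : SInv.Scanned H A M E b P x y) (hEF : E ⊆ F) (hPE : P ⊆ E)
    (hb : ∀ u ∈ E, ∀ v ∈ E, b u = b v → b' u = b' v) (hx : x ∈ E) :
    SInv.Scanned H A M F b' P x y := by
  intro hy hadj
  rcases h hy hadj with ⟨h1, h2⟩ | ⟨h1, h2⟩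
  · exact Or.inl ⟨hEF h1, h2.imp_left (hb y h1 x hx)⟩
  · by_cases hyF : y ∈ F
    · exact Or.inl ⟨hyF, Or.inr fun h => h1 (hPE h)⟩
    · exact Or.inr ⟨hyF, hEF h2⟩

/-- After a visit the pair has been dealt with. -/
theorem visitP_spec {m : Mach} {A E P P' : Finset ℕ} {s : St} (hopt : Opt m.H A s.M)
    (h : SI m A E P s) (hx : s.x ∈ E) (hxn : s.x < m.n) (hy : s.y < m.n) :
    wp m visitP s fun s' => VFr s s' ∧ ∃ F, SI m A F P s' ∧ E ⊆ F ∧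
      (∀ u ∈ E, ∀ v ∈ E, s.b u = s.b v → s'.b u = s'.b v) ∧
      SInv.Scanned m.H A s.M F s'.b P' s.x s.y ∧
      s'.T ≤ s.T + 100 + 1000 * (m.n + 1) * (#F - #E) := by
  have hS := h.inv
  refine wp_when (by simp; omega) (fun h1 => wp_when (by simp) (fun h2 => wp_cond (by simp)
    (fun h3 => wp_cond (by simp) (fun h4 => wp_skip ?_) (fun h4 => ?_))
    (fun h3 => wp_cond (by simp) (fun h4 => wp_skip ?_) (fun h4 => ?_))) (fun h2 => ?_))
    (fun h1 => ?_) <;> simp at *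
  · have hyA := (h.fA _ hy).1 h2
    have hyE := (h.fE _ hy).1 h3
    exact ⟨⟨_, _, _, _, _, _, _, _, _, _, _, _, _, _, _, _, _, _, _, _, rfl⟩, E,
      ⟨h.fA, h.fE, h.dn, h.lt, h.inv, h.PE, h.tm, h.tm_le⟩, Subset.rfl,
      fun _ _ => Or.inl ⟨hyE, Or.inl h4.symm⟩, by omega⟩
  · have hyA := (h.fA _ hy).1 h2
    have hyE := (h.fE _ hy).1 h3
    refine wp_mono (contractP_spec (A := A) (E := E) (P := P) hopt
      ⟨h.fA, h.fE, h.dn, h.lt, h.inv, h.PE, h.tm, h.tm_le⟩ hx hyE h1 h4) ?_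
    rintro _ ⟨_, _, _, _, _, _, _, _, _, _, _, _, _, _, _, _, _, rfl, F, hF, hEF, hlt, hT, hb, he⟩
    refine ⟨⟨_, _, _, _, _, _, _, _, _, _, _, _, _, _, _, _, _, _, _, _, rfl⟩, F, hF, hEF, hb,
      fun _ _ => Or.inl ⟨hEF hyE, Or.inl he⟩, ?_⟩
    dsimp at *
    omega
  · have hyA := (h.fA _ hy).1 h2
    have hyE : s.y ∉ E := fun h' => (h.fE _ hy).2 h' h3
    have hMyE := (h.fE _ (h.lt _ (hS.isMat _ hyA).1)).1 h4
    exact ⟨⟨_, _, _, _, _, _, _, _, _, _, _, _, _, _, _, _, _, _, _, _, rfl⟩, E,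
      ⟨h.fA, h.fE, h.dn, h.lt, h.inv, h.PE, h.tm, h.tm_le⟩, Subset.rfl,
      fun _ _ => Or.inr ⟨hyE, hMyE⟩, by omega⟩
  · have hyA := (h.fA _ hy).1 h2
    have hyE : s.y ∉ E := fun h' => (h.fE _ hy).2 h' h3
    have hMyE : s.M s.y ∉ E := fun h' => (h.fE _ (h.lt _ (hS.isMat _ hyA).1)).2 h' h4
    refine wp_mono (growP_spec (A := A) (E := E) (P := P)
      ⟨h.fA, h.fE, h.dn, h.lt, h.inv, h.PE, h.tm, h.tm_le⟩ hx hyA hyE hMyE h1) ?_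
    rintro s' ⟨hv, hSI, hT, hb⟩
    refine ⟨?_, _, hSI, subset_insert _ _, fun u hu v hv h => ?_, fun _ _ => Or.inr
      ⟨fun h' => ?_, mem_insert_self _ _⟩, ?_⟩
    · obtain ⟨_, _, _, _, _, _, _, _, _, _, _, _, _, _, _, _, _, _, _, _, rfl⟩ := hv
      exact ⟨_, _, _, _, _, _, _, _, _, _, _, _, _, _, _, _, _, _, _, _, rfl⟩
    · rw [hb u hu, hb v hv]; exact h
    · rcases mem_insert.1 h' with h' | h'
      exacts [hyE (hS.root _ hyA h'.symm), hyE h']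
    · rw [card_insert_of_notMem hMyE, Nat.add_sub_cancel_left]
      dsimp at hT
      linarith
  · have hyA : s.y ∉ A := fun h' => (h.fA _ hy).2 h' h2
    exact ⟨⟨_, _, _, _, _, _, _, _, _, _, _, _, _, _, _, _, _, _, _, _, rfl⟩, E,
      ⟨h.fA, h.fE, h.dn, h.lt, h.inv, h.PE, h.tm, h.tm_le⟩, Subset.rfl,
      fun h' => absurd h' hyA, by omega⟩
  · exact ⟨⟨_, _, _, _, _, _, _, _, _, _, _, _, _, _, _, _, _, _, _, _, rfl⟩, E,
      ⟨h.fA, h.fE, h.dn, h.lt, h.inv, h.PE, h.tm, h.tm_le⟩, Subset.rfl,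
      fun _ h' => absurd h' h1, by omega⟩

end GeoRAM

/-! ### The complete search in quadratic time -/

namespace GeoRAM

open WordRAM Matching Finset

theorem findP_spec {m : Mach} {E P : Finset ℕ} {s : St} (hE : Flags m.n s.E E)
    (hP : Flags m.n s.dn P) (hlt : ∀ v ∈ E, v < m.n) :
    wp m findP s fun s' => ∃ T' x' v', s' = { s with T := T', x := x', v := v' } ∧
      T' ≤ s.T + 40 * m.n + 20 ∧ ((x' = m.n ∧ E ⊆ P) ∨ (x' < m.n ∧ x' ∈ E ∧ x' ∉ P)) := by
  refine wp_seq (wp_asg (by simp) ?_)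
  dsimp
  refine wp_for (fun i s' => ∃ T' x', s' = { s with T := T', x := x', v := i } ∧
    T' ≤ s.T + 40 * i + 10 ∧ ((x' = m.n ∧ ∀ v < i, v ∈ E → v ∈ P) ∨
      (x' < m.n ∧ x' ∈ E ∧ x' ∉ P))) ?_ ?_ ?_
  · exact ⟨_, _, rfl, by dsimp; omega, Or.inl ⟨rfl, by intros; omega⟩⟩
  · rintro i hi _ - ⟨T1, x1, rfl, hT, h⟩
    have hEi := hE i hi
    have hPi := hP i hi
    refine wp_when (by simp) (fun h1 => wp_cond (by simp) (fun h2 => wp_skip ?_)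
      (fun h2 => wp_asg (by simp) ?_)) (fun h1 => ?_)
    · simp at h1 h2
      dsimp
      refine ⟨rfl, _, _, rfl, by omega, h.imp_left fun h => ⟨h.1, fun v hv hvE => ?_⟩⟩
      rcases Nat.lt_succ_iff_lt_or_eq.1 hv with hv | rfl
      exacts [h.2 v hv hvE, hPi.1 h2]
    · simp at h1 h2
      dsimp
      exact ⟨rfl, _, _, rfl, by omega, Or.inr ⟨hi, hEi.1 h1, fun h => hPi.2 h h2⟩⟩
    · simp at h1
      dsimp
      refine ⟨rfl, _, _, rfl, by omega, h.imp_left fun h => ⟨h.1, fun v hv hvE => ?_⟩⟩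
      rcases Nat.lt_succ_iff_lt_or_eq.1 hv with hv | rfl
      exacts [h.2 v hv hvE, absurd h1 (hEi.2 hvE)]
  · rintro _ - ⟨T1, x1, rfl, hT, h⟩
    exact ⟨_, _, _, rfl, by dsimp; omega,
      h.imp_left fun h => ⟨h.1, fun v hv => h.2 v (hlt v hv) hv⟩⟩

theorem copyRow_spec {m : Mach} {s : St} (hv : s.v < m.n) :
    wp m (forUp .u (sto .NM (.ix (.v .v) (.v .u)) (.get .M (.v .u)))) s fun s' =>
      ∃ T' u' f, s' = { s with T := T', u := u', NM := f } ∧ T' ≤ s.T + 40 * m.n + 10 ∧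
      (∀ u < m.n, rows m.n f s.v u = s.M u) ∧
      ∀ x, x ≠ s.v → ∀ u < m.n, rows m.n f x u = rows m.n s.NM x u := by
  refine wp_for (fun i s' => ∃ T' f, s' = { s with T := T', u := i, NM := f } ∧
      T' ≤ s.T + 40 * i + 5 ∧ (∀ u < i, rows m.n f s.v u = s.M u) ∧
      ∀ x, x ≠ s.v → ∀ u < m.n, rows m.n f x u = rows m.n s.NM x u) ?_ ?_ ?_
  · exact ⟨_, _, rfl, by dsimp; omega, by intros; omega, fun _ _ _ _ => rfl⟩
  · rintro i hi _ - ⟨T1, f, rfl, hT, h1, h2⟩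
    refine wp_sto (by simp; omega) (by simp) ?_
    dsimp
    refine ⟨rfl, _, _, rfl, by omega, fun u hu => ?_, fun x hx u hu => ?_⟩
    · by_cases hui : u = i
      · simp [rows, hui]
      · have : s.v * m.n + u ≠ s.v * m.n + i := by omega
        rw [rows, Function.update_of_ne this]
        exact h1 u (by omega)
    · have : x * m.n + u ≠ s.v * m.n + i := fun h => hx (ix_inj hu hi h).1
      rw [rows, Function.update_of_ne this]
      exact h2 x hx u hu
  · rintro _ - ⟨T1, f, rfl, hT, h1, h2⟩
    exact ⟨_, _, _, rfl, by dsimp; omega, h1, h2⟩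

theorem startP_spec {m : Mach} {A : Finset ℕ} {s : St} (hA : Flags m.n s.A A)
    (hlt : ∀ v ∈ A, v < m.n) (hM : IsMat m.H A s.M) :
    wp m startP s fun s' => SFr s s' ∧ SI m A (fx A s.M) ∅ s' ∧
      s'.T ≤ s.T + 200 * (m.n + 1) * (m.n + 1) := by
  refine wp_seq (wp_mono (clear_spec .E) ?_)
  rintro _ ⟨T1, v1, E1, rfl, hT1, hE1⟩
  refine wp_seq (wp_mono (clear_spec .dn) ?_)
  rintro _ ⟨T2, v2, dn2, rfl, hT2, hdn2⟩
  refine wp_seq (wp_asg (by simp) ?_)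
  dsimp at hT1 hT2 ⊢
  refine wp_for (fun i s' => ∃ T' u' E' b' t' NM', s' = { s with T := T', v := i, u := u', E := E', b := b', t := t', NM := NM', dn := dn2, tm := m.n } ∧
    T' ≤ T2 + 20 + (40 * m.n + 100) * i ∧ (∀ v < m.n, i ≤ v → E' v = 0) ∧
    ∀ v < i, (E' v ≠ 0 ↔ v ∈ fx A s.M) ∧ (v ∈ fx A s.M → b' v = v ∧ t' v = v ∧
      ∀ u < m.n, rows m.n NM' v u = s.M u)) ?_ ?_ ?_
  · exact ⟨_, _, _, _, _, _, rfl, by dsimp; omega, fun v hv _ => hE1 v hv, by intros; omega⟩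
  · rintro i hi _ - ⟨T3, u3, E3, b3, t3, NM3, rfl, hT3, h1, h2⟩
    have hno : i ∉ fx A s.M → ∀ v < i + 1, (E3 v ≠ 0 ↔ v ∈ fx A s.M) ∧ (v ∈ fx A s.M →
        b3 v = v ∧ t3 v = v ∧ ∀ u < m.n, rows m.n NM3 v u = s.M u) := by
      intro hn v hv
      rcases Nat.lt_succ_iff_lt_or_eq.1 hv with hv | rfl
      · exact h2 v hv
      · exact ⟨iff_of_false (not_not.2 (h1 v hi le_rfl)) hn, fun h => absurd h hn⟩
    have hno' : ∀ v < m.n, i + 1 ≤ v → E3 v = 0 := fun v hv h => h1 v hv (by omega)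
    have hAi := hA i hi
    refine wp_when (by simp) (fun h3 => wp_when (by simp) (fun h4 => ?_) (fun h4 => ?_))
      (fun h3 => ?_)
    · simp at h3 h4
      refine wp_seq (wp_sto (by simp) (by simp) ?_)
      refine wp_seq (wp_sto (by simp) (by simp) ?_)
      refine wp_seq (wp_sto (by simp) (by simp) ?_)
      dsimp
      refine wp_mono (copyRow_spec (by exact hi)) ?_
      rintro _ ⟨T4, u4, NM4, rfl, hT4, r1, r2⟩
      dsimp at hT4 r1 r2 ⊢
      refine ⟨rfl, _, _, _, _, _, _, rfl, by nlinarith, fun v hv hiv => ?_, fun v hv => ?_⟩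
      · rw [Function.update_of_ne (by omega)]
        exact hno' v hv hiv
      · rcases Nat.lt_succ_iff_lt_or_eq.1 hv with hv | rfl
        · simp only [Function.update_of_ne hv.ne]
          refine ⟨(h2 v hv).1, fun h => ?_⟩
          obtain ⟨k1, k2, k3⟩ := (h2 v hv).2 h
          exact ⟨k1, k2, fun u hu => (r2 v hv.ne u hu).trans (k3 u hu)⟩
        · simp only [Function.update_self]
          exact ⟨iff_of_true one_ne_zero (mem_fx.2 ⟨hAi.1 h3, h4⟩), fun _ => ⟨trivial, trivial, r1⟩⟩
    · simp at h3 h4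
      dsimp
      exact ⟨rfl, _, _, _, _, _, _, rfl, by nlinarith, hno', hno fun h => h4 (mem_fx.1 h).2⟩
    · simp at h3
      dsimp
      exact ⟨rfl, _, _, _, _, _, _, rfl, by nlinarith, hno',
        hno fun h => hAi.2 (mem_fx.1 h).1 h3⟩
  · rintro _ - ⟨T3, u3, E3, b3, t3, NM3, rfl, hT3, -, h2⟩
    have hl : ∀ v ∈ fx A s.M, v < m.n := fun v hv => hlt v (mem_fx.1 hv).1
    refine ⟨⟨_, _, _, _, _, _, _, _, _, _, _, _, _, _, _, _, _, _, _, _, _, _, _, rfl⟩,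
      ⟨hA, fun v hv => (h2 v hv).1, fun v hv => ?_, hlt, SInv.init hM _ (fun x hx v hv => ?_)
        (fun x hx => ?_) (fun x hx => ?_), empty_subset _, fun v hv _ => ?_, ?_⟩, ?_⟩
    · simp [hdn2 v hv]
    · exact ((h2 x (hl x hx)).2 hx).2.2 v (hlt v hv)
    · exact ((h2 x (hl x hx)).2 hx).1
    · exact ((h2 x (hl x hx)).2 hx).2.1
    · dsimp
      rw [((h2 v (hl v hv)).2 hv).2.1]
      exact hl v hv
    · dsimp; omega
    · dsimp
      nlinarith

/-- Scanning costs a constant per vertex `y`, plus linear time for each vertex that becomes outer;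
the second part telescopes over the whole search. -/
theorem scan_spec {m : Mach} {A E P : Finset ℕ} {s : St} (hopt : Opt m.H A s.M)
    (h : SI m A E (insert s.x P) s)
    (hP : ∀ x ∈ P, ∀ y, SInv.Scanned m.H A s.M E s.b P x y) :
    wp m (forUp .y visitP) s fun s' => SFr s s' ∧ ∃ F, SI m A F (insert s.x P) s' ∧ E ⊆ F ∧
      (∀ x ∈ insert s.x P, ∀ y, SInv.Scanned m.H A s.M F s'.b (insert s.x P) x y) ∧
      s'.T ≤ s.T + 20 + 110 * m.n + 1000 * (m.n + 1) * (#F - #E) := by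
  have hxE : s.x ∈ E := h.PE (mem_insert_self _ _)
  have hxA := h.inv.sub hxE
  have hxn := h.lt _ hxA
  refine wp_for (fun i s' => VFr { s with y := i } s' ∧ ∃ F, SI m A F (insert s.x P) s' ∧ E ⊆ F ∧
      (∀ x ∈ P, ∀ y, SInv.Scanned m.H A s.M F s'.b P x y) ∧
      (∀ y < i, SInv.Scanned m.H A s.M F s'.b P s.x y) ∧
      s'.T ≤ s.T + 10 + 110 * i + 1000 * (m.n + 1) * (#F - #E)) ?_ ?_ ?_
  · exact ⟨⟨_, _, _, _, _, _, _, _, _, _, _, _, _, _, _, _, _, _, _, _, rfl⟩, E,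
      ⟨h.fA, h.fE, h.dn, h.lt, h.inv, h.PE, h.tm, h.tm_le⟩, Subset.rfl, hP,
      by intros; omega, by dsimp; omega⟩
  · rintro i hi _ - ⟨⟨T1, _, _, _, _, _, _, _, _, _, _, _, _, _, _, E1, b1, p1, t1, tm1, rfl⟩, F, hF, hEF, k1, k2, hT⟩
    refine wp_mono (visitP_spec (P' := P) (A := A) (E := F) (P := insert s.x P) hopt
      ⟨hF.fA, hF.fE, hF.dn, hF.lt, hF.inv, hF.PE, hF.tm, hF.tm_le⟩ (hEF hxE) hxn hi) ?_
    rintro s2 ⟨hv, F', hF', hFF, hb, hsc, hT2⟩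
    have hPF : P ⊆ F := (subset_insert _ _).trans hF.PE
    obtain ⟨_, _, _, _, _, _, _, _, _, _, _, _, _, _, _, _, _, _, _, _, rfl⟩ := hv
    dsimp at *
    refine ⟨rfl, ⟨_, _, _, _, _, _, _, _, _, _, _, _, _, _, _, _, _, _, _, _, rfl⟩, F',
      ⟨hF'.fA, hF'.fE, hF'.dn, hF'.lt, hF'.inv, hF'.PE, hF'.tm, hF'.tm_le⟩, hEF.trans hFF,
      fun x hx y => Scanned_mono (k1 x hx y) hFF hPF hb (hPF hx), fun y hy => ?_, ?_⟩
    · rcases Nat.lt_succ_iff_lt_or_eq.1 hy with hy | rfl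
      · exact Scanned_mono (k2 y hy) hFF hPF hb (hEF hxE)
      · exact hsc
    · have h1 := card_le_card hEF
      have h2 := card_le_card hFF
      have : #F' - #E = (#F - #E) + (#F' - #F) := by omega
      rw [this, Nat.mul_add]
      linarith
  · rintro _ - ⟨⟨T1, _, _, _, _, _, _, _, _, _, _, _, _, _, _, E1, b1, p1, t1, tm1, rfl⟩, F, hF, hEF, k1, k2, hT⟩
    dsimp at *
    have hxs : ∀ y, SInv.Scanned m.H A s.M F b1 P s.x y := fun y hyA hadj =>
      k2 y (h.lt y hyA) hyA hadj
    refine ⟨⟨_, _, _, _, _, _, _, _, _, _, _, _, _, _, _, _, _, _, _, _, _, _, _, rfl⟩, F,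
      ⟨hF.fA, hF.fE, hF.dn, hF.lt, hF.inv, hF.PE, hF.tm, hF.tm_le⟩, hEF, fun x hx y => ?_,
      by linarith⟩
    have key : ∀ x ∈ insert s.x P, ∀ y, SInv.Scanned m.H A s.M F b1 P x y := fun x hx y => by
      rcases mem_insert.1 hx with rfl | hx
      exacts [hxs y, k1 x hx y]
    intro hyA hadj
    rcases key x hx y hyA hadj with ⟨h1, h2 | h2⟩ | h1
    · exact Or.inl ⟨h1, Or.inl h2⟩
    -- An edge from a vertex scanned earlier to `s.x` may have been postponed because `s.x` was not
    -- yet done. The scan of `s.x` has now met the same edge from the other end, which puts both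
    -- ends in one blossom.
    · by_cases hyx : y = s.x
      · subst hyx
        refine Or.inl ⟨h1, Or.inl ?_⟩
        rcases mem_insert.1 hx with rfl | hxP'
        · rfl
        · rcases hxs x (h.inv.sub (h.PE hx)) hadj.symm with ⟨_, h4 | h4⟩ | h3
          exacts [h4.symm, absurd hxP' h4, absurd (hF.PE hx) h3.1]
      · exact Or.inl ⟨h1, Or.inr fun h => (mem_insert.1 h).elim hyx h2⟩
    · exact Or.inr h1

/-- The search finds the vertices missed by maximum matchings, with matchings that miss them. -/
theorem searchP_spec {m : Mach} {A : Finset ℕ} {s : St} (hA : Flags m.n s.A A)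
    (hlt : ∀ v ∈ A, v < m.n) (hopt : Opt m.H A s.M) :
    wp m searchP s fun s' => SFr s s' ∧ (∀ v < m.n, s'.E v ≠ 0 ↔ v ∈ A ∧ Miss m.H A v) ∧
      (∀ x ∈ A, Miss m.H A x →
        Opt m.H A (rows m.n s'.NM x) ∧ rows m.n s'.NM x x = x) ∧
      s'.T ≤ s.T + 2000 * (m.n + 1) * (m.n + 1) := by
  refine wp_seq (wp_mono (startP_spec hA hlt hopt.1) ?_)
  rintro s1 ⟨f1, h1, hT1⟩
  have hM1 : s1.M = s.M := by
    obtain ⟨_, _, _, _, _, _, _, _, _, _, _, _, _, _, _, _, _, _, _, _, _, _, _, rfl⟩ := f1; rfl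
  have hcard : ∀ {E P s}, SI m A E P s → #P ≤ #E ∧ #E ≤ m.n := fun h => by
    have h1 := card_le_card (h.inv.sub.trans fun v hv => mem_range.2 (hlt v hv))
    rw [card_range] at h1
    exact ⟨card_le_card h.PE, h1⟩
  refine wp_seq (wp_mono (findP_spec h1.fE h1.dn fun v hv => hlt v (h1.inv.sub hv)) ?_)
  rintro _ ⟨T2, x2, v2, rfl, hT2, hx2⟩
  refine wp_while (fun s' => SFr s s' ∧ ∃ E P, SI m A E P s' ∧
      (∀ x ∈ P, ∀ y, SInv.Scanned m.H A s.M E s'.b P x y) ∧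
      ((s'.x = m.n ∧ E ⊆ P) ∨ (s'.x < m.n ∧ s'.x ∈ E ∧ s'.x ∉ P)) ∧
      s'.T ≤ T2 + 200 * (m.n + 1) * #P + 1000 * (m.n + 1) * #E)
    -- Each round marks one more outer vertex as done.
    (fun s' => m.n - #{v ∈ range m.n | s'.dn v ≠ 0}) ?_ ?_ ?_ ?_
  · refine ⟨f1.trans ⟨_, _, _, _, _, _, _, _, _, _, _, _, _, _, _, _, _, _, _, _, _, _, _, rfl⟩, _, _,
      ⟨h1.fA, h1.fE, h1.dn, h1.lt, h1.inv, h1.PE, h1.tm, h1.tm_le⟩, by simp, hx2, ?_⟩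
    dsimp
    omega
  · intros; simp
  · rintro s3 ⟨f3, E, P, hSI, hP, hx, hT⟩ hlt3
    simp at hlt3
    obtain ⟨-, hxE, hxP⟩ := hx.resolve_left fun h => by omega
    have hM3 : s3.M = s.M := by
      obtain ⟨_, _, _, _, _, _, _, _, _, _, _, _, _, _, _, _, _, _, _, _, _, _, _, rfl⟩ := f3; rfl
    have hdn : ∀ {E P s}, SI m A E P s → #{v ∈ range m.n | s.dn v ≠ 0} = #P := fun h => by
      congr 1
      ext v
      simp only [mem_filter, mem_range]
      exact ⟨fun h' => (h.dn v h'.1).1 h'.2, fun h' =>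
        have := hlt v (h.inv.sub (h.PE h'))
        ⟨this, (h.dn v this).2 h'⟩⟩
    refine wp_seq (wp_sto (by simp) (by simp) ?_)
    dsimp
    refine wp_seq (wp_mono (scan_spec (A := A) (E := E) (P := P) (by dsimp; rw [hM3]; exact hopt)
      ⟨hSI.fA, hSI.fE, fun v hv => ?_, hSI.lt, hSI.inv, insert_subset hxE hSI.PE, hSI.tm,
        hSI.tm_le⟩ (by dsimp; rw [hM3]; exact hP)) ?_)
    · dsimp
      rw [Function.update_apply, mem_insert]
      split_ifs with hc
      · simp [hc]
      · simp only [hc, false_or]; exact hSI.dn v hv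
    rintro s4 ⟨f4, F, hF, hEF, hP4, hT4⟩
    refine wp_mono (findP_spec hF.fE hF.dn fun v hv => hlt v (hF.inv.sub hv)) ?_
    rintro _ ⟨T5, x5, v5, rfl, hT5, hx5⟩
    dsimp at *
    refine ⟨⟨?_, F, _, ⟨hF.fA, hF.fE, hF.dn, hF.lt, hF.inv, hF.PE, hF.tm, hF.tm_le⟩,
      by rw [hM3] at hP4; exact hP4, hx5, ?_⟩, ?_⟩
    · refine (f3.trans ?_).trans (f4.trans
        ⟨_, _, _, _, _, _, _, _, _, _, _, _, _, _, _, _, _, _, _, _, _, _, _, rfl⟩)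
      exact ⟨_, _, _, _, _, _, _, _, _, _, _, _, _, _, _, _, _, _, _, _, _, _, _, rfl⟩
    · rw [card_insert_of_notMem hxP]
      have := card_le_card hEF
      have : 1000 * (m.n + 1) * #F = 1000 * (m.n + 1) * #E + 1000 * (m.n + 1) * (#F - #E) := by
        rw [← Nat.mul_add]; congr 1; omega
      rw [this]
      linarith
    · rw [hdn hF, hdn hSI, card_insert_of_notMem hxP]
      have h1 := hcard hF
      rw [card_insert_of_notMem hxP] at h1
      omega
  · rintro s3 ⟨f3, E, P, hSI, hP, hx, hT⟩ hlt3
    simp at hlt3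
    obtain ⟨-, hEP⟩ := hx.resolve_right fun h => by omega
    have hM3 : s3.M = s.M := by
      obtain ⟨_, _, _, _, _, _, _, _, _, _, _, _, _, _, _, _, _, _, _, _, _, _, _, rfl⟩ := f3; rfl
    -- The exit value `x = n` says that every outer vertex has been scanned, which is what
    -- `outer_iff_miss` requires.
    obtain rfl : E = P := hEP.antisymm hSI.PE
    have hinv := hSI.inv
    rw [hM3] at hinv
    have key : ∀ v ∈ A, v ∈ E ↔ Miss m.H A v := fun v hv => hinv.outer_iff_miss hopt hP hv
    refine ⟨f3.trans ⟨_, _, _, _, _, _, _, _, _, _, _, _, _, _, _, _, _, _, _, _, _, _, _, rfl⟩,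
      fun v hv => ?_, fun x hx hm => ?_, ?_⟩
    · refine (hSI.fE v hv).trans ⟨fun h => ⟨hinv.sub h, (key v (hinv.sub h)).1 h⟩, fun h =>
        (key v h.1).2 h.2⟩
    · obtain ⟨k1, k2, k3⟩ := hinv.mat x ((key x hx).2 hm)
      exact ⟨hopt.of_card_le k1 k3.le, k2⟩
    · have := (hcard hSI).2
      dsimp at *
      nlinarith

end GeoRAM

/-! ### Building a maximum matching vertex by vertex -/

namespace GeoRAM

open WordRAM Matching Finset

/-- Let `x` be a neighbour of `w` that some maximum matching misses, or `n`. -/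
def partnerP : Prog :=
  asg .x .n ;; forUp .v (when (.adj (.v .w) (.v .v)) (when (.get .E (.v .v)) (asg .x (.v .v))))

/-- Extend a maximum matching by the vertex `w`. -/
def extendP : Prog :=
  searchP ;; partnerP ;; sto .A (.v .w) (.lit 1) ;;
  cond (.lt (.v .x) .n)
    (forUp .v (sto .M (.v .v) (.get .NM (.ix (.v .x) (.v .v)))) ;;
      sto .M (.v .x) (.v .w) ;; sto .M (.v .w) (.v .x))
    (sto .M (.v .w) (.v .w))

/-- Compute a maximum matching of the graph. -/
def matchP : Prog := forUp .v (sto .A (.v .v) (.lit 0)) ;; forUp .w extendP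

theorem partnerP_spec {m : Mach} {s : St} (hw : s.w < m.n) :
    wp m partnerP s fun s' => ∃ T' x' v', s' = { s with T := T', x := x', v := v' } ∧
      T' ≤ s.T + 40 * m.n + 20 ∧ ((x' = m.n ∧ ∀ v < m.n, m.H.Adj s.w v → s.E v = 0) ∨
        (x' < m.n ∧ m.H.Adj s.w x' ∧ s.E x' ≠ 0)) := by
  refine wp_seq (wp_asg (by simp) ?_)
  dsimp
  refine wp_for (fun i s' => ∃ T' x', s' = { s with T := T', x := x', v := i } ∧
    T' ≤ s.T + 40 * i + 10 ∧ ((x' = m.n ∧ ∀ v < i, m.H.Adj s.w v → s.E v = 0) ∨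
        (x' < m.n ∧ m.H.Adj s.w x' ∧ s.E x' ≠ 0))) ?_ ?_ ?_
  · exact ⟨_, _, rfl, by dsimp; omega, Or.inl ⟨rfl, by intros; omega⟩⟩
  · rintro i hi _ - ⟨T1, x1, rfl, hT, h⟩
    refine wp_when (by simp; omega) (fun h1 => wp_when (by simp) (fun h2 => wp_asg (by simp) ?_)
      (fun h2 => ?_)) (fun h1 => ?_)
    · simp at h1 h2
      dsimp
      exact ⟨rfl, _, _, rfl, by omega, Or.inr ⟨hi, h1, h2⟩⟩
    · simp at h1 h2
      dsimp
      refine ⟨rfl, _, _, rfl, by omega, h.imp_left fun h => ⟨h.1, fun v hv hvE => ?_⟩⟩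
      rcases Nat.lt_succ_iff_lt_or_eq.1 hv with hv | rfl
      exacts [h.2 v hv hvE, h2]
    · simp at h1
      dsimp
      refine ⟨rfl, _, _, rfl, by omega, h.imp_left fun h => ⟨h.1, fun v hv hvE => ?_⟩⟩
      rcases Nat.lt_succ_iff_lt_or_eq.1 hv with hv | rfl
      exacts [h.2 v hv hvE, absurd hvE h1]
  · rintro _ - ⟨T1, x1, rfl, hT, h⟩
    exact ⟨_, _, _, rfl, by dsimp; omega, h⟩

theorem copyM_spec {m : Mach} {s : St} (hx : s.x < m.n) :
    wp m (forUp .v (sto .M (.v .v) (.get .NM (.ix (.v .x) (.v .v))))) s fun s' =>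
      ∃ T' v' f, s' = { s with T := T', v := v', M := f } ∧ T' ≤ s.T + 40 * m.n + 10 ∧
      ∀ v < m.n, f v = rows m.n s.NM s.x v := by
  refine wp_for (fun i s' => ∃ T' f, s' = { s with T := T', v := i, M := f } ∧
      T' ≤ s.T + 40 * i + 5 ∧ ∀ v < i, f v = rows m.n s.NM s.x v) ?_ ?_ ?_
  · exact ⟨_, _, rfl, by dsimp; omega, by intros; omega⟩
  · rintro i hi _ - ⟨T1, f, rfl, hT, h1⟩
    refine wp_sto (by simp) (by simp; omega) ?_
    dsimp
    refine ⟨rfl, _, _, rfl, by omega, fun u hu => ?_⟩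
    by_cases hui : u = i
    · simp [rows, hui]
    · rw [Function.update_of_ne hui]
      exact h1 u (by omega)
  · rintro _ - ⟨T1, f, rfl, hT, h1⟩
    exact ⟨_, _, _, rfl, by dsimp; omega, h1⟩

theorem Flags.insert {n v : ℕ} {f : ℕ → ℕ} {S : Finset ℕ} (h : Flags n f S) {c : ℕ} (hc : c ≠ 0) :
    Flags n (Function.update f v c) (insert v S) := by
  intro u hu
  rw [Function.update_apply, mem_insert]
  split_ifs with huv
  · simp [huv, hc]
  · simp only [huv, false_or]; exact h u hu

theorem Flags.erase {n v : ℕ} {f : ℕ → ℕ} {S : Finset ℕ} (h : Flags n f S) :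
    Flags n (Function.update f v 0) (S.erase v) := by
  intro u hu
  rw [Function.update_apply, mem_erase]
  split_ifs with huv
  · simp [huv]
  · simp only [ne_eq, huv, not_false_eq_true, true_and]; exact h u hu

/-- If `w` has a neighbour `x` that can be missed, the row of `x` is a maximum matching missing it
and `opt_join` applies; otherwise `w` stays free by `opt_free`. -/
theorem extendP_spec {m : Mach} {A : Finset ℕ} {s : St} (hA : Flags m.n s.A A)
    (hlt : ∀ v ∈ A, v < m.n) (hopt : Opt m.H A s.M) (hw : s.w < m.n) (hwA : s.w ∉ A) :
    wp m extendP s fun s' => s'.src = s.src ∧ s'.w = s.w ∧ Flags m.n s'.A (insert s.w A) ∧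
      Opt m.H (insert s.w A) s'.M ∧ s'.T ≤ s.T + 3000 * (m.n + 1) * (m.n + 1) := by
  refine wp_seq (wp_mono (searchP_spec hA hlt hopt) ?_)
  rintro _ ⟨⟨T1, _, _, _, NM1, _, _, _, _, _, _, _, _, _, _, E1, _, _, _, _, _, _, _, rfl⟩, hE, hN, hT⟩
  refine wp_seq (wp_mono (partnerP_spec hw) ?_)
  rintro _ ⟨T2, x2, v2, rfl, hT2, hx⟩
  refine wp_seq (wp_sto (by simp) (by simp) ?_)
  dsimp at *
  refine wp_cond (by simp) (fun h1 => ?_) (fun h1 => wp_sto (by simp) (by simp) ?_)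
  · simp at h1
    obtain ⟨-, hadj, hxE⟩ := hx.resolve_left fun h => by omega
    obtain ⟨hxA, hxm⟩ := (hE x2 h1).1 hxE
    obtain ⟨k1, k2⟩ := hN x2 hxA hxm
    refine wp_seq (wp_mono (copyM_spec h1) ?_)
    rintro _ ⟨T3, v3, f, rfl, hT3, hf⟩
    refine wp_seq (wp_sto (by simp) (by simp) ?_)
    refine wp_sto (by simp) (by simp) ?_
    dsimp at *
    refine ⟨rfl, rfl, hA.insert one_ne_zero, ?_, by nlinarith⟩
    exact opt_join (k1.congr fun v hv => hf v (hlt v hv)) hwA hxA ((hf x2 h1).trans k2) hadj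
  · simp at h1
    obtain ⟨-, hno⟩ := hx.resolve_right fun h => by omega
    dsimp
    refine ⟨rfl, rfl, hA.insert one_ne_zero, ?_, by nlinarith⟩
    exact opt_free hopt hwA fun v hv hadj hm =>
      (hE v (hlt v hv)).2 ⟨hv, hm⟩ (hno v (hlt v hv) hadj)

theorem matchP_spec {m : Mach} {s : St} :
    wp m matchP s fun s' => s'.src = s.src ∧ Flags m.n s'.A (range m.n) ∧
      Opt m.H (range m.n) s'.M ∧ s'.T ≤ s.T + 4000 * (m.n + 1) ^ 3 := by
  refine wp_seq (wp_mono (clear_spec .A) ?_)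
  rintro _ ⟨T1, v1, A1, rfl, hT1, hA1⟩
  refine wp_for (fun i s' => s'.src = s.src ∧ s'.w = i ∧ Flags m.n s'.A (range i) ∧
      Opt m.H (range i) s'.M ∧
      s'.T ≤ s.T + 20 * m.n + 20 + (3000 * (m.n + 1) * (m.n + 1) + 10) * i) ?_ ?_ ?_
  · dsimp
    exact ⟨rfl, rfl, fun v hv => by simp [hA1 v hv], ⟨by simp [IsMat], by simp [fx]⟩, by omega⟩
  · rintro i hi s1 - ⟨h1, h2, h3, h4, h5⟩
    subst h2
    refine wp_mono (extendP_spec h3 (by simp; omega) h4 hi (by simp)) ?_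
    rintro s2 ⟨k1, k2, k3, k4, k5⟩
    dsimp at *
    rw [← range_add_one] at k3 k4
    exact ⟨k2, k1.trans h1, rfl, k3, k4, by linarith⟩
  · rintro s1 - ⟨h1, h2, h3, h4, h5⟩
    dsimp
    refine ⟨h1, h3, h4, ?_⟩
    ring_nf at *
    nlinarith

end GeoRAM

/-! ### The depth first search over positions of nonzero value -/

namespace GeoRAM

open WordRAM Matching Finset UndirectedGeography

open Classical in
/-- Number of positions visited from a position with `k` further vertices. -/
noncomputable def nodesAux (H : SimpleGraph ℕ) : ℕ → Finset ℕ → ℕ → ℕ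
  | 0, _, _ => 1
  | k + 1, R, v => 1 + ∑ w ∈ R with H.Adj v w ∧ nimberAt H (R.erase w) w ≠ 0,
      nodesAux H k (R.erase w) w

/-- Number of positions visited from a position when positions of value `0` are not entered. -/
noncomputable def nodes (H : SimpleGraph ℕ) (R : Finset ℕ) (v : ℕ) : ℕ := nodesAux H #R R v

open Classical in
theorem nodes_eq (H : SimpleGraph ℕ) (R : Finset ℕ) (v : ℕ) : nodes H R v =
    1 + ∑ w ∈ R with H.Adj v w ∧ nimberAt H (R.erase w) w ≠ 0, nodes H (R.erase w) w := by
  unfold nodes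
  rcases h : #R with _ | k
  · rw [card_eq_zero] at h
    simp [h, nodesAux]
  · rw [nodesAux]
    congr 1
    refine sum_congr rfl fun w hw => ?_
    rw [card_erase_of_mem (mem_filter.1 hw).1, h, Nat.add_sub_cancel]

/-- Move the token to `w` at depth `d`, and find out which options have value `0`. -/
def pushP : Prog :=
  sto .V (.v .d) (.v .w) ;; sto .pt (.v .d) (.lit 0) ;; sto .A (.v .w) (.lit 0) ;;
  sto .U (.v .d) (.get .M (.v .w)) ;; sto .M (.get .M (.v .w)) (.get .M (.v .w)) ;;
  sto .M (.v .w) (.v .w) ;; searchP ;;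
  forUp .v (sto .Z (.ix (.v .d) (.v .v)) (.get .E (.v .v)) ;;
    sto .SN (.ix (.v .d) (.v .v)) (.lit 0))

/-- Compute the value of the position at depth `d` and return from it. -/
def popP : Prog :=
  asg .k (.lit 0) ;;
  while_ (.get .SN (.ix (.v .d) (.v .k))) (asg .k (.inc (.v .k))) ;;
  asg .w (.get .V (.v .d)) ;; sto .A (.v .w) (.lit 1) ;;
  sto .M (.v .w) (.get .U (.v .d)) ;; sto .M (.get .U (.v .d)) (.v .w) ;;
  asg .d (.dec (.v .d)) ;; sto .SN (.ix (.v .d) (.v .k)) (.lit 1)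

/-- One step of the depth first search. -/
def stepP : Prog :=
  cond (.lt (.get .pt (.v .d)) .n)
    (asg .w (.get .pt (.v .d)) ;; sto .pt (.v .d) (.inc (.v .w)) ;;
      when (.adj (.get .V (.v .d)) (.v .w)) (when (.get .A (.v .w))
        (cond (.get .Z (.ix (.v .d) (.v .w))) (sto .SN (.ix (.v .d) (.lit 0)) (.lit 1))
          (asg .d (.inc (.v .d)) ;; pushP))))
    popP

/-- Compute the Grundy value. -/
def geoP : Prog :=
  matchP ;; searchP ;;
  cond (.get .E (.v .src)) (asg .k (.lit 0))
    (asg .w (.v .src) ;; asg .d (.lit 1) ;; pushP ;; while_ (.v .d) stepP)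

theorem storeRow_spec {m : Mach} {s : St} (hd : s.d ≤ m.n) :
    wp m (forUp .v (sto .Z (.ix (.v .d) (.v .v)) (.get .E (.v .v)) ;;
      sto .SN (.ix (.v .d) (.v .v)) (.lit 0))) s fun s' =>
      ∃ T' v' f g, s' = { s with T := T', v := v', Z := f, SN := g } ∧ T' ≤ s.T + 60 * m.n + 10 ∧
      (∀ v < m.n, rows m.n f s.d v = s.E v ∧ rows m.n g s.d v = 0) ∧
      ∀ e, e ≠ s.d → ∀ v < m.n, rows m.n f e v = rows m.n s.Z e v ∧
        rows m.n g e v = rows m.n s.SN e v := by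
  refine wp_for (fun i s' => ∃ T' f g, s' = { s with T := T', v := i, Z := f, SN := g } ∧
      T' ≤ s.T + 60 * i + 5 ∧
      (∀ v < i, rows m.n f s.d v = s.E v ∧ rows m.n g s.d v = 0) ∧
      ∀ e, e ≠ s.d → ∀ v < m.n, rows m.n f e v = rows m.n s.Z e v ∧
        rows m.n g e v = rows m.n s.SN e v) ?_ ?_ ?_
  · exact ⟨_, _, _, rfl, by dsimp; omega, by intros; omega, fun _ _ _ _ => ⟨rfl, rfl⟩⟩
  · rintro i hi _ - ⟨T1, f, g, rfl, hT, h1, h2⟩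
    refine wp_seq (wp_sto (by simp; omega) (by simp) ?_)
    refine wp_sto (by simp; omega) (by simp) ?_
    dsimp
    refine ⟨rfl, _, _, _, rfl, by omega, fun u hu => ?_, fun x hx u hu => ?_⟩
    · by_cases hui : u = i
      · simp [rows, hui]
      · have : s.d * m.n + u ≠ s.d * m.n + i := by omega
        simp only [rows, Function.update_of_ne this]
        exact h1 u (by omega)
    · have : x * m.n + u ≠ s.d * m.n + i := fun h => hx (ix_inj hu hi h).1
      simp only [rows, Function.update_of_ne this]
      exact h2 x hx u hu
  · rintro _ - ⟨T1, f, g, rfl, hT, h1, h2⟩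
    exact ⟨_, _, _, _, rfl, by dsimp; omega, h1, h2⟩

/-- Because `w` is covered by every maximum matching, `cut` keeps the matching maximum without a new
augmentation, and a single search then settles which options have value 0. The old partner of `w` is
kept in `U` for the way back. -/
theorem pushP_spec {m : Mach} {A : Finset ℕ} {s : St} (hA : Flags m.n s.A A)
    (hlt : ∀ v ∈ A, v < m.n) (hopt : Opt m.H A s.M) (hw : s.w ∈ A) (hm : ¬ Miss m.H A s.w)
    (hd : s.d ≤ m.n) :
    wp m pushP s fun s' => s'.d = s.d ∧ s'.V = Function.update s.V s.d s.w ∧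
      s'.pt = Function.update s.pt s.d 0 ∧ s'.U = Function.update s.U s.d (s.M s.w) ∧
      Flags m.n s'.A (A.erase s.w) ∧ s'.M = cut s.M s.w ∧
      (∀ v < m.n, (rows m.n s'.Z s.d v ≠ 0 ↔ v ∈ A.erase s.w ∧ Miss m.H (A.erase s.w) v) ∧
        rows m.n s'.SN s.d v = 0) ∧
      (∀ e, e ≠ s.d → ∀ v < m.n, rows m.n s'.Z e v = rows m.n s.Z e v ∧
        rows m.n s'.SN e v = rows m.n s.SN e v) ∧
      s'.T ≤ s.T + 3000 * (m.n + 1) * (m.n + 1) := by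
  refine wp_seq (wp_sto (by simp) (by simp) ?_)
  refine wp_seq (wp_sto (by simp) (by simp) ?_)
  refine wp_seq (wp_sto (by simp) (by simp) ?_)
  refine wp_seq (wp_sto (by simp) (by simp) ?_)
  refine wp_seq (wp_sto (by simp) (by simp) ?_)
  refine wp_seq (wp_sto (by simp) (by simp) ?_)
  dsimp
  refine wp_seq (wp_mono (searchP_spec (A := A.erase s.w) hA.erase
    (fun v hv => hlt v (mem_of_mem_erase hv)) (opt_cut hopt hw hm)) ?_)
  rintro _ ⟨⟨T1, _, _, _, NM1, _, _, _, _, _, _, _, _, _, _, E1, _, _, _, _, _, _, _, rfl⟩, hE, -, hT⟩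
  dsimp at hE hT
  refine wp_mono (storeRow_spec hd) ?_
  rintro _ ⟨T2, v2, f, g, rfl, hT2, h1, h2⟩
  dsimp at *
  refine ⟨rfl, rfl, rfl, rfl, hA.erase, rfl, fun v hv => ⟨?_, (h1 v hv).2⟩, h2, by nlinarith⟩
  rw [(h1 v hv).1]
  exact hE v hv

/-- The value is the first position of the row `SN` that is still 0. It is entered in the row of the
parent; from the root, at depth 1, this goes harmlessly to row 0. -/
theorem popP_spec {m : Mach} {A : Finset ℕ} {s : St} {k : ℕ} (hA : Flags m.n s.A A)
    (hd : s.d ≤ m.n) (hk : k < m.n) (hk1 : rows m.n s.SN s.d k = 0)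
    (hk2 : ∀ j < k, rows m.n s.SN s.d j ≠ 0) :
    wp m popP s fun s' => s'.d = s.d - 1 ∧ s'.V = s.V ∧ s'.pt = s.pt ∧ s'.U = s.U ∧ s'.k = k ∧
      Flags m.n s'.A (insert (s.V s.d) A) ∧
      s'.M = Function.update (Function.update s.M (s.V s.d) (s.U s.d)) (s.U s.d) (s.V s.d) ∧
      s'.Z = s.Z ∧ s'.SN = Function.update s.SN ((s.d - 1) * m.n + k) 1 ∧
      s'.T ≤ s.T + 40 * m.n + 150 := by
  refine wp_seq (wp_asg (by simp) ?_)
  dsimp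
  refine wp_seq (wp_mono (Q := fun s' => ∃ T', s' = { s with T := T', k := k } ∧
    T' ≤ s.T + 40 * m.n + 50) ?_ ?_)
  · refine wp_while (fun s' => ∃ T' k', s' = { s with T := T', k := k' } ∧
      T' ≤ s.T + 10 + 40 * k' ∧ k' ≤ k) (fun s' => k - s'.k) ?_ ?_ ?_ ?_
    · exact ⟨_, _, rfl, by omega, by omega⟩
    · rintro _ ⟨T1, k1, rfl, hT, hk'⟩
      simp
      omega
    · rintro _ ⟨T1, k1, rfl, hT, hk'⟩ h
      simp at h
      have : k1 ≠ k := fun h' => h (h' ▸ hk1)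
      refine wp_asg (by simp; omega) ?_
      dsimp
      exact ⟨⟨_, _, rfl, by omega, by omega⟩, by omega⟩
    · rintro _ ⟨T1, k1, rfl, hT, hk'⟩ h
      simp at h
      obtain rfl : k1 = k := by
        by_contra hne
        exact hk2 k1 (by omega) h
      exact ⟨_, rfl, by dsimp; omega⟩
  · rintro _ ⟨T1, rfl, hT⟩
    refine wp_seq (wp_asg (by simp) ?_)
    refine wp_seq (wp_sto (by simp) (by simp) ?_)
    refine wp_seq (wp_sto (by simp) (by simp) ?_)
    refine wp_seq (wp_sto (by simp) (by simp) ?_)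
    refine wp_seq (wp_asg (by simp) ?_)
    refine wp_sto (by simp; omega) (by simp) ?_
    dsimp
    exact ⟨rfl, rfl, rfl, rfl, rfl, hA.insert one_ne_zero, rfl, rfl, rfl, by omega⟩

/-- The loop started in `s` gets to a state that satisfies `P`. -/
def To (m : Mach) (s : St) (P : St → Prop) : Prop :=
  ∃ s', (∀ Q, wp m (while_ (.v .d) stepP) s' Q → wp m (while_ (.v .d) stepP) s Q) ∧ P s'

theorem To.ret {m : Mach} {s : St} {P : St → Prop} (h : P s) : To m s P := ⟨s, fun _ h => h, h⟩

theorem To.bind {m : Mach} {s : St} {P P' : St → Prop} (h : To m s P)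
    (h' : ∀ s', P s' → To m s' P') : To m s P' := by
  obtain ⟨s1, h1, h2⟩ := h
  obtain ⟨s2, h3, h4⟩ := h' s1 h2
  exact ⟨s2, fun Q hQ => h1 Q (h3 Q hQ), h4⟩

theorem To.step {m : Mach} {s : St} {P : St → Prop} (hd : s.d ≠ 0)
    (h : wp m stepP (s.tick 2) fun s' => To m s' P) : To m s P := by
  obtain ⟨s1, h1, s2, h2, h3⟩ := h
  exact ⟨s2, fun Q hQ => wp_loop_true (by simp) (by simpa using hd) ⟨s1, h1, h2 Q hQ⟩, h3⟩

/-- State right after moving the token to `v`, with `R` left. -/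
structure Entry (m : Mach) (R : Finset ℕ) (v : ℕ) (s : St) : Prop where
  d1 : 1 ≤ s.d
  dR : s.d + #R ≤ m.n
  V : s.V s.d = v
  pt : s.pt s.d = 0
  vR : v ∉ R
  vn : v < m.n
  Rn : ∀ w ∈ R, w < m.n
  A : Flags m.n s.A R
  opt : Opt m.H R s.M
  Z : ∀ w < m.n, rows m.n s.Z s.d w ≠ 0 ↔ w ∈ R ∧ Miss m.H R w
  SN : ∀ w < m.n, rows m.n s.SN s.d w = 0

open Classical in
/-- State after the options below `i` have been evaluated. -/
structure Node (m : Mach) (R : Finset ℕ) (v i : ℕ) (s0 s : St) : Prop where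
  d : s.d = s0.d
  V : ∀ e ≤ s0.d, s.V e = s0.V e
  U : ∀ e ≤ s0.d, s.U e = s0.U e
  pt : ∀ e < s0.d, s.pt e = s0.pt e
  ptd : s.pt s0.d = i
  A : Flags m.n s.A R
  M : s.M = s0.M
  Z : ∀ e ≤ s0.d, ∀ w < m.n, rows m.n s.Z e w = rows m.n s0.Z e w
  SN : ∀ e < s0.d, ∀ w < m.n, rows m.n s.SN e w = rows m.n s0.SN e w
  SNd : ∀ k < m.n, rows m.n s.SN s0.d k ≠ 0 ↔
    ∃ w ∈ R, w < i ∧ m.H.Adj v w ∧ nimberAt m.H (R.erase w) w = k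
  T : s.T ≤ s0.T + 100 * i + 5000 * (m.n + 1) * (m.n + 1) *
    ∑ w ∈ R with (m.H.Adj v w ∧ nimberAt m.H (R.erase w) w ≠ 0) ∧ w < i, nodes m.H (R.erase w) w

/-- State after the return from the position. -/
structure Left (m : Mach) (R : Finset ℕ) (v : ℕ) (s0 s : St) : Prop where
  d : s.d = s0.d - 1
  k : s.k = nimberAt m.H R v
  V : ∀ e < s0.d, s.V e = s0.V e
  U : ∀ e < s0.d, s.U e = s0.U e
  pt : ∀ e < s0.d, s.pt e = s0.pt e
  A : Flags m.n s.A (insert v R)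
  M : s.M = Function.update (Function.update s0.M v (s0.U s0.d)) (s0.U s0.d) v
  Z : ∀ e < s0.d, ∀ w < m.n, rows m.n s.Z e w = rows m.n s0.Z e w
  SN : ∀ e < s0.d - 1, ∀ w < m.n, rows m.n s.SN e w = rows m.n s0.SN e w
  SNd : ∀ k < m.n, rows m.n s.SN (s0.d - 1) k ≠ 0 ↔
    rows m.n s0.SN (s0.d - 1) k ≠ 0 ∨ k = nimberAt m.H R v
  T : s.T + 4000 * (m.n + 1) * (m.n + 1) ≤
    s0.T + 5000 * (m.n + 1) * (m.n + 1) * nodes m.H R v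

end GeoRAM

/-! ### Correctness and cost of the depth first search -/

namespace GeoRAM

open WordRAM Matching Finset UndirectedGeography

theorem sum_lt_succ {R : Finset ℕ} {p : ℕ → Prop} [DecidablePred p] (f : ℕ → ℕ) (i : ℕ) :
    ∑ w ∈ R with p w ∧ w < i + 1, f w =
      (∑ w ∈ R with p w ∧ w < i, f w) + if i ∈ R ∧ p i then f i else 0 := by
  split_ifs with h
  · have : {w ∈ R | p w ∧ w < i + 1} = insert i {w ∈ R | p w ∧ w < i} := by
      ext w
      simp only [mem_filter, mem_insert]
      constructor
      · rintro ⟨h1, h2, h3⟩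
        rcases Nat.lt_succ_iff_lt_or_eq.1 h3 with h3 | h3
        exacts [Or.inr ⟨h1, h2, h3⟩, Or.inl h3]
      · rintro (rfl | ⟨h1, h2, h3⟩)
        exacts [⟨h.1, h.2, by omega⟩, ⟨h1, h2, by omega⟩]
    rw [this, sum_insert (by simp), add_comm]
  · rw [add_zero]
    congr 1
    ext w
    simp only [mem_filter]
    refine and_congr_right fun h1 => and_congr_right fun h2 => ⟨fun h3 => ?_, fun h3 => by omega⟩
    rcases Nat.lt_succ_iff_lt_or_eq.1 h3 with h3 | rfl
    exacts [h3, absurd ⟨h1, h2⟩ h]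

variable {m : Mach} {R : Finset ℕ} {v i : ℕ} {s0 s s' : St}

theorem Entry.node (h : Entry m R v s0) : Node m R v 0 s0 s0 where
  d := rfl
  V _ _ := rfl
  U _ _ := rfl
  pt _ _ := rfl
  ptd := h.pt
  A := h.A
  M := rfl
  Z _ _ _ _ := rfl
  SN _ _ _ _ := rfl
  SNd k hk := by simp [h.SN k hk]
  T := by omega

open Classical in
theorem Node.next (h : Node m R v i s0 s) (hd : s'.d = s.d)
    (hV : ∀ e ≤ s.d, s'.V e = s.V e) (hU : ∀ e ≤ s.d, s'.U e = s.U e)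
    (hpt : ∀ e < s.d, s'.pt e = s.pt e) (hptd : s'.pt s.d = i + 1) (hA : Flags m.n s'.A R)
    (hM : s'.M = s.M) (hZ : ∀ e ≤ s.d, ∀ w < m.n, rows m.n s'.Z e w = rows m.n s.Z e w)
    (hSN : ∀ e < s.d, ∀ w < m.n, rows m.n s'.SN e w = rows m.n s.SN e w)
    (hSNd : ∀ k < m.n, rows m.n s'.SN s.d k ≠ 0 ↔ rows m.n s.SN s.d k ≠ 0 ∨
      (i ∈ R ∧ m.H.Adj v i ∧ nimberAt m.H (R.erase i) i = k))
    (hT : s'.T ≤ s.T + 100 + 5000 * (m.n + 1) * (m.n + 1) *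
      if i ∈ R ∧ m.H.Adj v i ∧ nimberAt m.H (R.erase i) i ≠ 0 then nodes m.H (R.erase i) i
        else 0) : Node m R v (i + 1) s0 s' := by
  rw [h.d] at hV hU hpt hptd hZ hSN hSNd
  refine ⟨hd.trans h.d, fun e he => (hV e he).trans (h.V e he),
    fun e he => (hU e he).trans (h.U e he), fun e he => (hpt e he).trans (h.pt e he), hptd, hA,
    hM.trans h.M, fun e he w hw => (hZ e he w hw).trans (h.Z e he w hw),
    fun e he w hw => (hSN e he w hw).trans (h.SN e he w hw), fun k hk => ?_, ?_⟩
  · rw [hSNd k hk, h.SNd k hk]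
    constructor
    · rintro (⟨w, h1, h2, h3⟩ | ⟨h1, h2⟩)
      exacts [⟨w, h1, by omega, h3⟩, ⟨i, h1, by omega, h2⟩]
    · rintro ⟨w, h1, h2, h3⟩
      rcases Nat.lt_succ_iff_lt_or_eq.1 h2 with h2 | rfl
      exacts [Or.inl ⟨w, h1, h2, h3⟩, Or.inr ⟨h1, h3⟩]
  · have := h.T
    rw [sum_lt_succ, Nat.mul_add]
    linarith

theorem update_rows {n d k : ℕ} (f : ℕ → ℕ) (hk : k < n) {e w : ℕ} (hw : w < n) :
    rows n (Function.update f (d * n + k) 1) e w ≠ 0 ↔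
      (rows n f e w ≠ 0 ∨ (e = d ∧ w = k)) := by
  simp only [rows, Function.update_apply]
  split_ifs with h
  · simp [ix_inj hw hk h]
  · have : ¬ (e = d ∧ w = k) := by
      rintro ⟨rfl, rfl⟩; exact h rfl
    simp [this]

theorem update_rows_ne {n d k : ℕ} (f : ℕ → ℕ) (hk : k < n) {e w : ℕ} (hw : w < n) (he : e ≠ d) :
    rows n (Function.update f (d * n + k) 1) e w = rows n f e w := by
  simp only [rows]
  rw [Function.update_of_ne]
  exact fun h => he (ix_inj hw hk h).1

/-- An option of value 0 is recorded directly from the row `Z`. Any other option is pushed,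
evaluated by the induction hypothesis and popped, after which the token set, the matching and the
lower part of the stack are as before. -/
theorem Node.step (h0 : Entry m R v s0) (h : Node m R v i s0 s) (hi : i < m.n)
    (ih : ∀ w ∈ R, ∀ s1, Entry m (R.erase w) w s1 →
      To m s1 (Left m (R.erase w) w s1)) : To m s (Node m R v (i + 1) s0) := by
  have hd1 := h0.d1
  have hdR := h0.dR
  have hVd : s.V s.d = v := by rw [h.d, h.V _ le_rfl, h0.V]
  have hpt : s.pt s.d = i := by rw [h.d, h.ptd]
  have hZ : ∀ w < m.n, rows m.n s.Z s.d w ≠ 0 ↔ w ∈ R ∧ Miss m.H R w := fun w hw => by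
    rw [h.d, h.Z _ le_rfl w hw, h0.Z w hw]
  have hnim : i ∈ R → (nimberAt m.H (R.erase i) i = 0 ↔ Miss m.H R i) := fun hiR => by
    rw [nimberAt_eq_zero_iff_miss _ _ _ (notMem_erase _ _), insert_erase hiR]
  have hAi := h.A i hi
  have hM := h.M
  refine To.step (by rw [h.d]; omega) ?_
  refine wp_cond (by simp) (fun _ => ?_) (fun h1 => ?_)
  swap
  · simp [hpt] at h1
    omega
  refine wp_seq (wp_asg (by simp) ?_)
  refine wp_seq (wp_sto (by simp) (by simp; omega) ?_)
  dsimp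
  rw [hpt]
  have hskip : ∀ T' ≤ s.T + 70, (i ∈ R → ¬ m.H.Adj v i) →
      Node m R v (i + 1) s0 { s with T := T', w := i, pt := Function.update s.pt s.d (i + 1) } := by
    intro T' hT' hno
    refine h.next rfl (fun _ _ => rfl) (fun _ _ => rfl)
      (fun e he => Function.update_of_ne he.ne _ _) (Function.update_self ..) h.A rfl
      (fun _ _ _ _ => rfl) (fun _ _ _ _ => rfl) (fun k hk => ?_) (by dsimp; omega)
    exact ⟨fun h => Or.inl h, fun h => h.resolve_right fun h => hno h.1 h.2.1⟩
  refine wp_when (by simp [hVd, hi, h0.vn]) (fun h1 => wp_when (by simp) (fun h2 =>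
    wp_cond (by simp [hi.le]; rw [h.d]; omega) (fun h3 => ?_) (fun h3 => ?_)) (fun h2 => ?_)) (fun h1 => ?_)
  · simp [hVd] at h1 h2 h3
    obtain ⟨hiR, hmiss⟩ := (hZ i hi).1 h3
    have hn0 := (hnim hiR).2 hmiss
    refine wp_sto (by simp; rw [h.d]; omega) (by simp) (To.ret ?_)
    dsimp
    refine h.next rfl (fun _ _ => rfl) (fun _ _ => rfl)
      (fun e he => Function.update_of_ne he.ne _ _) (Function.update_self ..) h.A rfl
      (fun _ _ _ _ => rfl) (fun e he w hw => update_rows_ne (k := 0) s.SN (by omega) hw he.ne)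
      (fun k hk => ?_) (by dsimp; omega)
    refine (update_rows (k := 0) s.SN (by omega) hk).trans ?_
    simp [hiR, h1, hn0, eq_comm]
  · simp [hVd] at h1 h2 h3
    have hiR := hAi.1 h2
    have hmiss : ¬ Miss m.H R i := fun h' => (hZ i hi).2 ⟨hiR, h'⟩ h3
    have hR := card_pos.2 ⟨i, hiR⟩
    refine wp_seq (wp_asg (by simp; rw [h.d]; omega) ?_)
    dsimp
    refine wp_mono (pushP_spec (A := R) h.A h0.Rn (by dsimp; rw [hM]; exact h0.opt) hiR hmiss
      (by dsimp; rw [h.d]; omega)) ?_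
    rintro s1 ⟨e1, e2, e3, e4, e5, e6, e7, e8, e9⟩
    dsimp at e1 e2 e3 e4 e5 e6 e7 e8 e9
    have hcard := card_erase_of_mem hiR
    have hd := h.d
    refine To.bind (ih i hiR s1 ⟨by omega, by omega, by simp [e1, e2], by simp [e1, e3],
      notMem_erase _ _, hi, fun w hw => h0.Rn w (mem_of_mem_erase hw), e5, ?_, ?_, ?_⟩) ?_
    · rw [e6, hM]
      exact opt_cut h0.opt hiR hmiss
    · intro w hw
      rw [e1]
      exact (e7 w hw).1
    · intro w hw
      rw [e1]
      exact (e7 w hw).2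
    · intro s2 hL
      refine To.ret (h.next ?_ ?_ ?_ ?_ ?_ ?_ ?_ ?_ ?_ ?_ ?_)
      · rw [hL.d, e1, Nat.add_sub_cancel]
      · intro e he
        rw [hL.V e (by omega), e2, Function.update_of_ne (by omega)]
      · intro e he
        rw [hL.U e (by omega), e4, Function.update_of_ne (by omega)]
      · intro e he
        rw [hL.pt e (by omega), e3, Function.update_of_ne (by omega),
          Function.update_of_ne (by omega)]
      · rw [hL.pt _ (by omega), e3, Function.update_of_ne (by omega), Function.update_self]
      · have := hL.A
        rwa [insert_erase hiR] at this
      -- `cut` alters the matching only at `i` and its partner, and the stored partner restores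
      -- both.
      · have hinv := (h0.opt.1 i hiR).2.1
        rw [← hM] at hinv
        rw [hL.M, e1, e4, Function.update_self, e6]
        funext u
        simp only [cut, Function.update_apply]
        split_ifs with k1 k2 <;> simp_all
      · intro e he w hw
        rw [hL.Z e (by omega) w hw, (e8 e (by omega) w hw).1]
      · intro e he w hw
        rw [hL.SN e (by omega) w hw, (e8 e (by omega) w hw).2]
      · intro k hk
        have := hL.SNd k hk
        rw [e1, Nat.add_sub_cancel] at this
        rw [this, (e8 s.d (by omega) k hk).2]
        simp [hiR, h1, eq_comm]
      -- The push takes place before the entry state of the child; it is paid for by the `4000 *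
      -- (m.n + 1) * (m.n + 1)` that `Left.T` leaves unspent.
      · have := hL.T
        rw [if_pos ⟨hiR, h1, fun h => hmiss ((hnim hiR).1 h)⟩]
        nlinarith
  · simp [hVd] at h1 h2
    dsimp
    exact To.ret (hskip _ (by omega) fun h' => absurd h2 (hAi.2 h'))
  · simp [hVd] at h1
    dsimp
    exact To.ret (hskip _ (by omega) fun _ => h1)

-- With all options treated, the row `SN` holds exactly the set of their values. As `d ≥ 1` and `d +
-- #R ≤ n`, the value is at most `#R < n`, so the search for the first gap stays inside the row.
open Classical in
theorem Node.leave (h0 : Entry m R v s0) (h : Node m R v m.n s0 s) :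
    To m s (Left m R v s0) := by
  have hd1 := h0.d1
  have hdR := h0.dR
  have hVd : s.V s.d = v := by rw [h.d, h.V _ le_rfl, h0.V]
  have hpt : s.pt s.d = m.n := by rw [h.d, h.ptd]
  have hle := nimberAt_le m.H R v
  have hopts : ∀ k < m.n, rows m.n s.SN s.d k ≠ 0 ↔
      k ∈ {k | ∃ v_1 ∈ R, m.H.Adj v v_1 ∧ nimberAt m.H (R.erase v_1) v_1 = k} := fun k hk => by
    rw [h.d, h.SNd k hk]
    exact ⟨fun ⟨w, h1, _, h2⟩ => ⟨w, h1, h2⟩, fun ⟨w, h1, h2⟩ => ⟨w, h1, h0.Rn w h1, h2⟩⟩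
  have hd := h.d
  refine To.step (by omega) (wp_cond (by simp) (fun h1 => ?_) (fun _ => ?_))
  · simp [hpt] at h1
  refine wp_mono (popP_spec (A := R) (k := nimberAt m.H R v) h.A (by dsimp; omega) (by omega)
    ?_ ?_) ?_
  · by_contra hne
    rw [← ne_eq, St.tick, St.tick, hopts _ (by omega)] at hne
    nth_rewrite 1 [nimberAt_eq] at hne
    exact mex_notMem (options_finite ..) hne
  · intro j hj
    rw [St.tick, St.tick, hopts _ (by omega)]
    rw [nimberAt_eq] at hj
    exact mem_of_lt_mex hj
  · rintro s1 ⟨e1, e2, e3, e4, e5, e6, e7, e8, e9, e10⟩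
    dsimp at e1 e2 e3 e4 e5 e6 e7 e8 e9 e10
    rw [hVd] at e6 e7
    refine To.ret ⟨by rw [e1, hd], e5, fun e he => by rw [e2, h.V e he.le],
      fun e he => by rw [e4, h.U e he.le], fun e he => by rw [e3, h.pt e he], e6,
      by rw [e7, h.M, hd, h.U _ le_rfl], fun e he w hw => by rw [e8, h.Z e he.le w hw],
      fun e he w hw => ?_, fun k hk => ?_, ?_⟩
    · rw [e9, update_rows_ne _ (by omega) hw (by omega), h.SN e (by omega) w hw]
    · rw [e9, update_rows _ (by omega) hk, h.SN _ (by omega) k hk, hd]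
      simp
    · have hT := h.T
      have : {w ∈ R | (m.H.Adj v w ∧ nimberAt m.H (R.erase w) w ≠ 0) ∧ w < m.n} =
          {w ∈ R | m.H.Adj v w ∧ nimberAt m.H (R.erase w) w ≠ 0} :=
        filter_congr fun w hw => and_iff_left (h0.Rn w hw)
      rw [this] at hT
      rw [nodes_eq, Nat.mul_add]
      nlinarith

theorem Entry.visit (h : Entry m R v s0) : To m s0 (Left m R v s0) := by
  induction hk : #R using Nat.strong_induction_on generalizing R v s0 with
  | _ k ih =>
    have key : ∀ i ≤ m.n, To m s0 (Node m R v i s0) := by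
      intro i
      induction i with
      | zero => exact fun _ => To.ret h.node
      | succ i ihi =>
        refine fun hi => (ihi (by omega)).bind fun s hs => hs.step h hi fun w hw s1 h1 => ?_
        have := card_pos.2 ⟨w, hw⟩
        exact ih _ (by rw [← hk, card_erase_of_mem hw]; omega) h1 rfl
    exact (key m.n le_rfl).bind fun s hs => hs.leave h

/-- The program computes the Grundy value. -/
theorem geoP_spec {s : St} (hs : s.src < m.n) :
    wp m geoP s fun s' => s'.k = nimberAt m.H ((range m.n).erase s.src) s.src ∧
      s'.T ≤ s.T + 7000 * (m.n + 1) ^ 3 +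
        5000 * (m.n + 1) * (m.n + 1) * nodes m.H ((range m.n).erase s.src) s.src := by
  have hsR := mem_range.2 hs
  have hz := nimberAt_eq_zero_iff_miss m.H ((range m.n).erase s.src) s.src (notMem_erase _ _)
  rw [insert_erase hsR] at hz
  refine wp_seq (wp_mono matchP_spec ?_)
  rintro s1 ⟨h1, h2, h3, h4⟩
  refine wp_seq (wp_mono (searchP_spec h2 (by simp) h3) ?_)
  rintro s2 ⟨hf, hE, -, hT⟩
  have e1 : s2.src = s1.src ∧ s2.A = s1.A ∧ s2.M = s1.M := by
    obtain ⟨_, _, _, _, _, _, _, _, _, _, _, _, _, _, _, _, _, _, _, _, _, _, _, rfl⟩ := hf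
    exact ⟨rfl, rfl, rfl⟩
  obtain ⟨e1, e2, e3⟩ := e1
  rw [h1] at e1
  have hEs := hE s.src hs
  have hN : (m.n + 1) * (m.n + 1) ≤ (m.n + 1) ^ 3 := by
    rw [← sq]; exact Nat.pow_le_pow_right (by omega) (by omega)
  refine wp_cond (by simp) (fun h => wp_asg (by simp) ?_) (fun h => ?_)
  · simp [e1] at h
    dsimp
    refine ⟨(hz.2 (hEs.1 h).2).symm, ?_⟩
    nlinarith
  · simp [e1] at h
    have hmiss : ¬ Miss m.H (range m.n) s.src := fun h' => hEs.2 ⟨hsR, h'⟩ h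
    refine wp_seq (wp_asg (by simp) ?_)
    refine wp_seq (wp_asg (by simp) ?_)
    dsimp
    refine wp_seq (wp_mono (pushP_spec (A := range m.n) (by dsimp; rw [e2]; exact h2) (by simp)
      (by dsimp; rw [e3]; exact h3) (by dsimp; rw [e1]; exact hsR) (by dsimp; rw [e1]; exact hmiss)
      (by dsimp; omega)) ?_)
    rintro s3 ⟨k1, k2, k3, k4, k5, k6, k7, k8, k9⟩
    dsimp at k1 k2 k3 k4 k5 k6 k7 k8 k9
    rw [e1] at k2 k5 k6 k7
    have hE3 : Entry m ((range m.n).erase s.src) s.src s3 :=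
      ⟨by omega, by rw [k1, card_erase_of_mem hsR, card_range]; omega, by simp [k1, k2],
        by simp [k1, k3], notMem_erase _ _, hs, fun w hw => mem_range.1 (mem_of_mem_erase hw),
        k5, by rw [k6, e3]; exact opt_cut h3 hsR hmiss,
        fun w hw => by rw [k1]; exact (k7 w hw).1, fun w hw => by rw [k1]; exact (k7 w hw).2⟩
    obtain ⟨s4, h5, hL⟩ := hE3.visit
    refine h5 _ (wp_loop_false (by simp) (by simp [hL.d, k1]) ⟨hL.k, ?_⟩)
    have := hL.T
    dsimp
    nlinarith

end GeoRAM

/-! ### Counting the positions visited, and the final time bound -/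

namespace GeoRAM

open WordRAM Finset UndirectedGeography

open Classical in
/-- Number of neighbours below `n`. -/
noncomputable def deg (H : SimpleGraph ℕ) (n v : ℕ) : ℕ := #{u ∈ range n | H.Adj v u}

open Classical in
theorem deg_le (H : SimpleGraph ℕ) (n v : ℕ) : deg H n v ≤ n :=
  (card_filter_le _ _).trans_eq (card_range n)

variable {H : SimpleGraph ℕ} {n v : ℕ} {R : Finset ℕ} {f : ℕ → ℕ}

open Classical in
/-- The token came to `v` along an edge, so one neighbour is gone, and a position of value
different from `0` has an option of value `0`. -/
theorem card_entered_le (hf1 : 1 ≤ f v) (hf : deg H n v ≤ 3 ∨ deg H n v ≤ f v + 1)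
    (hR : R ⊆ range n) (hv : ∃ u < n, u ∉ R ∧ H.Adj v u) (hne : nimberAt H R v ≠ 0) :
    #{w ∈ R | H.Adj v w ∧ nimberAt H (R.erase w) w ≠ 0} ≤ f v := by
  obtain ⟨u, hu, huR, huv⟩ := hv
  have h0 : ∃ w ∈ R, H.Adj v w ∧ nimberAt H (R.erase w) w = 0 := by
    rw [nimberAt_eq] at hne
    exact mem_of_lt_mex (Nat.pos_of_ne_zero hne)
  obtain ⟨w, hwR, hvw, hw0⟩ := h0
  have hsub : insert u (insert w {w ∈ R | H.Adj v w ∧ nimberAt H (R.erase w) w ≠ 0}) ⊆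
      {u ∈ range n | H.Adj v u} := by
    intro x hx
    simp only [mem_insert, mem_filter] at hx
    rcases hx with rfl | rfl | hx
    · exact mem_filter.2 ⟨mem_range.2 hu, huv⟩
    · exact mem_filter.2 ⟨hR hwR, hvw⟩
    · exact mem_filter.2 ⟨hR hx.1, hx.2.1⟩
  have hcard := card_le_card hsub
  rw [card_insert_of_notMem, card_insert_of_notMem (by simp [hw0])] at hcard
  · unfold deg at hf
    omega
  · simp only [mem_insert, mem_filter, not_or]
    exact ⟨fun h => huR (h ▸ hwR), fun h => huR h.1⟩

/-- Every level of the tree has at most `∏ f` nodes, as each vertex is used at most once on a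
branch, and there are at most `#R + 1` levels. -/
theorem nodes_le (hf1 : ∀ w, 1 ≤ f w) (hf : ∀ w < n, deg H n w ≤ 3 ∨ deg H n w ≤ f w + 1)
    (hR : R ⊆ range n) (hvn : v < n) (hvR : v ∉ R) (hv : ∃ u < n, u ∉ R ∧ H.Adj v u)
    (hne : nimberAt H R v ≠ 0) : nodes H R v ≤ (#R + 1) * ∏ w ∈ insert v R, f w := by
  classical
  induction hk : #R generalizing R v with
  | zero =>
    rw [card_eq_zero] at hk
    subst hk
    rw [nodes_eq]
    simpa using hf1 v
  | succ k ih =>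
    rw [nodes_eq, prod_insert hvR]
    have h1 : ∀ w ∈ {w ∈ R | H.Adj v w ∧ nimberAt H (R.erase w) w ≠ 0},
        nodes H (R.erase w) w ≤ (k + 1) * ∏ w ∈ R, f w := by
      intro w hw
      obtain ⟨hwR, hvw, hw0⟩ := mem_filter.1 hw
      have := ih ((erase_subset _ _).trans hR) (mem_range.1 (hR hwR)) (notMem_erase _ _)
        ⟨v, hvn, fun h => hvR (mem_of_mem_erase h), hvw.symm⟩ hw0
        (by rw [card_erase_of_mem hwR, hk, Nat.add_sub_cancel])
      rwa [insert_erase hwR] at this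
    have h2 := (sum_le_sum h1).trans_eq (sum_const _)
    rw [smul_eq_mul] at h2
    have h3 := h2.trans (Nat.mul_le_mul_right _
      (card_entered_le (hf1 v) (hf v hvn) hR hv hne))
    have h4 : 1 ≤ f v * ∏ w ∈ R, f w := Nat.mul_pos (hf1 v) (prod_pos fun w _ => hf1 w)
    nlinarith

/-- The starting position, where no neighbour of `v` is gone yet. -/
theorem nodes_root_le (hf1 : ∀ w, 1 ≤ f w)
    (hf : ∀ w < n, deg H n w ≤ 3 ∨ deg H n w ≤ f w + 1) (hvn : v < n) :
    nodes H ((range n).erase v) v ≤ 3 * n * ∏ w ∈ range n, f w := by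
  classical
  have hv := mem_range.2 hvn
  rw [nodes_eq, ← mul_prod_erase _ _ hv]
  set R := (range n).erase v
  have hRc : #R + 1 = n := by rw [card_erase_of_mem hv, card_range]; omega
  have h1 : ∀ w ∈ {w ∈ R | H.Adj v w ∧ nimberAt H (R.erase w) w ≠ 0},
      nodes H (R.erase w) w ≤ #R * ∏ w ∈ R, f w := by
    intro w hw
    obtain ⟨hwR, hvw, hw0⟩ := mem_filter.1 hw
    have := nodes_le hf1 hf ((erase_subset w R).trans (erase_subset _ _))
      (mem_range.1 (mem_of_mem_erase hwR)) (notMem_erase _ _)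
      ⟨v, hvn, fun h => notMem_erase v _ (mem_of_mem_erase h), hvw.symm⟩ hw0
    rwa [insert_erase hwR, card_erase_add_one hwR] at this
  have h2 := (sum_le_sum h1).trans_eq (sum_const _)
  rw [smul_eq_mul] at h2
  -- At the root nothing is saved, but `deg` is at most 3 or at most `f v + 1`, hence at most `3 * f
  -- v` in either case.
  have hc : #{w ∈ R | H.Adj v w ∧ nimberAt H (R.erase w) w ≠ 0} ≤ 3 * f v := by
    have h3 : #{w ∈ R | H.Adj v w ∧ nimberAt H (R.erase w) w ≠ 0} ≤ deg H n v := by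
      refine card_le_card fun w hw => ?_
      obtain ⟨hwR, hvw, -⟩ := mem_filter.1 hw
      exact mem_filter.2 ⟨mem_of_mem_erase hwR, hvw⟩
    have := hf1 v
    rcases hf v hvn with h | h <;> omega
  have h3 := h2.trans (Nat.mul_le_mul_right _ hc)
  have h4 : 1 ≤ f v * ∏ w ∈ R, f w := Nat.mul_pos (hf1 v) (prod_pos fun w _ => hf1 w)
  nlinarith

theorem deg_map {n : ℕ} (G : SimpleGraph (Fin n)) [DecidableRel G.Adj] (v : Fin n) :
    deg (G.map Fin.valEmbedding) n v = G.degree v := by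
  classical
  rw [deg, ← G.card_neighborFinset_eq_degree, ← card_map Fin.valEmbedding]
  congr 1
  ext u
  rw [@mem_filter, SimpleGraph.map_adj]
  simp only [mem_range, mem_map, SimpleGraph.mem_neighborFinset, Fin.valEmbedding_apply]
  constructor
  · rintro ⟨_, a, b, h, ha, rfl⟩
    exact ⟨b, (Fin.ext ha : a = v) ▸ h, rfl⟩
  · rintro ⟨b, h, rfl⟩
    exact ⟨b.2, v, b, h, rfl, rfl⟩

/-- Bound for the number of options entered from a vertex of degree `d`. -/
def weight (Δ n d : ℕ) : ℕ :=
  (if 4 ≤ d ∧ d ≤ Δ + 1 then Δ else 1) * (if 4 ≤ d ∧ Δ + 1 < d then n else 1)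

theorem weight_pos {Δ n : ℕ} (hΔ : 1 ≤ Δ) (hn : 1 ≤ n) (d : ℕ) : 1 ≤ weight Δ n d := by
  unfold weight
  refine Nat.mul_pos ?_ ?_ <;> split_ifs <;> omega

theorem le_weight {Δ n d : ℕ} (hd : d ≤ n) : d ≤ 3 ∨ d ≤ weight Δ n d + 1 := by
  unfold weight
  split_ifs <;> omega

/-- The factor `n` is given only to vertices of degree above `Δ + 1`, which are among the at most
`D` vertices of degree above `Δ`. -/
theorem prod_weight_le {n Δ D : ℕ} (hn : 1 ≤ n) (G : SimpleGraph (Fin n)) [DecidableRel G.Adj]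
    (hD : #{v | Δ < G.degree v} ≤ D) :
    ∏ w ∈ range n, weight Δ n (deg (G.map Fin.valEmbedding) n w) ≤
      Δ ^ #{v | 4 ≤ G.degree v ∧ G.degree v ≤ Δ + 1} * n ^ D := by
  rw [prod_range]
  simp only [deg_map, weight, prod_mul_distrib, prod_ite, prod_const, one_pow, mul_one]
  refine Nat.mul_le_mul_left _ (Nat.pow_le_pow_right hn (le_trans (card_le_card ?_) hD))
  intro v hv
  simp only [mem_filter, mem_univ, true_and] at hv ⊢
  omega

/-- With `X = 2 ^ Nat.size n ≥ n + 1` the left side is at most `81 * (n + 1) ^ 2 ≤ 2 ^ 7 * X ^ 2 ≤ X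
^ 9`, which is where the factor 9 in the word length comes from. -/
theorem word_size {n : ℕ} (hn : 1 ≤ n) : n * n + 16 * bnd n + 16 ≤ 2 ^ (9 * Nat.size n) := by
  have h1 := Nat.lt_size_self n
  have h2 : 2 ≤ 2 ^ Nat.size n := by omega
  rw [mul_comm 9, pow_mul]
  generalize 2 ^ Nat.size n = X at *
  have h3 : 2 ^ 7 ≤ X ^ 7 := Nat.pow_le_pow_left h2 7
  have h4 : X ^ 9 = X ^ 7 * X ^ 2 := by ring
  have h5 : 2 ^ 7 * X ^ 2 ≤ X ^ 9 := h4 ▸ Nat.mul_le_mul_right _ h3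
  have h6 : (n + 1) ^ 2 ≤ X ^ 2 := Nat.pow_le_pow_left (by omega) 2
  unfold bnd
  nlinarith

/-- The start state of the algorithm. -/
def startSt (a : ℕ) : St := ⟨0, a, 0, 0, 0, 0, 0, 0, 0, 0, 0, 0, 0, 0, 0, 0, 0, 0, 0, 0, fun _ => 0,
  fun _ => 0, fun _ => 0, fun _ => 0, fun _ => 0, fun _ => 0, fun _ => 0, fun _ => 0, fun _ => 0,
  fun _ => 0, fun _ => 0, fun _ => 0, fun _ => 0, fun _ => 0⟩

theorem rep_start {m : Mach} (G : SimpleGraph (Fin m.n)) [DecidableRel G.Adj] (s : Fin m.n)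
    (hH : m.H = G.map Fin.valEmbedding) : Rep m (graphInput G s) (startSt s) where
  n := by simp [graphInput]
  reg r := by cases r <;> simp [graphInput, startSt, Vr.idx]
  lt r := by
    have := le_bnd m.n
    have := s.2
    cases r <;> simp [startSt] <;> omega
  arr a i _ := by
    have : (startSt s).getA a i = 0 := by cases a <;> rfl
    rw [this]
    refine if_neg ?_
    rintro ⟨x, y, h, -⟩
    have := Nat.mul_le_mul_right m.n (Nat.succ_le_of_lt x.2)
    rw [Nat.succ_mul] at this
    have := y.2
    omega
  alt a i _ := by
    have := le_bnd m.n
    cases a <;> simp [startSt] <;> omega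
  adj i j hi hj := by
    simp only [graphInput, flag]
    congr 1
    rw [hH, SimpleGraph.map_adj]
    refine propext ⟨?_, ?_⟩
    · rintro ⟨x, y, h, hadj⟩
      obtain ⟨h1, h2⟩ := ix_inj hj y.2 h
      exact ⟨x, y, hadj, h1.symm, h2.symm⟩
    · rintro ⟨x, y, hadj, rfl, rfl⟩
      exact ⟨x, y, rfl, hadj⟩

theorem nimber_map {n : ℕ} (G : SimpleGraph (Fin n)) (s : Fin n) :
    nimberAt (G.map Fin.valEmbedding) ((range n).erase s) s = nimber G s := by
  rw [nimber, ← nimberAt_map G Fin.valEmbedding]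
  congr 1
  ext v
  simp only [mem_erase, mem_range, mem_map, mem_univ, and_true, Fin.valEmbedding_apply]
  constructor
  · rintro ⟨h1, h2⟩
    exact ⟨⟨v, h2⟩, fun h => h1 (congrArg Fin.val h), rfl⟩
  · rintro ⟨a, h, rfl⟩
    exact ⟨fun h' => h (Fin.ext h'), a.2⟩

/-- From `n + 1 ≤ 2 * n` the constant is at most `8 * 7000 + 12 * 5000 + 2 ≤ 120000`. The exponent
comes from `Δ ^ q ≤ Δ ^ (c * log₂ n) = n ^ (c * log₂ Δ)`. -/
theorem exec_time_le {n D Δ : ℕ} (hn : 1 ≤ n) (hΔ : 1 ≤ Δ) {c : ℝ} {q : ℕ}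
    (hq : (q : ℝ) ≤ c * Real.logb 2 n) {t P : ℕ} (hP1 : 1 ≤ P) (hP : P ≤ Δ ^ q * n ^ D)
    (ht : t ≤ 7000 * (n + 1) ^ 3 + 5000 * (n + 1) * (n + 1) * (3 * n * P) + 2) :
    (t : ℝ) ≤ 120000 * (n : ℝ) ^ ((D : ℝ) + c * Real.logb 2 Δ + 3) := by
  have hn0 : (0 : ℝ) < n := by exact_mod_cast hn
  have hΔ0 : (0 : ℝ) < Δ := by exact_mod_cast hΔ
  have h1 : t ≤ 120000 * (n ^ 3 * P) := by
    have a1 : (n + 1) ^ 3 ≤ (2 * n) ^ 3 := Nat.pow_le_pow_left (by omega) 3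
    have a2 : (n + 1) * (n + 1) ≤ (2 * n) * (2 * n) := Nat.mul_le_mul (by omega) (by omega)
    have a3 : (n + 1) * (n + 1) * (3 * n * P) ≤ (2 * n) * (2 * n) * (3 * n * P) :=
      Nat.mul_le_mul_right _ a2
    have a4 : 1 ≤ n ^ 3 := Nat.one_le_pow _ _ hn
    have a5 : n ^ 3 ≤ n ^ 3 * P := Nat.le_mul_of_pos_right _ hP1
    have a6 : (2 * n) ^ 3 = 8 * n ^ 3 := by ring
    have a7 : (2 * n) * (2 * n) * (3 * n * P) = 12 * (n ^ 3 * P) := by ring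
    have a8 : 5000 * (n + 1) * (n + 1) * (3 * n * P) = 5000 * ((n + 1) * (n + 1) * (3 * n * P)) := by
      ring
    omega
  have h2 : (Δ : ℝ) ^ q ≤ (n : ℝ) ^ (c * Real.logb 2 Δ) := by
    have b1 : (Δ : ℝ) ^ (q : ℝ) ≤ (Δ : ℝ) ^ (c * Real.logb 2 n) :=
      Real.rpow_le_rpow_of_exponent_le (by exact_mod_cast hΔ) hq
    rw [Real.rpow_natCast] at b1
    refine b1.trans_eq ?_
    rw [Real.rpow_def_of_pos hΔ0, Real.rpow_def_of_pos hn0, Real.logb, Real.logb]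
    congr 1
    ring
  calc (t : ℝ) ≤ 120000 * ((n : ℝ) ^ 3 * P) := by exact_mod_cast h1
    _ ≤ 120000 * ((n : ℝ) ^ 3 * ((Δ : ℝ) ^ q * (n : ℝ) ^ D)) := by
      gcongr
      exact_mod_cast hP
    _ ≤ 120000 * ((n : ℝ) ^ 3 * ((n : ℝ) ^ (c * Real.logb 2 Δ) * (n : ℝ) ^ D)) := by gcongr
    _ = 120000 * (n : ℝ) ^ ((D : ℝ) + c * Real.logb 2 Δ + 3) := by
      rw [Real.rpow_add hn0, Real.rpow_add hn0, Real.rpow_natCast]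
      norm_cast
      ring

end GeoRAM

theorem mainTheorem8 (D Δ : ℕ) (hΔ : 1 ≤ Δ) (c : ℝ) :
    ∃ (P : WordRAM.Prog) (k : ℕ) (C : ℝ), 0 < k ∧
      ∀ (n : ℕ) (G : SimpleGraph (Fin n)) [DecidableRel G.Adj] (s : Fin n),
        ((Finset.univ.filter fun v => 4 ≤ G.degree v ∧ G.degree v ≤ Δ + 1).card : ℝ)
            ≤ c * Real.logb 2 n →
        (Finset.univ.filter fun v => Δ < G.degree v).card ≤ D →
        ∃ (t : ℕ) (τ : WordRAM.State),
          WordRAM.Exec (k * Nat.size n) P (WordRAM.graphInput G s) t τ ∧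
          τ.reg 0 = UndirectedGeography.nimber G s ∧
          (t : ℝ) ≤ C * (n : ℝ) ^ ((D : ℝ) + c * Real.logb 2 Δ + 3) := by
  -- Register 0 held `n` during the run; the last assignment puts the answer there and accounts for
  -- the two extra steps in the bound.
  refine ⟨.seq GeoRAM.geoP (.assign 0 (.reg (GeoRAM.Vr.k.idx + 1))), 9, 120000, by norm_num, ?_⟩
  intro n G _ s hq hD
  have hn : 1 ≤ n := by have := s.2; omega
  let m : GeoRAM.Mach := ⟨n, 9 * Nat.size n, G.map Fin.valEmbedding, GeoRAM.word_size hn⟩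
  obtain ⟨s', hr, hk, hT⟩ := GeoRAM.geoP_spec (m := m) (s := GeoRAM.startSt s) s.2
  obtain ⟨τ, t, he, hrep, ht⟩ := hr _ (GeoRAM.rep_start (m := m) G s rfl)
  refine ⟨_, _, .seq he (.assign τ 0 (.reg (GeoRAM.Vr.k.idx + 1))), ?_, ?_⟩
  · change Function.update τ.reg 0 (τ.reg (GeoRAM.Vr.k.idx + 1)) 0 = _
    rw [Function.update_self]
    exact (hrep.reg .k).trans (hk.trans (GeoRAM.nimber_map G s))
  · have hw1 := fun w => GeoRAM.weight_pos hΔ hn (GeoRAM.deg (G.map Fin.valEmbedding) n w)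
    refine GeoRAM.exec_time_le (P := ∏ w ∈ Finset.range n,
      GeoRAM.weight Δ n (GeoRAM.deg (G.map Fin.valEmbedding) n w)) hn hΔ hq
      (Nat.succ_le_of_lt (Finset.prod_pos fun w _ => hw1 w)) (GeoRAM.prod_weight_le hn G hD) ?_
    have hnodes := GeoRAM.nodes_root_le (H := G.map Fin.valEmbedding) hw1
      (fun w _ => GeoRAM.le_weight (GeoRAM.deg_le _ n w)) s.2
    refine (Nat.add_le_add_right (((Nat.le_add_left _ _).trans ht).trans hT) _).trans ?_
    have := Nat.mul_le_mul_left (5000 * (n + 1) * (n + 1)) hnodes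
    change 0 + 7000 * (n + 1) ^ 3 + 5000 * (n + 1) * (n + 1) * _ + 2 ≤ _
    rw [Nat.zero_add]
    exact Nat.add_le_add_right (Nat.add_le_add_left this _) _
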